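/- Let $\mu>0$ and $\mathbb{R}^+=(0,\infty)$. Let $u_0\in L^2(\mathbb{R}^2;\mathbb{R}^2)$ satisfy $\operatorname{div}u_0=0$ in the sense of distributions, and let $$u\in L^\infty\big(\mathbb{R}^+;L^2(\mathbb{R}^2;\mathbb{R}^2)\big)\cap L^2\big(\mathbb{R}^+;\dot H^1(\mathbb{R}^2;\mathbb{R}^2)\big)$$ be a Leray solution of the two-dimensional incompressible Navier--Stokes system $$\partial_t u+u\cdot\nabla u-\mu\Delta u=-\nabla p,\qquad \operatorname{div}u=0,\qquad u|_{t=0}=u_0 ,$$ that is, $\operatorname{div}u(t)=0$ in the sense of distributions for almost every $t>0$, and for every $\varphi\in C_c^\infty(\mathbb{R}\times\mathbb{R}^2;\mathbb{R}^2)$ with $\operatorname{div}_x\varphi=0$, $$\int_0^\infty\!\!\int_{\mathbb{R}^2}\big(u\cdot\partial_t\varphi+(u\otimes u):\nabla\varphi+\mu\,u\cdot\Delta\varphi\big)\,dx\,dt=-\int_{\mathbb{R}^2}u_0(x)\cdot\varphi(0,x)\,dx .$$ (No energy inequality needs to be assumed.) Then $u\in L^2(\mathbb{R}^+;L^\infty(\mathbb{R}^2;\mathbb{R}^2))$,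 i.e. $\int_0^\infty\|u(t)\|_{L^\infty}^2\,dt<\infty$. -/

import Mathlib

open MeasureTheory Set
open scoped ENNReal ContDiff InnerProductSpace Laplacian

namespace NavierStokes2D

/-- The Euclidean plane `ℝ²`, used both for positions and for velocities. -/
abbrev Plane : Type := EuclideanSpace ℝ (Fin 2)

/-- Membership in `L^p(ℝ⁺; L^q(ℝ²))`, where `ℝ⁺ = (0, ∞)`: the function is measurable in `(t, x)`
and the `L^p` norm in time of the `L^q` norm in space is finite. -/
def MemLpLq {F : Type*} [NormedAddCommGroup F] (p q : ℝ≥0∞) (f : ℝ → Plane → F) : Prop :=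
  AEStronglyMeasurable (fun z : ℝ × Plane => f z.1 z.2)
      (((volume : Measure ℝ).restrict (Ioi 0)).prod (volume : Measure Plane)) ∧
    eLpNorm (fun t : ℝ => eLpNorm (f t) q (volume : Measure Plane)) p
      ((volume : Measure ℝ).restrict (Ioi 0)) < (⊤ : ℝ≥0∞)

/-- `G` is the weak (distributional) gradient of `v`; here `G x e` is the derivative of `v` at `x`
in the direction `e`. -/
def IsWeakGradient (v : Plane → Plane) (G : Plane → Plane →L[ℝ] Plane) : Prop :=
  LocallyIntegrable v volume ∧ LocallyIntegrable G volume ∧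
    ∀ φ : Plane → ℝ, ContDiff ℝ ∞ φ → HasCompactSupport φ → ∀ e : Plane,
      ∫ x, fderiv ℝ φ x e • v x = -∫ x, φ x • G x e

/-- Membership in `L²(ℝ⁺; Ḣ¹(ℝ²))`, for velocity fields `u` with `u(t) ∈ L²(ℝ²)` for almost every
`t > 0`: the spatial weak gradient `∇u` exists and belongs to `L²(ℝ⁺; L²(ℝ²))`. -/
def MemL2HomogeneousH1 (u : ℝ → Plane → Plane) : Prop :=
  ∃ G : ℝ → Plane → Plane →L[ℝ] Plane, MemLpLq 2 2 G ∧
    ∀ᵐ t ∂(volume : Measure ℝ).restrict (Ioi 0), IsWeakGradient (u t) (G t)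

/-- `div v = 0` in the sense of distributions, for locally integrable `v`. -/
def IsWeaklyDivergenceFree (v : Plane → Plane) : Prop :=
  ∀ φ : Plane → ℝ, ContDiff ℝ ∞ φ → HasCompactSupport φ → ∫ x, fderiv ℝ φ x (v x) = 0

/-- The classical divergence of a differentiable vector field. -/
noncomputable def divergence (v : Plane → Plane) (x : Plane) : ℝ :=
  ∑ i : Fin 2, (fderiv ℝ v x (EuclideanSpace.single i 1)) i

/-- Smooth, compactly supported, spatially divergence-free test fields on `ℝ × ℝ²`; they need not
vanish at `t = 0`. -/
structure IsSolenoidalTest (φ : ℝ → Plane → Plane) : Prop where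
  smooth : ContDiff ℝ ∞ (fun z : ℝ × Plane => φ z.1 z.2)
  compactSupport : HasCompactSupport (fun z : ℝ × Plane => φ z.1 z.2)
  divFree : ∀ t x, divergence (φ t) x = 0

/-- `u` is a Leray solution of the incompressible Navier--Stokes system
`∂ₜu + u·∇u - μ Δu = -∇p`, `div u = 0`, `u(0) = u₀` on `ℝ⁺ × ℝ²`: it belongs to the energy space
`L^∞(ℝ⁺; L²) ∩ L²(ℝ⁺; Ḣ¹)` and solves the system in the sense of distributions. The pressure is
eliminated by testing against divergence-free fields, and `⟪u, (Dφ) u⟫ = (u ⊗ u) : ∇φ`.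
No energy inequality is imposed in addition, so that every solution in the energy space
is covered. -/
structure IsLeraySolution (μ : ℝ) (u₀ : Plane → Plane) (u : ℝ → Plane → Plane) : Prop where
  memLinftyL2 : MemLpLq (⊤ : ℝ≥0∞) 2 u
  memL2H1 : MemL2HomogeneousH1 u
  divFree : ∀ᵐ t ∂(volume : Measure ℝ).restrict (Ioi 0), IsWeaklyDivergenceFree (u t)
  weakForm : ∀ φ : ℝ → Plane → Plane, IsSolenoidalTest φ →
    ∫ t in Ioi (0 : ℝ), ∫ x : Plane,
        (⟪u t x, deriv (fun s => φ s x) t⟫_ℝ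
          + ⟪u t x, fderiv ℝ (φ t) x (u t x)⟫_ℝ
          + μ * ⟪u t x, (Δ (φ t)) x⟫_ℝ)
      = -∫ x : Plane, ⟪u₀ x, φ 0 x⟫_ℝ

end NavierStokes2D

/-! It suffices to show that the spatial Fourier transform of `u` lies in `L²` in time with values
in `L¹` in frequency, because the sup norm in `x` is at most the `L¹` norm in `ξ`. Let `U(t, ξ)` be
the sum of the moduli of the transforms of the two components of `u`.

Duhamel inequality. Testing against `θ(t) ∇^⊥ψ(x)` removes the pressure and gives the vorticity
equation, which at almost every frequency is a linear scalar equation in time with forcing of size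
`|ξ|²` times a correlation of `U` with itself. Incompressibility bounds `|ξ| U` by the vorticity, so
one factor `|ξ|` cancels: `U(t)` is at most a constant times the heat evolution of `U₀` plus the
Duhamel integral of `bilin (U s)` (`ae_ae_le_duhamel`).

Estimates. The heat multiplier maps `L²` in frequency to `L²` in time of `L¹` in frequency
(`exists_lintegral_sq_heat_le`); Minkowski's inequality extends this to Duhamel integrals of
forcings in `L¹` in time of `L²` in frequency (`lintegral_sq_duhamel_le`). With `M(t) = ‖U(t)‖_{L¹}`
and `v(t) = ‖|ξ| U(t)‖_{L²}`, Young's inequality bounds the forcing in `L²` by `M v`, hence `∫₀ᵀ M²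
≤ A + B (∫₀ᵀ M v)²`. Membership in `L²(ℝ⁺; Ḣ¹)` says that `v` is square integrable. Cutting time
into finitely many pieces on which `∫ v²` is small, the last piece can be absorbed each time
(`exists_bound_of_sq_volterra`), with a bound independent of `T`.

Absorption requires `∫₀ᵀ M² < ∞` beforehand, which is not known. So `M` is replaced by the `L¹` norm
weighted by `1 / (1 + ε|ξ|²)`; this is finite by the `L^∞(ℝ⁺; L²)` bound. The weight spoils the
bilinear estimate only when two high frequencies produce a low one, and that interaction is bounded
by `v²`, which is integrable in time (`lintegral_sq_weight_mul_bilin_le`). All constants are uniform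
in `ε`, and monotone convergence concludes (`lintegral_sq_lintegral_lt_top_of_duhamel`). -/

namespace NavierStokes2D

/-! ### Cauchy–Schwarz and Minkowski inequalities for lower integrals. -/

section Lintegral

variable {α β : Type*} [MeasurableSpace α] [MeasurableSpace β]

theorem sq_lintegral_mul_le (μ : Measure α) {f g : α → ℝ≥0∞} (hf : AEMeasurable f μ)
    (hg : AEMeasurable g μ) :
    (∫⁻ a, f a * g a ∂μ) ^ 2 ≤ (∫⁻ a, f a ^ 2 ∂μ) * ∫⁻ a, g a ^ 2 ∂μ := by
  have h := ENNReal.lintegral_mul_le_Lp_mul_Lq μ Real.HolderConjugate.two_two hf hg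
  have h2 := pow_le_pow_left₀ (zero_le) h 2
  refine h2.trans (le_of_eq ?_)
  rw [mul_pow]
  simp only [one_div, ← ENNReal.rpow_natCast, ← ENNReal.rpow_mul]
  norm_num

/-- Cauchy–Schwarz for the factors `(a p)^(1/2)` and `(a q)^(1/2) f`. The choice `p = |ξ|⁻¹`, `q =
|ξ|` serves the heat estimate, where `p q ≥ 1` fails at the origin; this is why the condition is
only almost everywhere. The choice `p = q = 1` serves Young's inequality. -/
theorem sq_lintegral_mul_le_of_weight (μ : Measure α) {a p q f : α → ℝ≥0∞} (ha : Measurable a)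
    (hp : Measurable p) (hq : Measurable q) (hf : Measurable f) (hpq : ∀ᵐ x ∂μ, 1 ≤ p x * q x) :
    (∫⁻ x, a x * f x ∂μ) ^ 2 ≤ (∫⁻ x, a x * p x ∂μ) * ∫⁻ x, a x * q x * f x ^ 2 ∂μ := by
  have h := sq_lintegral_mul_le μ (f := fun x => (a x * p x) ^ (1 / 2 : ℝ))
    (g := fun x => (a x * q x) ^ (1 / 2 : ℝ) * f x) (by fun_prop) (by fun_prop)
  have e : ∀ y : ℝ≥0∞, (y ^ (1 / 2 : ℝ)) ^ 2 = y := fun y => by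
    rw [← ENNReal.rpow_natCast, ← ENNReal.rpow_mul]; norm_num
  simp only [mul_pow, e] at h
  refine le_trans (pow_le_pow_left₀ zero_le (lintegral_mono_ae ?_) 2) h
  filter_upwards [hpq] with x hx
  rw [← mul_assoc, ← ENNReal.mul_rpow_of_nonneg _ _ (by norm_num)]
  gcongr
  calc a x = (a x ^ 2) ^ (1 / 2 : ℝ) := by
        rw [← ENNReal.rpow_natCast, ← ENNReal.rpow_mul]; norm_num
    _ ≤ _ := by
        apply ENNReal.rpow_le_rpow _ (by norm_num)
        calc a x ^ 2 = a x ^ 2 * 1 := by rw [mul_one]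
          _ ≤ a x ^ 2 * (p x * q x) := by gcongr
          _ = _ := by ring

/-- Minkowski's integral inequality in `L²`: the square of the inner integral is a double integral
over `s` and `r`, and after Tonelli the integral in `t` of the product is bounded by Cauchy–Schwarz.
-/
theorem lintegral_sq_lintegral_le (μ : Measure α) (ν : Measure β) [SFinite μ] [SFinite ν]
    {g : β → α → ℝ≥0∞} (hg : Measurable (Function.uncurry g)) :
    ∫⁻ t, (∫⁻ s, g s t ∂ν) ^ 2 ∂μ ≤ (∫⁻ s, (∫⁻ t, g s t ^ 2 ∂μ) ^ (1 / 2 : ℝ) ∂ν) ^ 2 := by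
  have m1 : ∀ s, Measurable (g s) := fun s => hg.comp measurable_prodMk_left
  have m2 : ∀ t, Measurable (fun s => g s t) := fun t => hg.comp measurable_prodMk_right
  have mN : Measurable fun s => (∫⁻ t, g s t ^ 2 ∂μ) ^ (1 / 2 : ℝ) := by
    refine Measurable.pow_const ?_ _
    exact Measurable.lintegral_prod_right' (f := fun z : β × α => g z.1 z.2 ^ 2) (hg.pow_const 2)
  have e : ∀ y : ℝ≥0∞, (y ^ (1 / 2 : ℝ)) ^ 2 = y := fun y => by
    rw [← ENNReal.rpow_natCast, ← ENNReal.rpow_mul]; norm_num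
  calc ∫⁻ t, (∫⁻ s, g s t ∂ν) ^ 2 ∂μ
      = ∫⁻ t, ∫⁻ s, ∫⁻ r, g s t * g r t ∂ν ∂ν ∂μ := by
        refine lintegral_congr fun t => ?_
        rw [sq, ← lintegral_mul_const _ (m2 t)]
        exact lintegral_congr fun s => (lintegral_const_mul _ (m2 t)).symm
    _ = ∫⁻ s, ∫⁻ t, ∫⁻ r, g s t * g r t ∂ν ∂μ ∂ν := by
        rw [lintegral_lintegral_swap]
        apply Measurable.aemeasurable
        refine Measurable.lintegral_prod_right'
          (f := fun z : (α × β) × β => g z.1.2 z.1.1 * g z.2 z.1.1) ?_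
        exact (hg.comp (measurable_fst.snd.prodMk measurable_fst.fst)).mul
          (hg.comp (measurable_snd.prodMk measurable_fst.fst))
    _ = ∫⁻ s, ∫⁻ r, ∫⁻ t, g s t * g r t ∂μ ∂ν ∂ν := by
        refine lintegral_congr fun s => ?_
        rw [lintegral_lintegral_swap]
        apply Measurable.aemeasurable
        exact ((m1 s).comp measurable_fst).mul (hg.comp measurable_swap)
    _ ≤ ∫⁻ s, ∫⁻ r, (∫⁻ t, g s t ^ 2 ∂μ) ^ (1 / 2 : ℝ) * (∫⁻ t, g r t ^ 2 ∂μ) ^ (1 / 2 : ℝ)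
          ∂ν ∂ν := by
        refine lintegral_mono fun s => lintegral_mono fun r => ?_
        rw [← ENNReal.mul_rpow_of_nonneg _ _ (by norm_num)]
        refine le_trans (le_of_eq ?_) (ENNReal.rpow_le_rpow (sq_lintegral_mul_le μ
          (m1 s).aemeasurable (m1 r).aemeasurable) (by norm_num))
        rw [← ENNReal.rpow_natCast, ← ENNReal.rpow_mul]; norm_num
    _ = _ := by
        rw [sq, ← lintegral_mul_const _ mN]
        exact lintegral_congr fun s => lintegral_const_mul _ mN

end Lintegral

/-! ### The heat multiplier from `L²` in frequency to `L²` in time of `L¹` in frequency. -/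

/-- In polar coordinates of the plane the Jacobian `r` cancels the weight `r⁻¹`, which leaves a
Gaussian integral on the half-line. -/
theorem lintegral_exp_neg_sq_mul_inv_norm {τ : ℝ} (hτ : 0 < τ) :
    ∫⁻ ξ : Plane, ENNReal.ofReal (Real.exp (-τ * ‖ξ‖ ^ 2)) * ENNReal.ofReal (‖ξ‖⁻¹) =
      ENNReal.ofReal (2 * Real.pi ^ (3/2 : ℝ) / 2 * τ ^ (-(1 / 2) : ℝ)) := by
  have hd : Module.finrank ℝ Plane = 2 := by simp
  have hv : (volume : Measure Plane).real (Metric.ball 0 1) = Real.pi := by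
    simp [Measure.real, Real.pi_pos.le]
  have hI : Integrable (fun ξ : Plane => Real.exp (-τ * ‖ξ‖ ^ 2) * ‖ξ‖⁻¹) := by
    rw [integrable_fun_norm_addHaar volume (f := fun r => Real.exp (-τ * r ^ 2) * r⁻¹), hd]
    refine ((integrable_exp_neg_mul_sq hτ).integrableOn (s := Ioi 0)).congr_fun ?_
      measurableSet_Ioi
    intro x hx
    have : x ≠ 0 := ne_of_gt hx
    simp only [smul_eq_mul, Nat.add_one_sub_one, pow_one]
    field_simp
  simp_rw [← ENNReal.ofReal_mul (Real.exp_pos _).le]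
  rw [← ofReal_integral_eq_lintegral_ofReal hI (.of_forall fun ξ => by positivity)]
  congr 1
  rw [integral_fun_norm_addHaar volume (fun r => Real.exp (-τ * r ^ 2) * r⁻¹), hd, hv]
  have : ∫ y in Ioi (0 : ℝ), y ^ (2 - 1) • (Real.exp (-τ * y ^ 2) * y⁻¹) =
      √(Real.pi / τ) / 2 := by
    rw [← integral_gaussian_Ioi]
    refine setIntegral_congr_fun measurableSet_Ioi fun x hx => ?_
    have : x ≠ 0 := ne_of_gt hx
    simp only [smul_eq_mul, Nat.add_one_sub_one, pow_one]
    field_simp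
  rw [this, Real.sqrt_eq_rpow, Real.div_rpow Real.pi_pos.le hτ.le, Real.rpow_neg hτ.le,
    show (3 / 2 : ℝ) = 1 + 1 / 2 by norm_num, Real.rpow_add Real.pi_pos, Real.rpow_one]
  simp only [nsmul_eq_mul, smul_eq_mul]
  push_cast
  field_simp

theorem lintegral_rpow_mul_exp {r : ℝ} (hr : 0 < r) :
    ∫⁻ τ in Ioi (0 : ℝ), ENNReal.ofReal (τ ^ (-(1 / 2) : ℝ)) * ENNReal.ofReal (Real.exp (-(r * τ)))
      = ENNReal.ofReal (r ^ (-(1 / 2) : ℝ) * √Real.pi) := by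
  have h := Real.integral_rpow_mul_exp_neg_mul_Ioi (a := 1 / 2) (by norm_num) hr
  rw [show (1 / 2 - 1 : ℝ) = -(1 / 2) by norm_num, Real.Gamma_one_half_eq] at h
  have hint : IntegrableOn (fun t : ℝ => t ^ (-(1 / 2) : ℝ) * Real.exp (-(r * t))) (Ioi 0) := by
    -- A non-integrable function has integral zero by convention, which contradicts the positive
    -- value of the Gamma integral.
    by_contra hn
    rw [integral_undef hn] at h
    have : 0 < (1 / r) ^ (1 / 2 : ℝ) * √Real.pi := by positivity
    linarith
  rw [Real.rpow_neg hr.le, ← Real.inv_rpow hr.le, ← one_div, ← h,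
    ofReal_integral_eq_lintegral_ofReal hint]
  · refine setLIntegral_congr_fun measurableSet_Ioi fun t ht => ?_
    rw [ENNReal.ofReal_mul (Real.rpow_nonneg (le_of_lt ht) _)]
  · filter_upwards [self_mem_ae_restrict measurableSet_Ioi] with t ht
    exact mul_nonneg (Real.rpow_nonneg (le_of_lt ht) _) (Real.exp_pos _).le

/-- The heat multiplier `exp (-κ τ |ξ|²)`. -/
noncomputable def heat (κ τ : ℝ) (ξ : Plane) : ℝ≥0∞ :=
  ENNReal.ofReal (Real.exp (-(κ * τ) * ‖ξ‖ ^ 2))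

theorem measurable_heat (κ : ℝ) : Measurable fun z : ℝ × Plane => heat κ z.1 z.2 := by
  unfold heat; fun_prop

/-- Cauchy–Schwarz with the weight `|ξ|⁻¹` costs a factor `τ^(-1/2)` and leaves `|ξ| f²` under the
heat multiplier. Integrating `τ^(-1/2) exp (-κτ|ξ|²)` over `τ` gives a multiple of `|ξ|⁻¹`, which
removes the weight again. Unweighted Cauchy–Schwarz would cost `τ⁻¹`, which is not integrable at
zero. -/
theorem exists_lintegral_sq_heat_le {κ : ℝ} (hκ : 0 < κ) : ∃ C : ℝ≥0∞, C < ⊤ ∧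
    ∀ f : Plane → ℝ≥0∞, Measurable f →
      ∫⁻ τ in Ioi (0 : ℝ), (∫⁻ ξ, heat κ τ ξ * f ξ) ^ 2 ≤ C * ∫⁻ ξ, f ξ ^ 2 := by
  set c₁ : ℝ := 2 * Real.pi ^ (3/2 : ℝ) / 2 * κ ^ (-(1 / 2) : ℝ) with hc₁
  set c₂ : ℝ := κ ^ (-(1 / 2) : ℝ) * √Real.pi
  have c₁0 : 0 ≤ c₁ := by positivity
  refine ⟨ENNReal.ofReal c₁ * ENNReal.ofReal c₂, by finiteness, fun f hf => ?_⟩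
  have mh := measurable_heat κ
  have h0 : ∀ᵐ ξ : Plane, ξ ≠ 0 := by
    rw [ae_iff]; simp
  have key : ∀ τ ∈ Ioi (0 : ℝ), (∫⁻ ξ, heat κ τ ξ * f ξ) ^ 2 ≤
      ∫⁻ ξ, ENNReal.ofReal c₁ * (ENNReal.ofReal (τ ^ (-(1 / 2) : ℝ)) *
        (heat κ τ ξ * ENNReal.ofReal ‖ξ‖ * f ξ ^ 2)) := by
    intro τ hτ
    have mτ : Measurable (heat κ τ) := mh.comp measurable_prodMk_left
    refine (sq_lintegral_mul_le_of_weight volume (a := heat κ τ)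
      (p := fun ξ => ENNReal.ofReal ‖ξ‖⁻¹) (q := fun ξ => ENNReal.ofReal ‖ξ‖) (f := f)
      mτ (by fun_prop) (by fun_prop) hf ?_).trans ?_
    · filter_upwards [h0] with ξ hξ
      rw [← ENNReal.ofReal_mul (by positivity), inv_mul_cancel₀ (by simpa using hξ)]
      simp
    · unfold heat
      rw [lintegral_exp_neg_sq_mul_inv_norm (mul_pos hκ hτ), lintegral_const_mul',
        lintegral_const_mul', ← mul_assoc, ← ENNReal.ofReal_mul c₁0]
      · rw [hc₁, Real.mul_rpow hκ.le (le_of_lt hτ)]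
        ring_nf
        rfl
      · finiteness
      · finiteness
  have hr : ∀ ξ : Plane, ξ ≠ 0 → ∫⁻ τ in Ioi (0 : ℝ), ENNReal.ofReal (τ ^ (-(1 / 2) : ℝ)) *
        (heat κ τ ξ * ENNReal.ofReal ‖ξ‖ * f ξ ^ 2) = ENNReal.ofReal c₂ * f ξ ^ 2 := by
    intro ξ hξ
    have hn : 0 < ‖ξ‖ := norm_pos_iff.2 hξ
    calc _ = ∫⁻ τ in Ioi (0 : ℝ), (ENNReal.ofReal (τ ^ (-(1 / 2) : ℝ)) *
        ENNReal.ofReal (Real.exp (-((κ * ‖ξ‖ ^ 2) * τ)))) *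
          (ENNReal.ofReal ‖ξ‖ * f ξ ^ 2) := by
          refine lintegral_congr fun τ => ?_
          rw [heat, show -(κ * τ) * ‖ξ‖ ^ 2 = -((κ * ‖ξ‖ ^ 2) * τ) by ring]
          ring
      _ = _ := by
          rw [lintegral_mul_const _ (by fun_prop), lintegral_rpow_mul_exp (by positivity),
            ← mul_assoc, ← ENNReal.ofReal_mul (by positivity)]
          congr 2
          rw [Real.mul_rpow hκ.le (by positivity), Real.rpow_neg (x := ‖ξ‖ ^ 2) (by positivity),
            ← Real.sqrt_eq_rpow, Real.sqrt_sq hn.le]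
          field_simp
          rfl
  calc _ ≤ ∫⁻ τ in Ioi (0 : ℝ), ∫⁻ ξ, ENNReal.ofReal c₁ * (ENNReal.ofReal (τ ^ (-(1 / 2) : ℝ)) *
        (heat κ τ ξ * ENNReal.ofReal ‖ξ‖ * f ξ ^ 2)) :=
        setLIntegral_mono' measurableSet_Ioi key
    _ = ∫⁻ ξ, ∫⁻ τ in Ioi (0 : ℝ), ENNReal.ofReal c₁ * (ENNReal.ofReal (τ ^ (-(1 / 2) : ℝ)) *
        (heat κ τ ξ * ENNReal.ofReal ‖ξ‖ * f ξ ^ 2)) := by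
        rw [lintegral_lintegral_swap]
        apply Measurable.aemeasurable
        unfold Function.uncurry
        fun_prop
    _ = ∫⁻ ξ, ENNReal.ofReal c₁ * (ENNReal.ofReal c₂ * f ξ ^ 2) := by
        refine lintegral_congr_ae ?_
        filter_upwards [h0] with ξ hξ
        rw [lintegral_const_mul' _ _ (by finiteness), hr ξ hξ]
    _ = _ := by
        rw [lintegral_const_mul' _ _ (by finiteness), lintegral_const_mul' _ _ (by finiteness),
          mul_assoc]

end NavierStokes2D

/-! ### The Duhamel integral and the bilinear estimate in frequency. -/

namespace NavierStokes2D

theorem ENNReal_sqrt_sq (y : ℝ≥0∞) : (y ^ (1 / 2 : ℝ)) ^ 2 = y := by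
  rw [← ENNReal.rpow_natCast, ← ENNReal.rpow_mul]; norm_num

theorem ENNReal_sq_sqrt (y : ℝ≥0∞) : (y ^ 2) ^ (1 / 2 : ℝ) = y := by
  rw [← ENNReal.rpow_natCast, ← ENNReal.rpow_mul]; norm_num

theorem ENNReal_add_sq_le (a b : ℝ≥0∞) : (a + b) ^ 2 ≤ 2 * (a ^ 2 + b ^ 2) := by
  have := ENNReal.rpow_add_le_mul_rpow_add_rpow a b (p := 2) (by norm_num)
  norm_num at this
  exact_mod_cast this

/-- Minkowski's inequality moves the `L²` norm in `t` inside the integral over the source time `s`.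
For fixed `s` a translation in time reduces the claim to the bound `hC` for the data `f s`. -/
theorem lintegral_sq_duhamel_le {κ : ℝ} {C : ℝ≥0∞}
    (hC : ∀ f : Plane → ℝ≥0∞, Measurable f →
      ∫⁻ τ in Ioi (0 : ℝ), (∫⁻ ξ, heat κ τ ξ * f ξ) ^ 2 ≤ C * ∫⁻ ξ, f ξ ^ 2)
    {f : ℝ → Plane → ℝ≥0∞} (hf : Measurable (Function.uncurry f)) (T : ℝ) :
    ∫⁻ t in Ioc 0 T, (∫⁻ ξ, ∫⁻ s in Ioo 0 t, heat κ (t - s) ξ * f s ξ) ^ 2 ≤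
      C * (∫⁻ s in Ioc 0 T, (∫⁻ ξ, f s ξ ^ 2) ^ (1 / 2 : ℝ)) ^ 2 := by
  have mh := measurable_heat κ
  -- Extension by zero to `τ ≤ 0` encodes the constraint `s < t` in `h s (t - s)` and permits
  -- translation over the whole line.
  set h : ℝ → ℝ → ℝ≥0∞ := fun s τ =>
    (Ioi (0 : ℝ)).indicator (fun τ => ∫⁻ ξ, heat κ τ ξ * f s ξ) τ with hh
  have mI : Measurable fun z : ℝ × ℝ => ∫⁻ ξ, heat κ z.2 ξ * f z.1 ξ := by
    refine Measurable.lintegral_prod_right'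
      (f := fun z : (ℝ × ℝ) × Plane => heat κ z.1.2 z.2 * f z.1.1 z.2) ?_
    exact (mh.comp (measurable_fst.snd.prodMk measurable_snd)).mul
      (hf.comp (measurable_fst.fst.prodMk measurable_snd))
  have mh' : Measurable (Function.uncurry h) := by
    have : Function.uncurry h = indicator {z : ℝ × ℝ | z.2 ∈ Ioi (0:ℝ)}
        (fun z : ℝ × ℝ => ∫⁻ ξ, heat κ z.2 ξ * f z.1 ξ) := by
      ext z; simp [h, Function.uncurry, indicator]
    rw [this]
    exact mI.indicator (measurable_snd measurableSet_Ioi)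
  have mg : Measurable (Function.uncurry fun s t : ℝ => h s (t - s)) :=
    mh'.comp (measurable_fst.prodMk (measurable_snd.sub measurable_fst))
  have step : ∀ t ∈ Ioc 0 T, (∫⁻ ξ, ∫⁻ s in Ioo 0 t, heat κ (t - s) ξ * f s ξ) =
      ∫⁻ s in Ioc 0 T, h s (t - s) := by
    intro t ht
    rw [lintegral_lintegral_swap]
    · have : ∀ s, h s (t - s) = (Iio t).indicator (fun s => ∫⁻ ξ, heat κ (t - s) ξ * f s ξ) s := by
        intro s; simp [h, indicator]
      simp_rw [this]
      rw [lintegral_indicator measurableSet_Iio, Measure.restrict_restrict measurableSet_Iio]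
      congr 2
      ext s
      simp only [mem_Ioo, mem_inter_iff, mem_Iio, mem_Ioc]
      constructor
      · rintro ⟨h1, h2⟩; exact ⟨h2, h1, h2.le.trans ht.2⟩
      · rintro ⟨h1, h2, _⟩; exact ⟨h2, h1⟩
    · apply Measurable.aemeasurable
      exact (mh.comp ((measurable_const.sub measurable_snd).prodMk measurable_fst)).mul
        (hf.comp (measurable_snd.prodMk measurable_fst))
  calc _ = ∫⁻ t in Ioc 0 T, (∫⁻ s in Ioc 0 T, h s (t - s)) ^ 2 :=
        setLIntegral_congr_fun measurableSet_Ioc fun t ht => by rw [step t ht]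
    _ ≤ (∫⁻ s in Ioc 0 T, (∫⁻ t in Ioc 0 T, h s (t - s) ^ 2) ^ (1 / 2 : ℝ)) ^ 2 :=
        lintegral_sq_lintegral_le _ _ mg
    _ ≤ (∫⁻ s in Ioc 0 T, (C * ∫⁻ ξ, f s ξ ^ 2) ^ (1 / 2 : ℝ)) ^ 2 := by
        gcongr with s
        calc _ ≤ ∫⁻ t, h s (t - s) ^ 2 := setLIntegral_le_lintegral _ _
          _ = ∫⁻ t, h s t ^ 2 := lintegral_sub_right_eq_self (fun t => h s t ^ 2) s
          _ = ∫⁻ τ in Ioi (0 : ℝ), (∫⁻ ξ, heat κ τ ξ * f s ξ) ^ 2 := by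
              rw [← lintegral_indicator measurableSet_Ioi]
              refine lintegral_congr fun τ => ?_
              by_cases hτ : τ ∈ Ioi (0 : ℝ)
              · simp [h, indicator_of_mem hτ]
              · simp [h, indicator_of_notMem hτ]
          _ ≤ _ := hC _ (hf.comp measurable_prodMk_left)
    _ = _ := by
        simp_rw [ENNReal.mul_rpow_of_nonneg _ _ (show (0 : ℝ) ≤ 1 / 2 by norm_num)]
        rw [lintegral_const_mul, mul_pow, ENNReal_sqrt_sq]
        refine Measurable.pow_const ?_ _
        exact Measurable.lintegral_prod_right' (f := fun z : ℝ × Plane => f z.1 z.2 ^ 2)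
          (hf.pow_const 2)

/-- The bilinear majorant of the Fourier transform of `div (u ⊗ u)`. -/
noncomputable def bilin (U : Plane → ℝ≥0∞) (ξ : Plane) : ℝ≥0∞ :=
  ENNReal.ofReal ‖ξ‖ * ∫⁻ η, U η * U (ξ + η)

/-- A decaying frequency weight, increasing to `1` as `ε → 0`. -/
noncomputable def weight (ε : ℝ) (ξ : Plane) : ℝ≥0∞ := ENNReal.ofReal (1 / (1 + ε * ‖ξ‖ ^ 2))

theorem measurable_weight (ε : ℝ) : Measurable (weight ε) := by unfold weight; fun_prop

theorem weight_le_one {ε : ℝ} (hε : 0 ≤ ε) (ξ : Plane) : weight ε ξ ≤ 1 := by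
  unfold weight
  rw [ENNReal.ofReal_le_one]
  rw [div_le_one (by positivity)]
  nlinarith [mul_nonneg hε (sq_nonneg ‖ξ‖)]

/-- The numbers `a`, `b`, `c` stand for `|ξ|`, `|η|`, `|ξ + η|`. If `b` and `c` are both at most
`4a`, then `a` is at most twice the larger of the two, and the weight at `a` is at most `16` times
the weight at the smaller one; hence `32`. Otherwise two high frequencies interact to give a low
one: the weights at `b` and `c` may be far smaller than the one at `a`, so the weight is bounded by
`1` and `a ≤ 2c` is used, with `b⁻¹ b` inserted so that both factors carry a frequency. Without a
weight, `a ≤ b + c` would be enough. -/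
theorem triangle_weight_ineq {a b c ε : ℝ} (ha : 0 ≤ a) (hb : 0 ≤ b) (hc : 0 ≤ c) (hε : 0 ≤ ε)
    (h1 : a ≤ b + c) (h2 : b ≤ a + c) (h3 : c ≤ a + b) :
    1 / (1 + ε * a ^ 2) * a ≤ 32 * (b * (1 / (1 + ε * c ^ 2)) + 1 / (1 + ε * b ^ 2) * c) +
      2 * ((if a < b then b⁻¹ else 0) * b * c) := by
  have key : ∀ x y : ℝ, 0 ≤ x → 0 ≤ y → a ≤ x + y → x ≤ 4 * a → x ≤ y →
      1 / (1 + ε * a ^ 2) * a ≤ 32 * (y * (1 / (1 + ε * x ^ 2))) := by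
    intro x y hx hy hxy hxa hyx
    have e1 : 1 / (1 + ε * a ^ 2) ≤ 16 * (1 / (1 + ε * x ^ 2)) := by
      rw [mul_one_div, div_le_div_iff₀ (by positivity) (by positivity)]
      have : x ^ 2 ≤ 16 * a ^ 2 := by nlinarith
      nlinarith [mul_le_mul_of_nonneg_left this hε]
    calc 1 / (1 + ε * a ^ 2) * a ≤ 16 * (1 / (1 + ε * x ^ 2)) * (2 * y) := by
          gcongr; linarith
      _ = _ := by ring
  have p1 : 0 ≤ b * (1 / (1 + ε * c ^ 2)) := by positivity
  have p2 : 0 ≤ 1 / (1 + ε * b ^ 2) * c := by positivity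
  have p3 : 0 ≤ (if a < b then b⁻¹ else 0) * b * c := by
    have : 0 ≤ (if a < b then b⁻¹ else 0) := by split_ifs <;> positivity
    positivity
  by_cases h4 : b ≤ 4 * a ∧ c ≤ 4 * a
  · rcases le_total c b with h | h
    · have := key c b hc hb (by linarith) h4.2 h
      linarith
    · have := key b c hb hc (by linarith) h4.1 h
      linarith
  · have hab : 3 * a < b ∧ a ≤ 2 * c := by
      by_cases hb4 : b ≤ 4 * a
      · have : 4 * a < c := not_le.1 fun h => h4 ⟨hb4, h⟩
        constructor <;> linarith
      · constructor <;> linarith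
    have hlt : a < b := by linarith
    have hb0 : b ≠ 0 := by linarith
    have e2 : 1 / (1 + ε * a ^ 2) * a ≤ a := by
      apply mul_le_of_le_one_left ha
      rw [div_le_one (by positivity)]
      nlinarith [mul_nonneg hε (sq_nonneg a)]
    rw [if_pos hlt, inv_mul_cancel₀ hb0]
    linarith [hab.2]

/-- Kernel of the high-high to low frequency interaction. -/
noncomputable def hhKernel (ξ η : Plane) : ℝ≥0∞ :=
  ENNReal.ofReal (if ‖ξ‖ < ‖η‖ then ‖η‖⁻¹ else 0)

theorem measurable_hhKernel : Measurable fun z : Plane × Plane => hhKernel z.1 z.2 := by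
  unfold hhKernel
  refine ENNReal.measurable_ofReal.comp (Measurable.ite ?_ (by fun_prop) (by fun_prop))
  exact measurableSet_lt (by fun_prop) (by fun_prop)

/-- The square of the kernel is `|η|⁻²` on the disc of radius `|η|`, whose area is `π|η|²`; in the
plane the two cancel exactly. -/
theorem lintegral_hhKernel_sq_le (η : Plane) :
    ∫⁻ ξ, hhKernel ξ η ^ 2 ≤ ENNReal.ofReal Real.pi := by
  have e : ∀ ξ, hhKernel ξ η ^ 2 =
      (Metric.ball (0 : Plane) ‖η‖).indicator (fun _ => ENNReal.ofReal (‖η‖⁻¹ ^ 2)) ξ := by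
    intro ξ
    unfold hhKernel
    by_cases h : ‖ξ‖ < ‖η‖
    · rw [if_pos h, indicator_of_mem (by simpa using h), ENNReal.ofReal_pow (by positivity)]
    · rw [if_neg h, indicator_of_notMem (by simpa using h)]; simp
  simp_rw [e]
  rw [lintegral_indicator_const Metric.isOpen_ball.measurableSet]
  rw [EuclideanSpace.volume_ball_fin_two, ← ENNReal.ofReal_pow (norm_nonneg _), ← ENNReal.ofReal_mul (by positivity),
    ← ENNReal.ofReal_mul (by positivity)]
  apply ENNReal.ofReal_le_ofReal
  by_cases h : ‖η‖ = 0
  · simp [h, Real.pi_pos.le]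
  · apply le_of_eq; field_simp

theorem weight_mul_norm_le {ε : ℝ} (hε : 0 ≤ ε) (ξ η : Plane) :
    weight ε ξ * ENNReal.ofReal ‖ξ‖ ≤
      32 * (ENNReal.ofReal ‖η‖ * weight ε (ξ + η) + weight ε η * ENNReal.ofReal ‖ξ + η‖) +
        2 * (hhKernel ξ η * ENNReal.ofReal ‖η‖ * ENNReal.ofReal ‖ξ + η‖) := by
  have hr := triangle_weight_ineq (norm_nonneg ξ) (norm_nonneg η) (norm_nonneg (ξ + η)) hε
    (by simpa [add_comm] using norm_sub_le (ξ + η) η)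
    (by simpa [add_comm] using norm_sub_le (ξ + η) ξ) (norm_add_le ξ η)
  unfold weight hhKernel
  have hk0 : 0 ≤ (if ‖ξ‖ < ‖η‖ then ‖η‖⁻¹ else 0) := by split_ifs <;> positivity
  generalize (if ‖ξ‖ < ‖η‖ then ‖η‖⁻¹ else 0) = k at *
  have p1 : 0 ≤ 1 / (1 + ε * ‖ξ‖ ^ 2) := by positivity
  have p2 : 0 ≤ 1 / (1 + ε * ‖η‖ ^ 2) := by positivity
  have p3 : 0 ≤ 1 / (1 + ε * ‖ξ + η‖ ^ 2) := by positivity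
  generalize 1 / (1 + ε * ‖ξ‖ ^ 2) = a₁ at *
  generalize 1 / (1 + ε * ‖η‖ ^ 2) = a₂ at *
  generalize 1 / (1 + ε * ‖ξ + η‖ ^ 2) = a₃ at *
  have q1 := norm_nonneg ξ
  have q2 := norm_nonneg η
  have q3 := norm_nonneg (ξ + η)
  generalize ‖ξ‖ = b₁ at *
  generalize ‖η‖ = b₂ at *
  generalize ‖ξ + η‖ = b₃ at *
  lift k to NNReal using hk0
  lift a₁ to NNReal using p1
  lift a₂ to NNReal using p2
  lift a₃ to NNReal using p3
  lift b₁ to NNReal using q1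
  lift b₂ to NNReal using q2
  lift b₃ to NNReal using q3
  simp only [ENNReal.ofReal_coe_nnreal]
  exact_mod_cast hr

theorem weight_mul_bilin_le {ε : ℝ} (hε : 0 ≤ ε) {U : Plane → ℝ≥0∞} (hU : Measurable U)
    (ξ : Plane) :
    weight ε ξ * bilin U ξ ≤
      32 * ((∫⁻ η, weight ε (ξ + η) * U (ξ + η) * (ENNReal.ofReal ‖η‖ * U η)) +
        ∫⁻ η, weight ε η * U η * (ENNReal.ofReal ‖ξ + η‖ * U (ξ + η))) +
      2 * ∫⁻ η, hhKernel ξ η * (ENNReal.ofReal ‖η‖ * U η) *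
        (ENNReal.ofReal ‖ξ + η‖ * U (ξ + η)) := by
  have mw := measurable_weight ε
  have mk : Measurable fun η => hhKernel ξ η := by
    unfold hhKernel
    refine ENNReal.measurable_ofReal.comp (Measurable.ite ?_ (by fun_prop) (by fun_prop))
    exact measurableSet_lt (by fun_prop) (by fun_prop)
  have mU' : Measurable fun η => U (ξ + η) := hU.comp (measurable_const_add ξ)
  have mw' : Measurable fun η => weight ε (ξ + η) := mw.comp (measurable_const_add ξ)
  have mn : Measurable fun η : Plane => ENNReal.ofReal ‖η‖ := by fun_prop
  have mn' : Measurable fun η : Plane => ENNReal.ofReal ‖ξ + η‖ := by fun_prop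
  have alg : ∀ a₁ a₂ a₃ a₄ b₁ b₂ b₃ c₁ c₂ : ℝ≥0∞,
      a₁ * b₁ ≤ 32 * (b₂ * a₃ + a₂ * b₃) + 2 * (a₄ * b₂ * b₃) →
      a₁ * b₁ * (c₁ * c₂) ≤
        32 * (a₃ * c₂ * (b₂ * c₁) + a₂ * c₁ * (b₃ * c₂)) + 2 * (a₄ * (b₂ * c₁) * (b₃ * c₂)) := by
    intro a₁ a₂ a₃ a₄ b₁ b₂ b₃ c₁ c₂ h
    calc a₁ * b₁ * (c₁ * c₂) ≤ (32 * (b₂ * a₃ + a₂ * b₃) + 2 * (a₄ * b₂ * b₃)) * (c₁ * c₂) := by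
          gcongr
      _ = _ := by ring
  calc weight ε ξ * bilin U ξ
      = ∫⁻ η, weight ε ξ * ENNReal.ofReal ‖ξ‖ * (U η * U (ξ + η)) := by
        have m : Measurable fun η => U η * U (ξ + η) := hU.mul mU'
        rw [bilin, ← mul_assoc, lintegral_const_mul _ m]
    _ ≤ ∫⁻ η, (32 * (weight ε (ξ + η) * U (ξ + η) * (ENNReal.ofReal ‖η‖ * U η) +
          weight ε η * U η * (ENNReal.ofReal ‖ξ + η‖ * U (ξ + η))) +
          2 * (hhKernel ξ η * (ENNReal.ofReal ‖η‖ * U η) *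
            (ENNReal.ofReal ‖ξ + η‖ * U (ξ + η)))) :=
        lintegral_mono fun η => alg _ _ _ _ _ _ _ _ _ (weight_mul_norm_le hε ξ η)
    _ = _ := by
        have m1 : Measurable fun η => weight ε (ξ + η) * U (ξ + η) * (ENNReal.ofReal ‖η‖ * U η) :=
          (mw'.mul mU').mul (mn.mul hU)
        have m2 : Measurable fun η => weight ε η * U η * (ENNReal.ofReal ‖ξ + η‖ * U (ξ + η)) :=
          (mw.mul hU).mul (mn'.mul mU')
        have m3 : Measurable fun η => hhKernel ξ η * (ENNReal.ofReal ‖η‖ * U η) *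
            (ENNReal.ofReal ‖ξ + η‖ * U (ξ + η)) := (mk.mul (mn.mul hU)).mul (mn'.mul mU')
        rw [lintegral_add_right _ (m3.const_mul _), lintegral_const_mul' _ _ (by finiteness),
          lintegral_const_mul _ m3, lintegral_add_left m1]

/-- The first two contributions follow from Young's inequality `L¹ * L² ⊂ L²` for correlations, with
the weighted factor in `L¹` and `|ξ| U` in `L²`. The high-high contribution is a Hilbert–Schmidt
bound: Cauchy–Schwarz in `η`, then the integral of the squared kernel in `ξ`. The latter involves no
`L¹` norm, so it becomes a fixed constant in the final inequality. -/
theorem lintegral_sq_weight_mul_bilin_le {ε : ℝ} (hε : 0 ≤ ε) {U : Plane → ℝ≥0∞}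
    (hU : Measurable U) :
    ∫⁻ ξ, (weight ε ξ * bilin U ξ) ^ 2 ≤ 10000 * (1 + ENNReal.ofReal Real.pi) *
      ((∫⁻ ξ, weight ε ξ * U ξ) ^ 2 * (∫⁻ ξ, (ENNReal.ofReal ‖ξ‖ * U ξ) ^ 2) +
        (∫⁻ ξ, (ENNReal.ofReal ‖ξ‖ * U ξ) ^ 2) ^ 2) := by
  set W : Plane → ℝ≥0∞ := fun ξ => weight ε ξ * U ξ with hW
  set V : Plane → ℝ≥0∞ := fun ξ => ENNReal.ofReal ‖ξ‖ * U ξ with hV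
  have mW : Measurable W := (measurable_weight ε).mul hU
  have mV : Measurable V := by fun_prop
  have mk := measurable_hhKernel
  have madd : ∀ ξ : Plane, Measurable fun η => ξ + η := fun ξ => measurable_const_add ξ
  have mp : Measurable fun z : Plane × Plane => z.1 + z.2 := measurable_fst.add measurable_snd
  have tr : ∀ (g : Plane → ℝ≥0∞) (ξ : Plane), ∫⁻ η, g (ξ + η) = ∫⁻ η, g η :=
    fun g ξ => lintegral_add_left_eq_self g ξ
  have tr' : ∀ (g : Plane → ℝ≥0∞) (ξ : Plane), ∫⁻ η, g (η + ξ) = ∫⁻ η, g η :=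
    fun g ξ => lintegral_add_right_eq_self g ξ
  set M := ∫⁻ ξ, W ξ
  set E := ∫⁻ ξ, V ξ ^ 2
  have cs : ∀ {a f : Plane → ℝ≥0∞}, Measurable a → Measurable f →
      (∫⁻ x, a x * f x) ^ 2 ≤ (∫⁻ x, a x) * ∫⁻ x, a x * f x ^ 2 := by
    intro a f ha hf
    simpa using sq_lintegral_mul_le_of_weight volume (p := fun _ => 1) (q := fun _ => 1) ha
      measurable_const measurable_const hf (by simp)
  have mA1 : Measurable fun ξ => ∫⁻ η, W (ξ + η) * V η :=
    Measurable.lintegral_prod_right' (f := fun z : Plane × Plane => W (z.1 + z.2) * V z.2)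
      ((mW.comp mp).mul (mV.comp measurable_snd))
  have mA2 : Measurable fun ξ => ∫⁻ η, W η * V (ξ + η) :=
    Measurable.lintegral_prod_right' (f := fun z : Plane × Plane => W z.2 * V (z.1 + z.2))
      ((mW.comp measurable_snd).mul (mV.comp mp))
  have mA3 : Measurable fun ξ => ∫⁻ η, hhKernel ξ η * V η * V (ξ + η) :=
    Measurable.lintegral_prod_right'
      (f := fun z : Plane × Plane => hhKernel z.1 z.2 * V z.2 * V (z.1 + z.2))
      ((mk.mul (mV.comp measurable_snd)).mul (mV.comp mp))
  have t1 : ∫⁻ ξ, (∫⁻ η, W (ξ + η) * V η) ^ 2 ≤ M ^ 2 * E := by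
    calc _ ≤ ∫⁻ ξ, M * ∫⁻ η, W (ξ + η) * V η ^ 2 := by
          refine lintegral_mono fun ξ => (cs (mW.comp (madd ξ)) mV).trans ?_
          simp only [Function.comp_def]
          rw [tr]
      _ = M * ∫⁻ η, ∫⁻ ξ, W (ξ + η) * V η ^ 2 := by
          rw [lintegral_const_mul, lintegral_lintegral_swap]
          · exact ((mW.comp mp).mul ((mV.comp measurable_snd).pow_const 2)).aemeasurable
          · exact Measurable.lintegral_prod_right'
              (f := fun z : Plane × Plane => W (z.1 + z.2) * V z.2 ^ 2)
              ((mW.comp mp).mul ((mV.comp measurable_snd).pow_const 2))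
      _ = M * ∫⁻ η, M * V η ^ 2 := by
          congr 1
          refine lintegral_congr fun η => ?_
          have m : Measurable fun ξ => W (ξ + η) := mW.comp (measurable_add_const η)
          rw [lintegral_mul_const _ m, tr']
      _ = _ := by rw [lintegral_const_mul _ (mV.pow_const 2)]; ring
  have t2 : ∫⁻ ξ, (∫⁻ η, W η * V (ξ + η)) ^ 2 ≤ M ^ 2 * E := by
    calc _ ≤ ∫⁻ ξ, M * ∫⁻ η, W η * V (ξ + η) ^ 2 :=
          lintegral_mono fun ξ => (cs mW (mV.comp (madd ξ)))
      _ = M * ∫⁻ η, ∫⁻ ξ, W η * V (ξ + η) ^ 2 := by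
          rw [lintegral_const_mul, lintegral_lintegral_swap]
          · exact ((mW.comp measurable_snd).mul ((mV.comp mp).pow_const 2)).aemeasurable
          · exact Measurable.lintegral_prod_right'
              (f := fun z : Plane × Plane => W z.2 * V (z.1 + z.2) ^ 2)
              ((mW.comp measurable_snd).mul ((mV.comp mp).pow_const 2))
      _ = M * ∫⁻ η, W η * E := by
          congr 1
          refine lintegral_congr fun η => ?_
          have m : Measurable fun ξ => V (ξ + η) ^ 2 :=
            (mV.comp (measurable_add_const η)).pow_const 2
          rw [lintegral_const_mul _ m, tr' (fun ξ => V ξ ^ 2)]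
      _ = _ := by rw [lintegral_mul_const _ mW]; ring
  have t3 : ∫⁻ ξ, (∫⁻ η, hhKernel ξ η * V η * V (ξ + η)) ^ 2 ≤ ENNReal.ofReal Real.pi * E ^ 2 := by
    calc _ ≤ ∫⁻ ξ, (∫⁻ η, (hhKernel ξ η * V η) ^ 2) * E := by
          refine lintegral_mono fun ξ => (sq_lintegral_mul_le volume
            (((mk.comp measurable_prodMk_left).mul mV).aemeasurable)
            (mV.comp (madd ξ)).aemeasurable).trans ?_
          simp only [Function.comp_def]
          rw [tr (fun ξ => V ξ ^ 2)]
          rfl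
      _ = (∫⁻ η, ∫⁻ ξ, hhKernel ξ η ^ 2 * V η ^ 2) * E := by
          simp_rw [mul_pow]
          rw [lintegral_mul_const, lintegral_lintegral_swap]
          · exact ((mk.pow_const 2).mul ((mV.comp measurable_snd).pow_const 2)).aemeasurable
          · exact Measurable.lintegral_prod_right'
              (f := fun z : Plane × Plane => hhKernel z.1 z.2 ^ 2 * V z.2 ^ 2)
              ((mk.pow_const 2).mul ((mV.comp measurable_snd).pow_const 2))
      _ ≤ (∫⁻ η, ENNReal.ofReal Real.pi * V η ^ 2) * E := by
          gcongr with η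
          have m : Measurable fun ξ => hhKernel ξ η ^ 2 :=
            (mk.comp measurable_prodMk_right).pow_const 2
          rw [lintegral_mul_const _ m]
          gcongr
          exact lintegral_hhKernel_sq_le η
      _ = _ := by rw [lintegral_const_mul _ (mV.pow_const 2)]; ring
  calc _ ≤ ∫⁻ ξ, (32 * ((∫⁻ η, W (ξ + η) * V η) + ∫⁻ η, W η * V (ξ + η)) +
        2 * ∫⁻ η, hhKernel ξ η * V η * V (ξ + η)) ^ 2 := by
        gcongr with ξ
        exact weight_mul_bilin_le hε hU ξ
    -- Two uses of `(p + q)² ≤ 2(p² + q²)`: `2 · 32² · 2 = 4096` and `2 · 2² = 8`.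
    _ ≤ ∫⁻ ξ, (4096 * (∫⁻ η, W (ξ + η) * V η) ^ 2 + 4096 * (∫⁻ η, W η * V (ξ + η)) ^ 2 +
        8 * (∫⁻ η, hhKernel ξ η * V η * V (ξ + η)) ^ 2) := by
        refine lintegral_mono fun ξ => ?_
        refine (ENNReal_add_sq_le _ _).trans ?_
        rw [mul_pow, mul_pow]
        calc _ ≤ 2 * ((32 : ℝ≥0∞) ^ 2 * (2 * ((∫⁻ η, W (ξ + η) * V η) ^ 2 +
              (∫⁻ η, W η * V (ξ + η)) ^ 2)) +
              2 ^ 2 * (∫⁻ η, hhKernel ξ η * V η * V (ξ + η)) ^ 2) := by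
              gcongr
              exact ENNReal_add_sq_le _ _
          _ = _ := by ring
    _ ≤ 4096 * (M ^ 2 * E) + 4096 * (M ^ 2 * E) + 8 * (ENNReal.ofReal Real.pi * E ^ 2) := by
        rw [lintegral_add_right _ ((mA3.pow_const 2).const_mul _),
          lintegral_add_right _ ((mA2.pow_const 2).const_mul _),
          lintegral_const_mul _ (mA1.pow_const 2), lintegral_const_mul _ (mA2.pow_const 2),
          lintegral_const_mul _ (mA3.pow_const 2)]
        gcongr
    _ = (8192 * 1) * (M ^ 2 * E) + (8 * ENNReal.ofReal Real.pi) * E ^ 2 := by ring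
    _ ≤ (10000 * (1 + ENNReal.ofReal Real.pi)) * (M ^ 2 * E) +
          (10000 * (1 + ENNReal.ofReal Real.pi)) * E ^ 2 := by
        gcongr
        · norm_num
        · exact le_self_add
        · norm_num
        · exact le_add_self
    _ = _ := by ring

end NavierStokes2D

/-! ### Absorption over short pieces of time and removal of the weight. -/

namespace NavierStokes2D

/-- The primitive of an integrable function is continuous, so it attains the value `x` unless its
value at `T` is already at most `x`. -/
theorem exists_split_of_lintegral_le {g : ℝ → ℝ≥0∞} (hg : Measurable g)
    (hfin : ∫⁻ t in Ioi (0 : ℝ), g t < ⊤) {T : ℝ} (hT : 0 ≤ T) {x y : ℝ≥0∞} (hx : x ≠ ⊤)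
    (h : ∫⁻ t in Ioc 0 T, g t ≤ x + y) :
    ∃ a, 0 ≤ a ∧ a ≤ T ∧ ∫⁻ t in Ioc 0 a, g t ≤ x ∧ ∫⁻ t in Ioc a T, g t ≤ y := by
  by_cases hle : ∫⁻ t in Ioc 0 T, g t ≤ x
  · exact ⟨T, hT, le_rfl, hle, by simp⟩
  push Not at hle
  have hfinT : ∀ a, ∫⁻ t in Ioc 0 a, g t ≠ ⊤ := fun a =>
    ((lintegral_mono_set Ioc_subset_Ioi_self).trans_lt hfin).ne
  have hint : IntegrableOn (fun t => (g t).toReal) (Ioi 0) :=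
    integrable_toReal_of_lintegral_ne_top hg.aemeasurable hfin.ne
  have hval : ∀ a, 0 ≤ a → ∫ t in (0 : ℝ)..a, (g t).toReal = (∫⁻ t in Ioc 0 a, g t).toReal := by
    intro a ha
    rw [intervalIntegral.integral_of_le ha, integral_toReal hg.aemeasurable
      (ae_lt_top hg (hfinT a))]
  have hcont : ContinuousOn (fun a => ∫ t in (0 : ℝ)..a, (g t).toReal) (Icc 0 T) := by
    have := intervalIntegral.continuousOn_primitive_interval (μ := volume) (a := 0) (b := T)
      (f := fun t => (g t).toReal) (by
        rw [uIcc_of_le hT, integrableOn_Icc_iff_integrableOn_Ioc]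
        exact hint.mono_set Ioc_subset_Ioi_self)
    rwa [uIcc_of_le hT] at this
  have hx' : x.toReal ∈ Icc (∫ t in (0 : ℝ)..0, (g t).toReal) (∫ t in (0 : ℝ)..T, (g t).toReal) := by
    refine ⟨by simp, ?_⟩
    rw [hval T hT]
    exact ENNReal.toReal_mono (hfinT T) hle.le
  obtain ⟨a, ha, hax⟩ := intermediate_value_Icc hT hcont hx'
  simp only [hval a ha.1] at hax
  have hax' : ∫⁻ t in Ioc 0 a, g t = x := (ENNReal.toReal_eq_toReal_iff' (hfinT a) hx).1 hax
  refine ⟨a, ha.1, ha.2, hax'.le, ?_⟩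
  have : ∫⁻ t in Ioc 0 T, g t = (∫⁻ t in Ioc 0 a, g t) + ∫⁻ t in Ioc a T, g t := by
    rw [← lintegral_union measurableSet_Ioc (Ioc_disjoint_Ioc_of_le le_rfl),
      Ioc_union_Ioc_eq_Ioc ha.1 ha.2]
  rw [this, hax'] at h
  exact (ENNReal.add_le_add_iff_left hx).1 h

/-- Finiteness of `X` is essential: the inequality carries no information at `⊤`. This is the reason
for working with weighted norms. -/
theorem le_two_mul_of_le_add_half {X a : ℝ≥0∞} (hX : X ≠ ⊤) (h : X ≤ a + 2⁻¹ * X) :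
    X ≤ 2 * a := by
  by_cases ha : a = ⊤
  · simp [ha]
  lift X to NNReal using hX
  lift a to NNReal using ha
  have h' : X ≤ a + 2⁻¹ * X := by
    have e : (2⁻¹ : ℝ≥0∞) = ((2⁻¹ : NNReal) : ℝ≥0∞) := by simp
    rw [e] at h
    exact_mod_cast h
  have : X ≤ 2 * a := by
    rw [← NNReal.coe_le_coe] at h' ⊢
    push_cast at h' ⊢
    linarith
  exact_mod_cast this

/-- This replaces Gronwall's lemma. On a piece of time where `∫ v²` is at most `δ`, Cauchy–Schwarz
bounds the corresponding part of the right-hand side by half of the left-hand side. Finitely many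
such pieces cover the half-line. The bound `K` is chosen before `M`, which makes it uniform over the
weighted norms. -/
theorem exists_bound_of_sq_volterra {v : ℝ → ℝ≥0∞} (hv : Measurable v)
    (hfin : ∫⁻ t in Ioi (0 : ℝ), v t ^ 2 < ⊤) {A B : ℝ≥0∞} (hA : A < ⊤) (hB : B < ⊤) :
    ∃ K < ⊤, ∀ M : ℝ → ℝ≥0∞, Measurable M → (∀ T, ∫⁻ t in Ioc 0 T, M t ^ 2 < ⊤) →
      (∀ T, ∫⁻ t in Ioc 0 T, M t ^ 2 ≤ A + B * (∫⁻ t in Ioc 0 T, M t * v t) ^ 2) →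
      ∀ T, 0 ≤ T → ∫⁻ t in Ioc 0 T, M t ^ 2 ≤ K := by
  set E := ∫⁻ t in Ioi (0 : ℝ), v t ^ 2 with hE
  -- Chosen so that `2 B δ ≤ 1/2`; the summand `1` covers the case `B = 0`.
  set δ : ℝ≥0∞ := (4 * (B + 1))⁻¹ with hδ
  have hδ0 : δ ≠ 0 := ENNReal.inv_ne_zero.2 (by finiteness)
  have hδt : δ ≠ ⊤ := ENNReal.inv_ne_top.2 (by positivity)
  have hBδ : 2 * B * δ ≤ 2⁻¹ := by
    rw [hδ, ← div_eq_mul_inv]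
    apply ENNReal.div_le_of_le_mul
    calc 2 * B ≤ 2 * (B + 1) := by gcongr; exact le_self_add
      _ = (2⁻¹ * 2) * (2 * (B + 1)) := by
          rw [ENNReal.inv_mul_cancel (by norm_num) (by norm_num), one_mul]
      _ = _ := by ring
  have ind : ∀ n : ℕ, ∃ K < ⊤, ∀ M : ℝ → ℝ≥0∞, Measurable M →
      (∀ T, ∫⁻ t in Ioc 0 T, M t ^ 2 < ⊤) →
      (∀ T, ∫⁻ t in Ioc 0 T, M t ^ 2 ≤ A + B * (∫⁻ t in Ioc 0 T, M t * v t) ^ 2) →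
      ∀ T, 0 ≤ T → ∫⁻ t in Ioc 0 T, v t ^ 2 ≤ n * δ → ∫⁻ t in Ioc 0 T, M t ^ 2 ≤ K := by
    intro n
    induction n with
    | zero =>
      -- With no pieces available `v` vanishes almost everywhere up to `T`, and only `A` remains.
      refine ⟨A, hA, fun M hM _ h T _ hT => (h T).trans ?_⟩
      have h0 : ∫⁻ t in Ioc 0 T, v t ^ 2 = 0 := by simpa using hT
      rw [lintegral_eq_zero_iff (hv.pow_const 2)] at h0
      have : ∫⁻ t in Ioc 0 T, M t * v t = 0 := by
        rw [← lintegral_zero (μ := volume.restrict (Ioc 0 T))]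
        refine lintegral_congr_ae ?_
        filter_upwards [h0] with t ht
        have : v t = 0 := by simpa using ht
        simp [this]
      simp [this]
    | succ n ih =>
      obtain ⟨K, hK, ih⟩ := ih
      -- The past contributes `2B · K E` by the induction hypothesis and Cauchy–Schwarz; the last
      -- piece contributes `2Bδ X ≤ X/2`, and absorbing it doubles the rest.
      refine ⟨2 * (A + 2 * B * (K * E)), by finiteness, fun M hM hMf h T hT0 hT => ?_⟩
      obtain ⟨a, ha0, haT, h1, h2⟩ := exists_split_of_lintegral_le (hv.pow_const 2) hfin hT0
        (x := n * δ) (y := δ) (by finiteness) (hT.trans (by push_cast; rw [add_mul, one_mul]))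
      have hKa := ih M hM hMf h a ha0 h1
      refine le_two_mul_of_le_add_half (hMf T).ne ?_
      have split : ∫⁻ t in Ioc 0 T, M t * v t =
          (∫⁻ t in Ioc 0 a, M t * v t) + ∫⁻ t in Ioc a T, M t * v t := by
        rw [← lintegral_union measurableSet_Ioc (Ioc_disjoint_Ioc_of_le le_rfl),
          Ioc_union_Ioc_eq_Ioc ha0 haT]
      have c1 : (∫⁻ t in Ioc 0 a, M t * v t) ^ 2 ≤ K * E := by
        refine (sq_lintegral_mul_le _ hM.aemeasurable hv.aemeasurable).trans ?_
        gcongr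
        exact lintegral_mono_set Ioc_subset_Ioi_self
      have c2 : (∫⁻ t in Ioc a T, M t * v t) ^ 2 ≤ (∫⁻ t in Ioc 0 T, M t ^ 2) * δ := by
        refine (sq_lintegral_mul_le _ hM.aemeasurable hv.aemeasurable).trans ?_
        gcongr
      set X := ∫⁻ t in Ioc 0 T, M t ^ 2
      calc X ≤ A + B * (∫⁻ t in Ioc 0 T, M t * v t) ^ 2 := h T
        _ ≤ A + B * (2 * (K * E + X * δ)) := by
            rw [split]
            gcongr
            exact (ENNReal_add_sq_le _ _).trans (by gcongr)
        _ = A + 2 * B * (K * E) + 2 * B * δ * X := by ring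
        _ ≤ A + 2 * B * (K * E) + 2⁻¹ * X := by gcongr
  obtain ⟨n, hn⟩ := ENNReal.exists_nat_mul_gt hδ0 hfin.ne
  obtain ⟨K, hK, h⟩ := ind n
  refine ⟨K, hK, fun M hM hMf hM' T hT => h M hM hMf hM' T hT ?_⟩
  exact (lintegral_mono_set Ioc_subset_Ioi_self).trans hn.le

/-- The squared weight decays like `|ξ|⁻⁴`, which is integrable in the plane; for `ε ≤ 1` one has `1
+ ε|ξ|² ≥ ε(1 + |ξ|²)`. -/
theorem lintegral_weight_sq_lt_top {ε : ℝ} (hε : 0 < ε) (hε1 : ε ≤ 1) :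
    ∫⁻ ξ, weight ε ξ ^ 2 < ⊤ := by
  have hI : Integrable fun ξ : Plane => (1 + ‖ξ‖ ^ 2) ^ (-(4 : ℝ) / 2) :=
    integrable_rpow_neg_one_add_norm_sq (by simp; norm_num)
  have h2 := (hI.const_mul (ε⁻¹ ^ 2)).lintegral_lt_top
  refine lt_of_le_of_lt (lintegral_mono fun ξ => ?_) h2
  unfold weight
  rw [← ENNReal.ofReal_pow (by positivity)]
  apply ENNReal.ofReal_le_ofReal
  rw [show (-(4 : ℝ) / 2) = -((2 : ℕ) : ℝ) by norm_num, Real.rpow_neg (by positivity),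
    Real.rpow_natCast, ← inv_pow, ← mul_pow, ← mul_inv, one_div]
  gcongr
  nlinarith [sq_nonneg ‖ξ‖]

/-- Square integrability in time of the `L¹` norm in frequency, for nonnegative functions that
satisfy the Duhamel inequality of the two-dimensional Navier--Stokes system. -/
theorem lintegral_sq_lintegral_lt_top_of_duhamel {κ : ℝ} (hκ : 0 < κ) {U : ℝ → Plane → ℝ≥0∞}
    (hU : Measurable (Function.uncurry U)) {U₀ : Plane → ℝ≥0∞} (hU₀ : Measurable U₀)
    (hU₀2 : ∫⁻ ξ, U₀ ξ ^ 2 < ⊤) {K₀ : ℝ≥0∞} (hK₀ : K₀ < ⊤)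
    (hL2 : ∀ᵐ t ∂(volume : Measure ℝ).restrict (Ioi 0), ∫⁻ ξ, U t ξ ^ 2 ≤ K₀)
    (hH1 : ∫⁻ t in Ioi (0 : ℝ), ∫⁻ ξ, (ENNReal.ofReal ‖ξ‖ * U t ξ) ^ 2 < ⊤)
    {c : ℝ≥0∞} (hc : c < ⊤)
    (hD : ∀ᵐ t ∂(volume : Measure ℝ).restrict (Ioi 0), ∀ᵐ ξ : Plane,
      U t ξ ≤ c * (heat κ t ξ * U₀ ξ +
        ∫⁻ s in Ioo 0 t, heat κ (t - s) ξ * bilin (U s) ξ)) :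
    ∫⁻ t in Ioi (0 : ℝ), (∫⁻ ξ, U t ξ) ^ 2 < ⊤ := by
  obtain ⟨C, hCt, hC⟩ := exists_lintegral_sq_heat_le hκ
  have mU : ∀ t, Measurable (U t) := fun t => hU.comp measurable_prodMk_left
  have mh := measurable_heat κ
  have mb : Measurable fun z : ℝ × Plane => bilin (U z.1) z.2 := by
    refine Measurable.mul (by fun_prop) ?_
    refine Measurable.lintegral_prod_right'
      (f := fun z : (ℝ × Plane) × Plane => U z.1.1 z.2 * U z.1.1 (z.1.2 + z.2)) ?_
    exact (hU.comp (measurable_fst.fst.prodMk measurable_snd)).mul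
      (hU.comp (measurable_fst.fst.prodMk (measurable_fst.snd.add measurable_snd)))
  set E : ℝ → ℝ≥0∞ := fun t => ∫⁻ ξ, (ENNReal.ofReal ‖ξ‖ * U t ξ) ^ 2 with hE
  have mE : Measurable E := Measurable.lintegral_prod_right'
    (f := fun z : ℝ × Plane => (ENNReal.ofReal ‖z.2‖ * U z.1 z.2) ^ 2)
    (Measurable.pow_const (Measurable.mul (by fun_prop) hU) 2)
  set v : ℝ → ℝ≥0∞ := fun t => E t ^ (1 / 2 : ℝ) with hv
  have mv : Measurable v := mE.pow_const _
  have hv2 : ∀ t, v t ^ 2 = E t := fun t => ENNReal_sqrt_sq _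
  set D : ℝ≥0∞ := (10000 * (1 + ENNReal.ofReal Real.pi)) ^ (1 / 2 : ℝ) with hDdef
  have hDt : D < ⊤ := by finiteness
  set Etot := ∫⁻ t in Ioi (0 : ℝ), E t with hEtot
  set A : ℝ≥0∞ := c ^ 2 * 2 * (C * (∫⁻ ξ, U₀ ξ ^ 2) + C * (D ^ 2 * (2 * Etot ^ 2))) with hA
  set B : ℝ≥0∞ := c ^ 2 * 2 * C * (D ^ 2 * 2) with hB
  have hAt : A < ⊤ := by finiteness
  have hBt : B < ⊤ := by finiteness
  obtain ⟨K, hK, hbound⟩ := exists_bound_of_sq_volterra mv (by simpa only [hv2] using hH1) hAt hBt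
  -- The regularized `L¹` norm. The constants `A`, `B`, and hence `K`, were fixed without reference
  -- to `ε`.
  set M : ℝ → ℝ → ℝ≥0∞ := fun ε t => ∫⁻ ξ, weight ε ξ * U t ξ with hM
  have mM : ∀ ε, Measurable (M ε) := fun ε => Measurable.lintegral_prod_right'
    (f := fun z : ℝ × Plane => weight ε z.2 * U z.1 z.2)
    (((measurable_weight ε).comp measurable_snd).mul hU)
  have hMT : ∀ ε, 0 < ε → ε ≤ 1 → ∀ T, 0 ≤ T → ∫⁻ t in Ioc 0 T, M ε t ^ 2 ≤ K := by
    intro ε hε hε1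
    have mw := measurable_weight ε
    refine hbound (M ε) (mM ε) (fun T => ?_) (fun T => ?_)
    -- Qualitative finiteness only: the weight is in `L²` and `U t` is bounded in `L²`. The
    -- resulting bound depends on `ε` and `T` and is not used quantitatively.
    · calc ∫⁻ t in Ioc 0 T, M ε t ^ 2
          ≤ ∫⁻ t in Ioc 0 T, (∫⁻ ξ, weight ε ξ ^ 2) * K₀ := by
            refine lintegral_mono_ae ?_
            filter_upwards [ae_restrict_of_ae_restrict_of_subset Ioc_subset_Ioi_self hL2] with t ht
            exact (sq_lintegral_mul_le _ mw.aemeasurable (mU t).aemeasurable).trans (by gcongr)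
        _ < ⊤ := by
            rw [lintegral_const]
            have := lintegral_weight_sq_lt_top hε hε1
            simp only [MeasurableSet.univ, Measure.restrict_apply, univ_inter, Real.volume_Ioc]
            finiteness
    -- The weight depends on `ξ` alone, so it commutes with the heat multiplier and passes onto the
    -- bilinear term; on the free evolution it is bounded by `1`.
    · set f : ℝ → Plane → ℝ≥0∞ := fun s ξ => weight ε ξ * bilin (U s) ξ with hf
      have mf : Measurable (Function.uncurry f) := (mw.comp measurable_snd).mul mb
      have m0 : Measurable fun t => ∫⁻ ξ, heat κ t ξ * U₀ ξ := Measurable.lintegral_prod_right'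
        (f := fun z : ℝ × Plane => heat κ z.1 z.2 * U₀ z.2) (mh.mul (hU₀.comp measurable_snd))
      have hMle : ∀ᵐ t ∂(volume : Measure ℝ).restrict (Ioc 0 T), M ε t ≤
          c * ((∫⁻ ξ, heat κ t ξ * U₀ ξ) +
            ∫⁻ ξ, ∫⁻ s in Ioo 0 t, heat κ (t - s) ξ * f s ξ) := by
        filter_upwards [ae_restrict_of_ae_restrict_of_subset Ioc_subset_Ioi_self hD] with t ht
        have m1 : Measurable fun ξ => heat κ t ξ * U₀ ξ := by
          have : Measurable fun ξ => heat κ t ξ := mh.comp measurable_prodMk_left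
          exact this.mul hU₀
        rw [← lintegral_add_left m1, ← lintegral_const_mul' _ _ hc.ne]
        refine lintegral_mono_ae ?_
        filter_upwards [ht] with ξ hξ
        calc weight ε ξ * U t ξ ≤ weight ε ξ * (c * (heat κ t ξ * U₀ ξ +
              ∫⁻ s in Ioo 0 t, heat κ (t - s) ξ * bilin (U s) ξ)) := by gcongr
          _ = c * (weight ε ξ * (heat κ t ξ * U₀ ξ) +
              weight ε ξ * ∫⁻ s in Ioo 0 t, heat κ (t - s) ξ * bilin (U s) ξ) := by ring
          _ ≤ _ := by
              refine mul_le_mul_right (add_le_add ?_ ?_) c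
              · exact mul_le_of_le_one_left zero_le (weight_le_one hε.le ξ)
              · rw [← lintegral_const_mul' _ _ (by unfold weight; finiteness)]
                refine lintegral_mono fun s => le_of_eq ?_
                simp only [f]; ring
      have hf12 : ∀ s, (∫⁻ ξ, f s ξ ^ 2) ^ (1 / 2 : ℝ) ≤ D * (M ε s * v s + E s) := by
        intro s
        calc (∫⁻ ξ, f s ξ ^ 2) ^ (1 / 2 : ℝ)
            ≤ (10000 * (1 + ENNReal.ofReal Real.pi) *
              (M ε s ^ 2 * E s + E s ^ 2)) ^ (1 / 2 : ℝ) := by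
              gcongr
              exact lintegral_sq_weight_mul_bilin_le hε.le (mU s)
          _ = D * (M ε s ^ 2 * E s + E s ^ 2) ^ (1 / 2 : ℝ) := by
              rw [ENNReal.mul_rpow_of_nonneg _ _ (by norm_num)]
          _ ≤ D * ((M ε s ^ 2 * E s) ^ (1 / 2 : ℝ) + (E s ^ 2) ^ (1 / 2 : ℝ)) := by
              gcongr
              exact ENNReal.rpow_add_le_add_rpow _ _ (by norm_num) (by norm_num)
          _ = _ := by
              rw [ENNReal.mul_rpow_of_nonneg _ _ (by norm_num), ENNReal_sq_sqrt, ENNReal_sq_sqrt]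
      have m12 : Measurable fun s => M ε s * v s := (mM ε).mul mv
      have hbil : (∫⁻ s in Ioc 0 T, (∫⁻ ξ, f s ξ ^ 2) ^ (1 / 2 : ℝ)) ^ 2 ≤
          D ^ 2 * (2 * ((∫⁻ s in Ioc 0 T, M ε s * v s) ^ 2 + Etot ^ 2)) := by
        calc _ ≤ (∫⁻ s in Ioc 0 T, D * (M ε s * v s + E s)) ^ 2 := by
              gcongr with s; exact hf12 s
          _ = D ^ 2 * ((∫⁻ s in Ioc 0 T, M ε s * v s) + ∫⁻ s in Ioc 0 T, E s) ^ 2 := by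
              rw [lintegral_const_mul' _ _ hDt.ne, mul_pow, lintegral_add_left m12]
          _ ≤ D ^ 2 * ((∫⁻ s in Ioc 0 T, M ε s * v s) + Etot) ^ 2 := by
              gcongr
              exact lintegral_mono_set Ioc_subset_Ioi_self
          _ ≤ _ := by gcongr; exact ENNReal_add_sq_le _ _
      calc ∫⁻ t in Ioc 0 T, M ε t ^ 2
          ≤ ∫⁻ t in Ioc 0 T, c ^ 2 * (2 * ((∫⁻ ξ, heat κ t ξ * U₀ ξ) ^ 2 +
            (∫⁻ ξ, ∫⁻ s in Ioo 0 t, heat κ (t - s) ξ * f s ξ) ^ 2)) := by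
            refine lintegral_mono_ae ?_
            filter_upwards [hMle] with t ht
            calc _ ≤ _ := pow_le_pow_left₀ zero_le ht 2
              _ ≤ _ := by rw [mul_pow]; gcongr; exact ENNReal_add_sq_le _ _
        _ = c ^ 2 * (2 * ((∫⁻ t in Ioc 0 T, (∫⁻ ξ, heat κ t ξ * U₀ ξ) ^ 2) +
            ∫⁻ t in Ioc 0 T, (∫⁻ ξ, ∫⁻ s in Ioo 0 t, heat κ (t - s) ξ * f s ξ) ^ 2)) := by
            rw [lintegral_const_mul' _ _ (by finiteness), lintegral_const_mul' _ _ (by finiteness),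
              lintegral_add_left (m0.pow_const 2)]
        _ ≤ c ^ 2 * (2 * (C * (∫⁻ ξ, U₀ ξ ^ 2) +
            C * (D ^ 2 * (2 * ((∫⁻ s in Ioc 0 T, M ε s * v s) ^ 2 + Etot ^ 2))))) := by
            gcongr
            · exact (lintegral_mono_set Ioc_subset_Ioi_self).trans (hC _ hU₀)
            · exact (lintegral_sq_duhamel_le hC mf T).trans (by gcongr)
        _ = _ := by rw [hA, hB]; ring
  set ε : ℕ → ℝ := fun n => 1 / ((n : ℝ) + 1) with hε
  have hε0 : ∀ n, 0 < ε n := fun n => by positivity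
  have hε1 : ∀ n, ε n ≤ 1 := fun n => by
    rw [hε]; simp only; rw [div_le_one (by positivity)]; linarith [n.cast_nonneg (α := ℝ)]
  have hεa : Antitone ε := fun m n h => by
    simp only [hε]; gcongr
  have hεt : Filter.Tendsto ε Filter.atTop (nhds 0) := tendsto_one_div_add_atTop_nhds_zero_nat
  -- The time horizon `n` and the weight parameter `1/(n+1)` are sent to their limits together, so
  -- one monotone convergence suffices.
  set F : ℕ → ℝ → ℝ≥0∞ := fun n => (Ioc (0 : ℝ) n).indicator fun t => M (ε n) t ^ 2 with hF
  have mwt : ∀ ξ, Monotone fun n => weight (ε n) ξ := by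
    intro ξ m n h
    simp only [weight]
    apply ENNReal.ofReal_le_ofReal
    have h1 := hεa h
    have h2 := (hε0 n).le
    gcongr
  have hMmono : ∀ t, Monotone fun n => M (ε n) t := fun t m n h =>
    lintegral_mono fun ξ => mul_le_mul_left (mwt ξ h) _
  have hFmono : ∀ t, Monotone fun n => F n t := by
    intro t m n h
    simp only [F]
    refine (indicator_le_indicator_of_subset (Ioc_subset_Ioc_right (Nat.cast_le.2 h))
      (fun _ => zero_le) t).trans (indicator_le_indicator ?_)
    exact pow_le_pow_left₀ zero_le (hMmono t h) 2
  have hMlim : ∀ t, Filter.Tendsto (fun n => M (ε n) t) Filter.atTop (nhds (∫⁻ ξ, U t ξ)) := by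
    intro t
    refine lintegral_tendsto_of_tendsto_of_monotone
      (fun n => ((measurable_weight _).mul (mU t)).aemeasurable)
      (.of_forall fun ξ m n h => mul_le_mul_left (mwt ξ h) _) (.of_forall fun ξ => ?_)
    have : Filter.Tendsto (fun n => weight (ε n) ξ) Filter.atTop (nhds 1) := by
      have h1 : Filter.Tendsto (fun n => 1 / (1 + ε n * ‖ξ‖ ^ 2)) Filter.atTop
          (nhds (1 / (1 + 0 * ‖ξ‖ ^ 2))) := by
        refine Filter.Tendsto.div tendsto_const_nhds
          (tendsto_const_nhds.add (hεt.mul_const _)) (by simp)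
      have h2 := ENNReal.tendsto_ofReal h1
      simpa only [weight, zero_mul, add_zero, div_one, ENNReal.ofReal_one] using h2
    simpa using ENNReal.Tendsto.mul_const (b := U t ξ) this (Or.inl one_ne_zero)
  have hFlim : ∀ t ∈ Ioi (0 : ℝ), Filter.Tendsto (fun n => F n t) Filter.atTop
      (nhds ((∫⁻ ξ, U t ξ) ^ 2)) := by
    intro t ht
    refine ((ENNReal.continuous_pow 2).tendsto _ |>.comp (hMlim t)).congr' ?_
    filter_upwards [Filter.eventually_ge_atTop ⌈t⌉₊] with n hn
    have : t ∈ Ioc (0 : ℝ) n := ⟨ht, (Nat.le_ceil t).trans (Nat.cast_le.2 hn)⟩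
    simp [F, indicator_of_mem this]
  have hlim := lintegral_tendsto_of_tendsto_of_monotone (μ := volume.restrict (Ioi (0 : ℝ)))
    (f := F) (F := fun t => (∫⁻ ξ, U t ξ) ^ 2)
    (fun n => (((mM _).pow_const 2).indicator measurableSet_Ioc).aemeasurable)
    (.of_forall hFmono) (by
      filter_upwards [self_mem_ae_restrict measurableSet_Ioi] with t ht using hFlim t ht)
  refine lt_of_le_of_lt (le_of_tendsto' hlim fun n => ?_) hK
  refine (setLIntegral_le_lintegral _ _).trans ?_
  rw [lintegral_indicator measurableSet_Ioc]
  exact hMT _ (hε0 n) (hε1 n) _ n.cast_nonneg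

end NavierStokes2D

/-! ### Density of compactly supported functions in Schwartz space, and tempered functions. -/

namespace NavierStokes2D

open SchwartzMap FourierTransform Filter Topology

section Density

/-- A smooth cutoff on the ball of radius `n + 1`. -/
noncomputable def cutoff (n : ℕ) (x : Plane) : ℂ :=
  (((⟨1, 2, one_pos, one_lt_two⟩ : ContDiffBump (0 : Plane)) (((n : ℝ) + 1)⁻¹ • x) : ℝ) : ℂ)

theorem contDiff_cutoff (n : ℕ) : ContDiff ℝ ∞ (cutoff n) := by
  unfold cutoff
  exact Complex.ofRealCLM.contDiff.comp ((ContDiffBump.contDiff _).comp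
    (contDiff_const_smul (((n : ℝ) + 1)⁻¹)))

theorem hasCompactSupport_cutoff (n : ℕ) : HasCompactSupport (cutoff n) := by
  have hc : ((n : ℝ) + 1)⁻¹ ≠ 0 := by positivity
  have h1 : HasCompactSupport fun x : Plane =>
      ((⟨1, 2, one_pos, one_lt_two⟩ : ContDiffBump (0 : Plane)) (((n : ℝ) + 1)⁻¹ • x) : ℝ) :=
    (ContDiffBump.hasCompactSupport _).comp_homeomorph (Homeomorph.smulOfNeZero _ hc)
  exact h1.comp_left (g := fun r : ℝ => (r : ℂ)) (by simp)

theorem cutoff_eq_one {n : ℕ} {x : Plane} (hx : ‖x‖ ≤ n + 1) : cutoff n x = 1 := by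
  unfold cutoff
  rw [ContDiffBump.one_of_mem_closedBall]
  · simp
  · have : (0 : ℝ) < n + 1 := by positivity
    rw [mem_closedBall_zero_iff, norm_smul, norm_inv, Real.norm_of_nonneg this.le,
      inv_mul_le_iff₀ this]
    simpa using hx

/-- Dilating a fixed bump by the factor `(n+1)⁻¹ ≤ 1` can only decrease its derivatives, so the
bound is uniform in `n`. -/
theorem exists_bound_iteratedFDeriv_one_sub_cutoff (i : ℕ) :
    ∃ B, 0 ≤ B ∧ ∀ n x, ‖iteratedFDeriv ℝ i (fun y => 1 - cutoff n y) x‖ ≤ B := by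
  set f : 𝓢(Plane, ℂ) := HasCompactSupport.toSchwartzMap
    (f := fun x : Plane => (((⟨1, 2, one_pos, one_lt_two⟩ : ContDiffBump (0 : Plane)) x : ℝ) : ℂ))
    ((ContDiffBump.hasCompactSupport _).comp_left (g := fun r : ℝ => (r : ℂ)) (by simp))
    (Complex.ofRealCLM.contDiff.comp (ContDiffBump.contDiff _)) with hf
  refine ⟨1 + SchwartzMap.seminorm ℝ 0 i f, by positivity, fun n x => ?_⟩
  set c : ℝ := ((n : ℝ) + 1)⁻¹ with hc
  have hc1 : |c| ≤ 1 := by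
    rw [hc, abs_of_pos (by positivity)]
    exact inv_le_one_of_one_le₀ (by linarith [n.cast_nonneg (α := ℝ)])
  have e : cutoff n = f ∘ (c • ContinuousLinearMap.id ℝ Plane) := by
    ext y; rfl
  have hi : ((i : ℕ∞) : ℕ∞ω) ≤ ((⊤ : ℕ∞) : ℕ∞ω) := mod_cast le_top
  rw [fun_iteratedFDeriv_sub_apply (by fun_prop) ((contDiff_cutoff n).of_le hi).contDiffAt]
  refine (norm_sub_le _ _).trans (add_le_add ?_ ?_)
  · rcases Nat.eq_zero_or_pos i with rfl | h
    · simp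
    · rw [iteratedFDeriv_const_of_ne h.ne']; simp
  · rw [e, ContinuousLinearMap.iteratedFDeriv_comp_right _ (f.smooth i) x le_rfl]
    refine (ContinuousMultilinearMap.norm_compContinuousLinearMap_le _ _).trans ?_
    refine (mul_le_of_le_one_right (norm_nonneg _) ?_).trans
      (norm_iteratedFDeriv_le_seminorm ℝ f i _)
    refine Finset.prod_le_one (fun _ _ => norm_nonneg _) fun _ _ => ?_
    rw [norm_smul]
    exact mul_le_one₀ hc1 (norm_nonneg _) ContinuousLinearMap.norm_id_le

/-- The product of a Schwartz function with a cutoff. -/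
noncomputable def truncate (n : ℕ) (ψ : 𝓢(Plane, ℂ)) : 𝓢(Plane, ℂ) :=
  ((hasCompactSupport_cutoff n).mul_right (f' := ψ)).toSchwartzMap
    ((contDiff_cutoff n).mul (ψ.smooth ⊤))

theorem hasCompactSupport_truncate (n : ℕ) (ψ : 𝓢(Plane, ℂ)) :
    HasCompactSupport (truncate n ψ) :=
  (hasCompactSupport_cutoff n).mul_right (f' := ψ)

theorem truncate_apply (n : ℕ) (ψ : 𝓢(Plane, ℂ)) (x : Plane) :
    truncate n ψ x = cutoff n x * ψ x := rfl

/-- The difference vanishes where `|x| < n + 1`. Elsewhere one extra power of `|x|`, controlled by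
the next Schwartz seminorm, is traded for the factor `1/(n+1)`. -/
theorem tendsto_truncate (ψ : 𝓢(Plane, ℂ)) :
    Tendsto (fun n => truncate n ψ) atTop (𝓝 ψ) := by
  rw [(schwartz_withSeminorms ℝ Plane ℂ).tendsto_nhds_atTop]
  rintro ⟨k, l⟩ ε hε
  choose B hB0 hB using exists_bound_iteratedFDeriv_one_sub_cutoff
  set C : ℝ := ∑ i ∈ Finset.range (l + 1), (l.choose i : ℝ) * B i *
    SchwartzMap.seminorm ℝ (k + 1) (l - i) ψ with hC
  have hC0 : 0 ≤ C := Finset.sum_nonneg fun i _ => by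
    have := hB0 i
    positivity
  obtain ⟨N, hN⟩ := exists_nat_gt (C / ε)
  refine ⟨N, fun n hn => ?_⟩
  rw [schwartzSeminormFamily_apply]
  have hn1 : (0 : ℝ) < n + 1 := by positivity
  refine lt_of_le_of_lt (SchwartzMap.seminorm_le_bound ℝ k l _ (M := C / (n + 1))
    (by positivity) fun x => ?_) ?_
  · have e : ∀ y, (truncate n ψ - ψ) y = -((1 - cutoff n y) * ψ y) := fun y => by
      simp only [sub_apply, truncate_apply]; ring
    by_cases hx : ‖x‖ < n + 1
    · have : (truncate n ψ - ψ : 𝓢(Plane, ℂ)) =ᶠ[𝓝 x] fun _ => (0 : ℂ) := by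
        filter_upwards [(isOpen_lt continuous_norm continuous_const).mem_nhds hx] with y hy
        rw [e, cutoff_eq_one (le_of_lt hy)]; simp
      rw [(this.iteratedFDeriv ℝ l).eq_of_nhds]
      simp
      positivity
    · push Not at hx
      have e' : ((truncate n ψ - ψ : 𝓢(Plane, ℂ)) : Plane → ℂ) =
          -(fun y => (1 - cutoff n y) * ψ y) := funext e
      rw [e', iteratedFDeriv_neg_apply, norm_neg, le_div_iff₀ hn1]
      have hg : ContDiff ℝ ∞ fun y => 1 - cutoff n y := contDiff_const.sub (contDiff_cutoff n)
      have hl : ((l : ℕ∞) : ℕ∞ω) ≤ ((⊤ : ℕ∞) : ℕ∞ω) := mod_cast le_top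
      have hm := norm_iteratedFDeriv_mul_le hg (ψ.smooth ⊤) x (n := l) hl
      calc ‖x‖ ^ k * ‖iteratedFDeriv ℝ l (fun y => (1 - cutoff n y) * ψ y) x‖ * (n + 1)
          ≤ ‖x‖ ^ k * (∑ i ∈ Finset.range (l + 1), (l.choose i : ℝ) *
            ‖iteratedFDeriv ℝ i (fun y => 1 - cutoff n y) x‖ *
            ‖iteratedFDeriv ℝ (l - i) ψ x‖) * ‖x‖ := by gcongr
        _ = ∑ i ∈ Finset.range (l + 1), (l.choose i : ℝ) *
            ‖iteratedFDeriv ℝ i (fun y => 1 - cutoff n y) x‖ *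
            (‖x‖ ^ (k + 1) * ‖iteratedFDeriv ℝ (l - i) ψ x‖) := by
            rw [Finset.mul_sum, Finset.sum_mul]
            exact Finset.sum_congr rfl fun i _ => by ring
        _ ≤ C := by
            refine Finset.sum_le_sum fun i _ => ?_
            have := hB0 i
            gcongr
            · exact hB i n x
            · exact SchwartzMap.le_seminorm ℝ _ _ ψ x
  · rw [div_lt_iff₀ hn1]
    rw [div_lt_iff₀ hε] at hN
    have : (N : ℝ) ≤ n := by exact_mod_cast hn
    nlinarith

end Density

section Tempered

/-- Functions that become integrable after division by a power of `1 + |ξ|`. -/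
def TemperedIntegrable (H : Plane → ℂ) : Prop :=
  ∃ k : ℕ, Integrable fun ξ => ((1 + ‖ξ‖) ^ k)⁻¹ • H ξ

theorem TemperedIntegrable.of_le {H : Plane → ℂ} {k l : ℕ} (hkl : k ≤ l)
    (h : Integrable fun ξ : Plane => ((1 + ‖ξ‖) ^ k)⁻¹ • H ξ) :
    Integrable fun ξ : Plane => ((1 + ‖ξ‖) ^ l)⁻¹ • H ξ := by
  have e : (fun ξ : Plane => ((1 + ‖ξ‖) ^ l)⁻¹ • H ξ) =
      fun ξ : Plane => ((1 + ‖ξ‖) ^ (l - k))⁻¹ • (((1 + ‖ξ‖) ^ k)⁻¹ • H ξ) := by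
    ext ξ
    rw [smul_smul, ← mul_inv, ← pow_add, Nat.sub_add_cancel hkl]
  rw [e]
  have hm : AEStronglyMeasurable (fun ξ : Plane => ((1 + ‖ξ‖) ^ (l - k))⁻¹) volume := by fun_prop
  refine h.bdd_smul 1 hm (.of_forall fun ξ => ?_)
  rw [norm_inv, norm_pow, Real.norm_of_nonneg (by positivity)]
  exact inv_le_one_of_one_le₀ (one_le_pow₀ (by linarith [norm_nonneg ξ]))

theorem TemperedIntegrable.add {H₁ H₂ : Plane → ℂ} (h₁ : TemperedIntegrable H₁)
    (h₂ : TemperedIntegrable H₂) : TemperedIntegrable fun ξ => H₁ ξ + H₂ ξ := by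
  obtain ⟨k, hk⟩ := h₁
  obtain ⟨l, hl⟩ := h₂
  refine ⟨max k l, ?_⟩
  simp only [smul_add]
  exact (of_le (le_max_left k l) hk).add (of_le (le_max_right k l) hl)

theorem TemperedIntegrable.mul_left {H g : Plane → ℂ} (hH : TemperedIntegrable H)
    (hg : AEStronglyMeasurable g volume) {C : ℝ} {j : ℕ}
    (hb : ∀ ξ, ‖g ξ‖ ≤ C * (1 + ‖ξ‖) ^ j) : TemperedIntegrable fun ξ => g ξ * H ξ := by
  obtain ⟨k, hk⟩ := hH
  refine ⟨j + k, ?_⟩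
  have e : (fun ξ : Plane => ((1 + ‖ξ‖) ^ (j + k))⁻¹ • (g ξ * H ξ)) =
      fun ξ : Plane => (((1 + ‖ξ‖) ^ j)⁻¹ • g ξ) • (((1 + ‖ξ‖) ^ k)⁻¹ • H ξ) := by
    ext ξ
    rw [pow_add, mul_inv, smul_eq_mul, smul_mul_smul_comm]
  rw [e]
  have hm : AEStronglyMeasurable (fun ξ : Plane => ((1 + ‖ξ‖) ^ j)⁻¹) volume := by fun_prop
  refine hk.bdd_smul C (hm.smul hg) (.of_forall fun ξ => ?_)
  change ‖((1 + ‖ξ‖) ^ j)⁻¹ • g ξ‖ ≤ C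
  rw [norm_smul, norm_inv, norm_pow, Real.norm_of_nonneg (by positivity),
    inv_mul_le_iff₀ (by positivity), mul_comm]
  exact hb ξ

theorem TemperedIntegrable.neg {H : Plane → ℂ} (h : TemperedIntegrable H) :
    TemperedIntegrable fun ξ => -H ξ := by
  obtain ⟨k, hk⟩ := h
  exact ⟨k, by simp only [smul_neg]; exact hk.neg⟩

theorem TemperedIntegrable.sub {H₁ H₂ : Plane → ℂ} (h₁ : TemperedIntegrable H₁)
    (h₂ : TemperedIntegrable H₂) : TemperedIntegrable fun ξ => H₁ ξ - H₂ ξ := by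
  simpa only [sub_eq_add_neg] using h₁.add h₂.neg

theorem TemperedIntegrable.const_mul {H : Plane → ℂ} (hH : TemperedIntegrable H) (c : ℂ) :
    TemperedIntegrable fun ξ => c * H ξ :=
  hH.mul_left aestronglyMeasurable_const (C := ‖c‖) (j := 0) (by simp)

theorem _root_.MeasureTheory.MemLp.temperedIntegrable {H : Plane → ℂ} (h : MemLp H 2) :
    TemperedIntegrable H := by
  refine ⟨2, ?_⟩
  have hw : MemLp (fun ξ : Plane => ((1 + ‖ξ‖) ^ 2)⁻¹) 2 := by
    rw [memLp_two_iff_integrable_sq (by fun_prop)]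
    have := integrable_one_add_norm (E := Plane) (μ := volume) (r := 4) (by simp; norm_num)
    refine this.congr (.of_forall fun ξ => ?_)
    simp only
    rw [← inv_pow, ← pow_mul, Real.rpow_neg (by positivity)]
    norm_cast
    simp
  exact memLp_one_iff_integrable.1 (h.smul hw)

theorem TemperedIntegrable.exists_seminorm_bound {H : Plane → ℂ} (h : TemperedIntegrable H) :
    ∃ (s : Finset (ℕ × ℕ)) (C : ℝ), 0 ≤ C ∧ ∀ ψ : 𝓢(Plane, ℂ),
      Integrable (fun ξ => H ξ * ψ ξ) ∧
      ‖∫ ξ, H ξ * ψ ξ‖ ≤ C * (s.sup (schwartzSeminormFamily ℂ Plane ℂ)) ψ := by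
  obtain ⟨k, hk⟩ := h
  refine ⟨Finset.Iic (k, 0), (∫ ξ, ‖((1 + ‖ξ‖) ^ k)⁻¹ • H ξ‖) * 2 ^ k, by positivity,
    fun ψ => ?_⟩
  have e : (fun ξ => H ξ * ψ ξ) =
      fun ξ : Plane => ((1 + ‖ξ‖) ^ k • ψ ξ) * (((1 + ‖ξ‖) ^ k)⁻¹ • H ξ) := by
    ext ξ
    have : ((1 + ‖ξ‖) ^ k) ≠ 0 := by positivity
    rw [smul_mul_smul_comm, mul_inv_cancel₀ this, one_smul, mul_comm]
  set S := ((Finset.Iic (k, 0)).sup (schwartzSeminormFamily ℂ Plane ℂ)) ψ with hS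
  have hb : ∀ ξ : Plane, ‖(1 + ‖ξ‖) ^ k • ψ ξ‖ ≤ 2 ^ k * S := by
    intro ξ
    have := one_add_le_sup_seminorm_apply (𝕜 := ℂ) (m := (k, 0)) le_rfl le_rfl ψ ξ
    rw [norm_iteratedFDeriv_zero] at this
    rw [norm_smul, norm_pow, Real.norm_of_nonneg (by positivity)]
    exact this
  have hm : AEStronglyMeasurable (fun ξ : Plane => (1 + ‖ξ‖) ^ k • ψ ξ) volume :=
    (Continuous.aestronglyMeasurable (by fun_prop))
  rw [e]
  refine ⟨hk.bdd_mul (c := 2 ^ k * S) hm (.of_forall hb), ?_⟩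
  calc _ ≤ ∫ ξ, (2 ^ k * S) * ‖((1 + ‖ξ‖) ^ k)⁻¹ • H ξ‖ := by
        refine norm_integral_le_of_norm_le (hk.norm.const_mul _) (.of_forall fun ξ => ?_)
        rw [norm_mul]
        gcongr
        exact hb ξ
    _ = _ := by rw [integral_const_mul]; ring

theorem TemperedIntegrable.integrable_mul {H : Plane → ℂ} (h : TemperedIntegrable H)
    (ψ : 𝓢(Plane, ℂ)) : Integrable fun ξ => H ξ * ψ ξ :=
  (h.exists_seminorm_bound.choose_spec.choose_spec.2 ψ).1

/-- Integration against a tempered function, as a continuous functional on Schwartz space. -/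
theorem TemperedIntegrable.continuous_integral {H : Plane → ℂ} (h : TemperedIntegrable H) :
    Continuous fun ψ : 𝓢(Plane, ℂ) => ∫ ξ, H ξ * ψ ξ := by
  obtain ⟨s, C, hC, hs⟩ := h.exists_seminorm_bound
  exact (SchwartzMap.mkCLMtoNormedSpace (𝕜 := ℂ) (𝕜' := ℂ) (σ := RingHom.id ℂ)
    (fun ψ : 𝓢(Plane, ℂ) => ∫ ξ, H ξ * ψ ξ)
    (fun f g => by
      simp only [add_apply, mul_add]
      exact integral_add (hs f).1 (hs g).1)
    (fun a f => by
      simp only [smul_apply, smul_eq_mul, RingHom.id_apply]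
      rw [← integral_const_mul]
      exact integral_congr_ae (.of_forall fun ξ => by ring))
    ⟨s, C, hC, fun f => (hs f).2⟩).continuous

theorem TemperedIntegrable.locallyIntegrable {H : Plane → ℂ} (h : TemperedIntegrable H) :
    LocallyIntegrable H := by
  obtain ⟨k, hk⟩ := h
  have e : H = fun ξ : Plane => ((1 + ‖ξ‖) ^ k) • (((1 + ‖ξ‖) ^ k)⁻¹ • H ξ) := by
    ext ξ
    have : ((1 + ‖ξ‖) ^ k) ≠ 0 := by positivity
    rw [smul_smul, mul_inv_cancel₀ this, one_smul]
  rw [e, ← locallyIntegrableOn_univ]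
  exact (hk.locallyIntegrable.locallyIntegrableOn univ).continuousOn_smul isOpen_univ.isLocallyClosed
    (by fun_prop)

/-- A tempered function that annihilates the inverse Fourier transforms of test functions
vanishes. -/
theorem TemperedIntegrable.ae_eq_zero {H : Plane → ℂ} (h : TemperedIntegrable H)
    (h0 : ∀ ψ : 𝓢(Plane, ℂ), HasCompactSupport ψ → ∫ ξ, H ξ * (𝓕⁻ ψ) ξ = 0) :
    ∀ᵐ ξ, H ξ = 0 := by
  -- The hypothesis concerns compactly supported `ψ`, whereas isolating a test function on the
  -- frequency side requires `ψ = 𝓕 G`, which need not have compact support. Density and continuity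
  -- bridge the gap.
  have hall : ∀ ψ : 𝓢(Plane, ℂ), ∫ ξ, H ξ * (𝓕⁻ ψ) ξ = 0 := by
    intro ψ
    have h1 : Tendsto (fun n => ∫ ξ, H ξ * (𝓕⁻ (truncate n ψ)) ξ) atTop
        (𝓝 (∫ ξ, H ξ * (𝓕⁻ ψ) ξ)) :=
      ((h.continuous_integral.comp (fourierInvCLM ℂ 𝓢(Plane, ℂ)).continuous).tendsto ψ).comp
        (tendsto_truncate ψ)
    simp only [h0 _ (hasCompactSupport_truncate _ ψ)] at h1
    exact tendsto_nhds_unique h1 tendsto_const_nhds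
  refine ae_eq_zero_of_integral_contDiff_smul_eq_zero h.locallyIntegrable fun g hg hgs => ?_
  have hgs' : HasCompactSupport fun x => (g x : ℂ) :=
    hgs.comp_left (g := fun r : ℝ => (r : ℂ)) (by simp)
  set G : 𝓢(Plane, ℂ) := hgs'.toSchwartzMap (Complex.ofRealCLM.contDiff.comp hg) with hG
  have := hall (𝓕 G)
  rw [fourierInv_fourier_eq] at this
  rw [← this]
  refine integral_congr_ae (.of_forall fun ξ => ?_)
  change g ξ • H ξ = H ξ * (g ξ : ℂ)
  rw [Complex.real_smul, mul_comm]

end Tempered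

end NavierStokes2D

/-! ### The `L²` Fourier transform through pairings with Schwartz functions. -/

namespace NavierStokes2D

open SchwartzMap FourierTransform Filter Topology

/-- `V` is the `L²` Fourier transform of `v`. -/
structure IsFourier (v V : Plane → ℂ) : Prop where
  memLp_left : MemLp v 2
  memLp_right : MemLp V 2
  pairing : ∀ ψ : 𝓢(Plane, ℂ), ∫ x, v x * ψ x = ∫ ξ, V ξ * (𝓕⁻ ψ) ξ

/-- The character `x ↦ exp (-2 π i ⟪x, ξ⟫)`. -/
noncomputable def phase (ξ x : Plane) : ℂ := (Real.fourierChar (-⟪x, ξ⟫_ℝ) : ℂ)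

theorem norm_phase (ξ x : Plane) : ‖phase ξ x‖ = 1 := Circle.norm_coe _

theorem continuous_phase : Continuous fun z : Plane × Plane => phase z.1 z.2 := by
  unfold phase
  fun_prop

theorem fourier_eq_integral_phase (q : Plane → ℂ) (ξ : Plane) :
    𝓕 q ξ = ∫ x, phase ξ x * q x := rfl

theorem integral_mul_eq_integral_fourier_mul {q : Plane → ℂ} (hq : Integrable q)
    (ψ : 𝓢(Plane, ℂ)) : ∫ x, q x * ψ x = ∫ ξ, 𝓕 q ξ * (𝓕⁻ ψ) ξ := by
  have h := VectorFourier.integral_fourierIntegral_smul_eq_flip (L := innerₗ Plane)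
    Real.continuous_fourierChar continuous_inner hq ((𝓕⁻ ψ).integrable (μ := volume))
  have e : VectorFourier.fourierIntegral Real.fourierChar volume (innerₗ Plane).flip
      (𝓕⁻ ψ : 𝓢(Plane, ℂ)) = ψ := by
    rw [flip_innerₗ]
    exact congrArg (fun f : 𝓢(Plane, ℂ) => (f : Plane → ℂ))
      (fourier_fourierInv_eq (F := 𝓢(Plane, ℂ)) ψ)
  rw [e] at h
  exact h.symm

theorem ae_eq_of_forall_integral_schwartz {f g : Plane → ℂ} (hf : LocallyIntegrable f)
    (hg : LocallyIntegrable g) (h : ∀ ψ : 𝓢(Plane, ℂ), ∫ x, f x * ψ x = ∫ x, g x * ψ x) :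
    f =ᵐ[volume] g := by
  refine ae_eq_of_integral_contDiff_smul_eq hf hg fun φ hφ hφs => ?_
  have hs : HasCompactSupport fun x => (φ x : ℂ) :=
    hφs.comp_left (g := fun r : ℝ => (r : ℂ)) (by simp)
  have := h (hs.toSchwartzMap (Complex.ofRealCLM.contDiff.comp hφ))
  simp only [Complex.real_smul, mul_comm (Complex.ofReal _)]
  exact this

namespace IsFourier

theorem unique {v V W : Plane → ℂ} (h : IsFourier v V) (h' : IsFourier v W) : V =ᵐ[volume] W := by
  refine ae_eq_of_forall_integral_schwartz (h.memLp_right.locallyIntegrable one_le_two)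
    (h'.memLp_right.locallyIntegrable one_le_two) fun ψ => ?_
  have h1 := h.pairing (𝓕 ψ)
  have h2 := h'.pairing (𝓕 ψ)
  rw [fourierInv_fourier_eq] at h1 h2
  rw [← h1, ← h2]

theorem congr {v w V W : Plane → ℂ} (h : IsFourier v V) (hv : v =ᵐ[volume] w)
    (hV : V =ᵐ[volume] W) : IsFourier w W where
  memLp_left := h.memLp_left.ae_eq hv
  memLp_right := h.memLp_right.ae_eq hV
  pairing ψ := by
    have e1 : ∫ x, w x * ψ x = ∫ x, v x * ψ x := by
      refine integral_congr_ae ?_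
      filter_upwards [hv] with x hx
      rw [hx]
    rw [e1, h.pairing]
    refine integral_congr_ae ?_
    filter_upwards [hV] with x hx
    rw [hx]

theorem of_toLp {v : Plane → ℂ} (hv : MemLp v 2) :
    IsFourier v ((𝓕 (hv.toLp v) : Lp (α := Plane) ℂ 2) : Plane → ℂ) where
  memLp_left := hv
  memLp_right := Lp.memLp _
  pairing ψ := by
    have h := Lp.fourier_toTemperedDistribution_eq (hv.toLp v)
    have h2 := congrArg (fun D : 𝓢'(Plane, ℂ) => D (𝓕⁻ ψ)) h
    simp only [TemperedDistribution.fourier_apply, fourier_fourierInv_eq] at h2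
    rw [Lp.toTemperedDistribution_apply, Lp.toTemperedDistribution_apply] at h2
    simp only [smul_eq_mul] at h2
    calc ∫ x, v x * ψ x = ∫ x, ψ x * hv.toLp v x := by
          refine integral_congr_ae ?_
          filter_upwards [hv.coeFn_toLp] with x hx
          rw [hx, mul_comm]
      _ = _ := h2
      _ = _ := by simp only [mul_comm]

theorem toLp_eq {v V : Plane → ℂ} (h : IsFourier v V) :
    𝓕 (h.memLp_left.toLp v) = h.memLp_right.toLp V := by
  refine Lp.ext ?_
  exact ((of_toLp h.memLp_left).unique h).trans h.memLp_right.coeFn_toLp.symm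

theorem eLpNorm_eq {v V : Plane → ℂ} (h : IsFourier v V) : eLpNorm V 2 = eLpNorm v 2 := by
  have e := congrArg (fun f => ‖f‖) h.toLp_eq
  simp only [Lp.norm_fourier_eq, Lp.norm_toLp] at e
  exact ((ENNReal.toReal_eq_toReal_iff' h.memLp_left.2.ne h.memLp_right.2.ne).1 e).symm

theorem lintegral_sq_eq {v V : Plane → ℂ} (h : IsFourier v V) :
    ∫⁻ ξ, ‖V ξ‖ₑ ^ 2 = ∫⁻ x, ‖v x‖ₑ ^ 2 := by
  have e := congrArg (fun f => f ^ 2) h.eLpNorm_eq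
  simp only [eLpNorm_eq_lintegral_rpow_enorm_toReal two_ne_zero ENNReal.ofNat_ne_top,
    ENNReal.toReal_ofNat, ENNReal.rpow_ofNat, ENNReal_sqrt_sq] at e
  exact e

theorem integral_conj_mul {v V w W : Plane → ℂ} (h : IsFourier v V) (h' : IsFourier w W) :
    ∫ x, w x * starRingEnd ℂ (v x) = ∫ ξ, W ξ * starRingEnd ℂ (V ξ) := by
  have e := Lp.inner_fourier_eq (h.memLp_left.toLp v) (h'.memLp_left.toLp w)
  rw [h.toLp_eq, h'.toLp_eq, L2.inner_def, L2.inner_def] at e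
  calc _ = ∫ x, ⟪h.memLp_left.toLp v x, h'.memLp_left.toLp w x⟫_ℂ := by
        refine integral_congr_ae ?_
        filter_upwards [h.memLp_left.coeFn_toLp, h'.memLp_left.coeFn_toLp] with x h1 h2
        rw [h1, h2]; rfl
    _ = _ := e.symm
    _ = _ := by
        refine integral_congr_ae ?_
        filter_upwards [h.memLp_right.coeFn_toLp, h'.memLp_right.coeFn_toLp] with x h1 h2
        rw [h1, h2]; rfl

theorem fourier_compSub (m : 𝓢(Plane, ℂ)) (ξ x : Plane) :
    𝓕 (compSubConstCLM ℂ ξ m) x = phase ξ x * 𝓕 m x := by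
  have h := congrFun (VectorFourier.fourierIntegral_comp_add_right Real.fourierChar
    (volume : Measure Plane) (innerₗ Plane) m (-ξ)) x
  have e : ((innerₗ Plane) (-ξ)) x = -⟪x, ξ⟫_ℝ := by
    simp [real_inner_comm]
  rw [e] at h
  rw [fourier_coe, fourier_coe]
  exact h

theorem phase_mul {v V : Plane → ℂ} (h : IsFourier v V) (ξ : Plane) :
    IsFourier (fun x => phase ξ x * v x) (fun η => V (η + ξ)) where
  memLp_left := by
    have hc : Continuous fun x => phase ξ x := by unfold phase; fun_prop
    have hm : AEStronglyMeasurable (fun x => phase ξ x * v x) volume :=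
      (hc.aestronglyMeasurable (μ := volume)).mul h.memLp_left.1
    refine h.memLp_left.of_le hm (.of_forall fun x => ?_)
    rw [norm_mul, norm_phase, one_mul]
  memLp_right := h.memLp_right.comp_measurePreserving (measurePreserving_add_right volume ξ)
  pairing ψ := by
    have h1 := h.pairing (𝓕 (compSubConstCLM ℂ ξ (𝓕⁻ ψ)))
    rw [fourierInv_fourier_eq] at h1
    simp only [fourier_compSub, fourier_fourierInv_eq, compSubConstCLM_apply] at h1
    calc _ = ∫ x, v x * (phase ξ x * ψ x) := by
          refine integral_congr_ae (.of_forall fun x => ?_)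
          simp only; ring
      _ = ∫ η, V η * (𝓕⁻ ψ) (η - ξ) := h1
      _ = _ := by
          rw [← integral_add_right_eq_self _ ξ]
          simp only [add_sub_cancel_right]

/-- The Fourier transform of a product of real square integrable functions is bounded by the
correlation of the Fourier transforms. -/
theorem enorm_fourier_mul_le {f g : Plane → ℝ} {F G : Plane → ℂ}
    (hf : IsFourier (fun x => (f x : ℂ)) F) (hg : IsFourier (fun x => (g x : ℂ)) G) (ξ : Plane) :
    ‖𝓕 (fun x => (f x * g x : ℂ)) ξ‖ₑ ≤ ∫⁻ η, ‖F η‖ₑ * ‖G (ξ + η)‖ₑ := by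
  -- Plancherel for `f` and the modulated `g`. As `f` is real, the conjugation is invisible in
  -- space, while in frequency it turns the convolution into a correlation.
  have h := hf.integral_conj_mul (hg.phase_mul ξ)
  rw [fourier_eq_integral_phase]
  calc _ = ‖∫ x, phase ξ x * (g x : ℂ) * starRingEnd ℂ (f x : ℂ)‖ₑ := by
        congr 1
        refine integral_congr_ae (.of_forall fun x => ?_)
        simp only [Complex.conj_ofReal]; ring
    _ ≤ ∫⁻ η, ‖G (η + ξ) * starRingEnd ℂ (F η)‖ₑ := by
        rw [h]; exact enorm_integral_le_lintegral_enorm _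
    _ = _ := by
        refine lintegral_congr fun η => ?_
        rw [enorm_mul, RCLike.enorm_conj, mul_comm, add_comm η]

/-- If the right-hand side is finite, `v` agrees almost everywhere with the Fourier integral of
`V(-·)`, by testing against Schwartz functions, and this integral is bounded by the `L¹` norm. -/
theorem ae_enorm_le {v V : Plane → ℂ} (h : IsFourier v V) :
    ∀ᵐ x, ‖v x‖ₑ ≤ ∫⁻ ξ, ‖V ξ‖ₑ := by
  by_cases hfin : ∫⁻ ξ, ‖V ξ‖ₑ = ⊤
  · simp [hfin]
  have hV : Integrable V := ⟨h.memLp_right.1, lt_top_iff_ne_top.2 hfin⟩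
  have hVn : Integrable fun ξ => V (-ξ) := hV.comp_neg
  have hle : ∀ x, ‖𝓕 (fun ξ => V (-ξ)) x‖ ≤ ∫ ξ, ‖V ξ‖ := fun x => by
    refine (VectorFourier.norm_fourierIntegral_le_integral_norm _ _ _ _ _).trans (le_of_eq ?_)
    exact integral_neg_eq_self (fun ξ => ‖V ξ‖) volume
  have hcont : Continuous (𝓕 (fun ξ => V (-ξ))) :=
    VectorFourier.fourierIntegral_continuous Real.continuous_fourierChar continuous_inner hVn
  have heq : v =ᵐ[volume] 𝓕 (fun ξ => V (-ξ)) := by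
    refine ae_eq_of_forall_integral_schwartz (h.memLp_left.locallyIntegrable one_le_two)
      hcont.locallyIntegrable fun ψ => ?_
    have h2 := integral_mul_eq_integral_fourier_mul hVn (𝓕 ψ)
    rw [fourierInv_fourier_eq] at h2
    rw [← h2, h.pairing, ← integral_neg_eq_self]
    refine integral_congr_ae (.of_forall fun x => ?_)
    simp only
    rw [fourierInv_coe, Real.fourierInv_eq_fourier_neg, neg_neg, ← fourier_coe]
  filter_upwards [heq] with x hx
  rw [hx, ← ofReal_norm, ← ofReal_integral_norm_eq_lintegral_enorm hV]
  exact ENNReal.ofReal_le_ofReal (hle x)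

end IsFourier

section PartialFourier

/-- A sequence of normalized bump functions concentrating at the origin, as Schwartz functions. -/
noncomputable def bump (n : ℕ) : ContDiffBump (0 : Plane) where
  rIn := 1 / ((n : ℝ) + 1)
  rOut := 2 / ((n : ℝ) + 1)
  rIn_pos := by positivity
  rIn_lt_rOut := by gcongr; norm_num

/-- The normalized bump function as a Schwartz function. -/
noncomputable def bumpSchwartz (n : ℕ) : 𝓢(Plane, ℂ) :=
  HasCompactSupport.toSchwartzMap (f := fun x => (((bump n).normed volume x : ℝ) : ℂ))
    ((bump n).hasCompactSupport_normed.comp_left (g := fun r : ℝ => (r : ℂ)) (by simp))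
    (Complex.ofRealCLM.contDiff.comp (bump n).contDiff_normed)

/-- The Fourier transform in space of a function of time and space, jointly measurable. -/
noncomputable def partialFourier (w : ℝ → Plane → ℂ) (t : ℝ) (ξ : Plane) : ℂ :=
  limUnder atTop fun n => ∫ x, w t x * (phase ξ x * 𝓕 (bumpSchwartz n) x)

/-- An `L²` transform chosen separately at each time would carry no measurability in `(t, ξ)`.
Limits of parameter integrals do. -/
theorem stronglyMeasurable_partialFourier {w : ℝ → Plane → ℂ}
    (hw : StronglyMeasurable (Function.uncurry w)) :
    StronglyMeasurable (Function.uncurry (partialFourier w)) := by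
  refine StronglyMeasurable.limUnder
    (f := fun n (z : ℝ × Plane) => ∫ x, w z.1 x * (phase z.2 x * 𝓕 (bumpSchwartz n) x))
    fun n => ?_
  refine StronglyMeasurable.integral_prod_right'
    (f := fun p : (ℝ × Plane) × Plane =>
      w p.1.1 p.2 * (phase p.1.2 p.2 * 𝓕 (bumpSchwartz n) p.2)) ?_
  refine StronglyMeasurable.mul ?_ (StronglyMeasurable.mul ?_ ?_)
  · exact hw.comp_measurable (measurable_fst.fst.prodMk measurable_snd)
  · exact (continuous_phase.comp (continuous_fst.snd.prodMk continuous_snd)).stronglyMeasurable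
  · exact ((𝓕 (bumpSchwartz n)).continuous.comp continuous_snd).stronglyMeasurable

/-- By Plancherel pairing, the `n`-th integral equals the convolution of the transform with a
normalized bump, evaluated at `ξ`. It converges to the transform at almost every point by Lebesgue
differentiation, since the ratio of the radii of the bumps is fixed. -/
theorem isFourier_partialFourier {w : ℝ → Plane → ℂ} {t : ℝ} (ht : MemLp (w t) 2) :
    IsFourier (w t) (partialFourier w t) := by
  obtain ⟨V, h⟩ : ∃ V, IsFourier (w t) V := ⟨_, IsFourier.of_toLp ht⟩
  refine h.congr ae_eq_rfl ?_
  have hr : Tendsto (fun n => (bump n).rOut) atTop (𝓝 0) := by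
    have := (tendsto_one_div_add_atTop_nhds_zero_nat (𝕜 := ℝ)).const_mul 2
    simpa [bump, div_eq_mul_inv] using this
  have hlim := ContDiffBump.ae_convolution_tendsto_right_of_locallyIntegrable
    (μ := (volume : Measure Plane)) (φ := bump) (l := atTop) (K := 2) hr
    (.of_forall fun n => by simp only [bump]; apply le_of_eq; ring)
    (h.memLp_right.locallyIntegrable one_le_two)
  filter_upwards [hlim] with ξ hξ
  have e : ∀ n, ∫ x, w t x * (phase ξ x * 𝓕 (bumpSchwartz n) x) =
      (convolution ((bump n).normed volume) V (ContinuousLinearMap.lsmul ℝ ℝ) volume) ξ := by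
    intro n
    have h1 := h.pairing (𝓕 (compSubConstCLM ℂ ξ (bumpSchwartz n)))
    rw [fourierInv_fourier_eq] at h1
    simp only [IsFourier.fourier_compSub, compSubConstCLM_apply] at h1
    rw [h1, convolution_eq_swap]
    refine integral_congr_ae (.of_forall fun η => ?_)
    simp only [ContinuousLinearMap.lsmul_apply, Complex.real_smul]
    rw [mul_comm, ← neg_sub η ξ, ContDiffBump.normed_neg]
    rfl
  simp only [partialFourier, e]
  exact hξ.limUnder_eq.symm

end PartialFourier

end NavierStokes2D

/-! ### Scalar evolution equations in time. -/

namespace NavierStokes2D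

open Filter Topology

section Time

variable {E : Type*} [NormedAddCommGroup E] [NormedSpace ℝ E] [CompleteSpace E]

theorem intervalIntegrable_of_integrableOn_Ioc {F : Type*} [NormedAddCommGroup F] {f : ℝ → F}
    (hf : ∀ T, IntegrableOn f (Ioc 0 T)) {a b : ℝ} (ha : 0 ≤ a) (hb : 0 ≤ b) :
    IntervalIntegrable f volume a b := by
  rw [intervalIntegrable_iff]
  refine (hf (max a b)).mono_set ?_
  rw [uIoc]
  exact Ioc_subset_Ioc_left (le_min ha hb)

theorem continuousOn_primitive_of_integrableOn_Ioc {F : Type*} [NormedAddCommGroup F]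
    [NormedSpace ℝ F] {f : ℝ → F}
    (hf : ∀ T, IntegrableOn f (Ioc 0 T)) (T : ℝ) :
    ContinuousOn (fun t => ∫ s in (0 : ℝ)..t, f s) (Icc 0 T) := by
  by_cases hT : 0 ≤ T
  · have := intervalIntegral.continuousOn_primitive_interval (μ := volume) (a := 0) (b := T)
      (f := f) (by rw [uIcc_of_le hT, integrableOn_Icc_iff_integrableOn_Ioc]; exact hf T)
    rwa [uIcc_of_le hT] at this
  · rw [Icc_eq_empty hT]; exact continuousOn_empty _

theorem integrableOn_primitive {f : ℝ → E} (hf : ∀ T, IntegrableOn f (Ioc 0 T)) (T : ℝ) :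
    IntegrableOn (fun t => ∫ s in (0 : ℝ)..t, f s) (Ioc 0 T) :=
  ((continuousOn_primitive_of_integrableOn_Ioc hf T).integrableOn_compact
    isCompact_Icc).mono_set Ioc_subset_Icc_self

/-- Fubini on the triangle `s ≤ t`; this plays the role of integration by parts without
differentiating the primitive. -/
theorem integral_smul_primitive {a : ℝ → ℝ} (ha : Continuous a) {f : ℝ → E}
    (hf : ∀ T, IntegrableOn f (Ioc 0 T)) {p : ℝ} (hp : 0 ≤ p) :
    ∫ t in (0 : ℝ)..p, a t • ∫ s in (0 : ℝ)..t, f s =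
      ∫ s in (0 : ℝ)..p, (∫ t in s..p, a t) • f s := by
  set ν := (volume : Measure ℝ).restrict (Ioc 0 p) with hν
  set F : ℝ → ℝ → E := fun t s => {z : ℝ × ℝ | z.2 ≤ z.1}.indicator (fun z => a z.1 • f z.2) (t, s)
    with hF
  have hS : MeasurableSet {z : ℝ × ℝ | z.2 ≤ z.1} :=
    measurableSet_le measurable_snd measurable_fst
  have haI : Integrable a ν := (ha.integrableOn_Icc).mono_set Ioc_subset_Icc_self
  have hint : Integrable (Function.uncurry F) (ν.prod ν) :=
    (haI.smul_prod (hf p)).indicator hS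
  have hsw := integral_integral_swap hint
  rw [intervalIntegral.integral_of_le hp, intervalIntegral.integral_of_le hp]
  calc _ = ∫ t, ∫ s, F t s ∂ν ∂ν := by
        refine setIntegral_congr_fun measurableSet_Ioc fun t ht => ?_
        have e : ∀ s, F t s = (Iic t).indicator (fun s => a t • f s) s := fun s => by
          simp [F, indicator]
        simp only [e]
        rw [integral_indicator measurableSet_Iic, hν, Measure.restrict_restrict measurableSet_Iic,
          intervalIntegral.integral_of_le ht.1.le, integral_smul]
        congr 3
        ext s
        simp only [mem_Ioc, mem_inter_iff, mem_Iic]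
        constructor
        · rintro ⟨h1, h2⟩; exact ⟨h2, h1, h2.trans ht.2⟩
        · rintro ⟨h1, h2, _⟩; exact ⟨h2, h1⟩
    _ = ∫ s, ∫ t, F t s ∂ν ∂ν := hsw
    _ = _ := by
        refine setIntegral_congr_fun measurableSet_Ioc fun s hs => ?_
        have e : ∀ t, F t s = (Ici s).indicator (fun t => a t • f s) t := fun t => by
          simp [F, indicator]
        simp only [e]
        rw [integral_indicator measurableSet_Ici, hν, Measure.restrict_restrict measurableSet_Ici,
          intervalIntegral.integral_of_le hs.2, integral_smul_const, ← integral_Icc_eq_integral_Ioc]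
        congr 3
        ext t
        simp only [mem_Ioc, mem_inter_iff, mem_Ici, mem_Icc]
        constructor
        · rintro ⟨h1, _, h3⟩; exact ⟨h1, h3⟩
        · rintro ⟨h1, h2⟩; exact ⟨h1, hs.1.trans_le h1, h2⟩

theorem integral_primitive {f : ℝ → E} (hf : ∀ T, IntegrableOn f (Ioc 0 T)) {p : ℝ} (hp : 0 ≤ p) :
    ∫ t in (0 : ℝ)..p, ∫ s in (0 : ℝ)..t, f s = ∫ s in (0 : ℝ)..p, (p - s) • f s := by
  simpa using integral_smul_primitive (a := fun _ => (1 : ℝ)) continuous_const hf hp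

/-- Continuity of the primitive extends the hypothesis to real endpoints, and Lebesgue
differentiation concludes. Rational endpoints matter later, when each endpoint has its own null set
of frequencies. -/
theorem ae_eq_zero_of_forall_integral_eq_zero {g : ℝ → E} (hg : ∀ T, IntegrableOn g (Ioc 0 T))
    (h : ∀ p : ℚ, 0 < p → ∫ t in (0 : ℝ)..(p : ℝ), g t = 0) :
    ∀ᵐ t ∂(volume : Measure ℝ).restrict (Ioi 0), g t = 0 := by
  have hall : ∀ p : ℝ, 0 < p → ∫ t in (0 : ℝ)..p, g t = 0 := by
    intro p hp
    have hc := continuousOn_primitive_of_integrableOn_Ioc hg (p + 1)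
    have hcl : p ∈ closure (Ioo 0 (p + 1) ∩ range ((↑) : ℚ → ℝ)) := by
      have hd : Dense (range ((↑) : ℚ → ℝ)) := Rat.denseRange_cast
      exact hd.open_subset_closure_inter isOpen_Ioo ⟨hp, by linarith⟩
    have hc' : ContinuousWithinAt (fun t => ∫ s in (0 : ℝ)..t, g s)
        (Ioo 0 (p + 1) ∩ range ((↑) : ℚ → ℝ)) p :=
      (hc p ⟨hp.le, by linarith⟩).mono (inter_subset_left.trans Ioo_subset_Icc_self)
    have := hc'.mem_closure_image hcl
    have hsub : (fun t => ∫ s in (0 : ℝ)..t, g s) '' (Ioo 0 (p + 1) ∩ range ((↑) : ℚ → ℝ)) ⊆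
        {0} := by
      rintro _ ⟨_, ⟨h1, ⟨q, rfl⟩⟩, rfl⟩
      exact h q (by exact_mod_cast h1.1)
    simpa using closure_mono hsub this
  have key : ∀ n : ℕ, ∀ᵐ t : ℝ, t ∈ Ioo (0 : ℝ) n → g t = 0 := by
    intro n
    have hI := intervalIntegrable_of_integrableOn_Ioc hg le_rfl (n.cast_nonneg (α := ℝ))
    filter_upwards [hI.ae_hasDerivAt_integral] with t ht htn
    have hd := ht (by rw [uIcc_of_le n.cast_nonneg]; exact Ioo_subset_Icc_self htn) 0
      (by rw [uIcc_of_le n.cast_nonneg]; exact left_mem_Icc.2 n.cast_nonneg)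
    have h0 : (fun u => ∫ s in (0 : ℝ)..u, g s) =ᶠ[𝓝 t] fun _ => 0 := by
      filter_upwards [lt_mem_nhds htn.1] with u hu using hall u hu
    exact hd.unique ((hasDerivAt_const t 0).congr_of_eventuallyEq h0)
  rw [ae_restrict_iff' measurableSet_Ioi]
  filter_upwards [ae_all_iff.2 key] with t ht ht0
  obtain ⟨n, hn⟩ := exists_nat_gt t
  exact ht n ⟨ht0, hn⟩

theorem locallyIntegrable_indicator_Ioi {F : Type*} [NormedAddCommGroup F] {f : ℝ → F}
    (hf : ∀ T, IntegrableOn f (Ioc 0 T)) :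
    LocallyIntegrable ((Ioi (0 : ℝ)).indicator f) := by
  intro x
  refine ⟨Iic (x + 1), Iic_mem_nhds (by linarith), ?_⟩
  rw [integrableOn_indicator_iff measurableSet_Ioi, inter_comm, Iic_inter_Ioi]
  exact hf _

/-- A distributional differential equation in time with initial datum, in integrated form. -/
theorem ae_eq_add_integral_of_weak {A B : ℝ → ℝ} {A₀ : ℝ} (hA : ∀ T, IntegrableOn A (Ioc 0 T))
    (hB : ∀ T, IntegrableOn B (Ioc 0 T))
    (h : ∀ θ : ℝ → ℝ, ContDiff ℝ ∞ θ → HasCompactSupport θ →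
      ∫ t in Ioi (0 : ℝ), (deriv θ t * A t + θ t * B t) = -(θ 0 * A₀)) :
    ∀ᵐ t ∂(volume : Measure ℝ).restrict (Ioi 0), A t = A₀ + ∫ s in (0 : ℝ)..t, B s := by
  set D : ℝ → ℝ := fun t => A t - A₀ - ∫ s in (0 : ℝ)..t, B s with hD
  have hDi : ∀ T, IntegrableOn D (Ioc 0 T) := fun T =>
    ((hA T).sub (integrableOn_const (by simp))).sub (integrableOn_primitive hB T)
  have h0 := ae_eq_zero_of_integral_contDiff_smul_eq_zero (μ := volume)
    (locallyIntegrable_indicator_Ioi hDi) (fun g hg hgs => by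
      obtain ⟨R, hR⟩ := hgs.isCompact.isBounded.subset_closedBall 0
      set T : ℝ := max R 0 + 1 with hT
      have hT0 : 0 < T := by positivity
      have hgT : ∀ t, T ≤ t → g t = 0 := by
        intro t ht
        by_contra hne
        have := hR (subset_tsupport _ hne)
        rw [mem_closedBall_zero_iff, Real.norm_eq_abs] at this
        have h1 := le_max_left R 0
        have h2 := le_abs_self t
        linarith
      -- The test function should have derivative `g` for `t ≥ 0`. This primitive vanishes after
      -- `T`, and the factor `χ`, equal to `1` for `t ≥ 0` and to `0` for `t ≤ -1`, makes the
      -- support compact without altering `θ` on the half-line.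
      set Γ : ℝ → ℝ := fun t => ∫ s in T..t, g s with hΓ
      have hΓd : ∀ t, HasDerivAt Γ (g t) t := fun t =>
        (hg.continuous.integral_hasStrictDerivAt T t).hasDerivAt
      have hΓs : ContDiff ℝ ∞ Γ := by
        rw [contDiff_infty_iff_deriv]
        refine ⟨fun t => (hΓd t).differentiableAt, ?_⟩
        have : deriv Γ = g := funext fun t => (hΓd t).deriv
        rwa [this]
      have hΓT : ∀ t, T ≤ t → Γ t = 0 := by
        intro t ht
        simp only [Γ]
        rw [intervalIntegral.integral_of_le ht]
        refine setIntegral_eq_zero_of_forall_eq_zero fun s hs => hgT s hs.1.le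
      set χ : ℝ → ℝ := fun t => Real.smoothTransition (t + 1) with hχ
      have hχs : ContDiff ℝ ∞ χ :=
        (Real.smoothTransition.contDiff (n := ⊤)).comp (contDiff_id.add contDiff_const)
      have hχ1 : ∀ t, 0 ≤ t → χ t = 1 := fun t ht =>
        Real.smoothTransition.one_of_one_le (by linarith)
      have hsupp : HasCompactSupport fun t => χ t * Γ t := by
        refine HasCompactSupport.of_support_subset_isCompact (isCompact_Icc (a := -1) (b := T)) ?_
        intro t ht
        by_contra hn
        apply ht
        rw [mem_Icc, not_and_or, not_le, not_le] at hn
        rcases hn with hn | hn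
        · have : χ t = 0 := Real.smoothTransition.zero_of_nonpos (by linarith)
          simp [this]
        · simp [hΓT t hn.le]
      have hw := h _ (hχs.mul hΓs) hsupp
      have e1 : ∫ t in Ioi (0 : ℝ), (deriv (fun t => χ t * Γ t) t * A t + χ t * Γ t * B t) =
          ∫ t in (0 : ℝ)..T, (g t * A t + Γ t * B t) := by
        rw [intervalIntegral.integral_of_le hT0.le]
        have e : ∀ t ∈ Ioi (0 : ℝ), deriv (fun t => χ t * Γ t) t * A t + χ t * Γ t * B t =
            g t * A t + Γ t * B t := by
          intro t ht
          have : (fun t => χ t * Γ t) =ᶠ[𝓝 t] Γ := by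
            filter_upwards [lt_mem_nhds ht] with s hs
            rw [hχ1 s (le_of_lt hs), one_mul]
          rw [this.deriv_eq, (hΓd t).deriv, hχ1 t (le_of_lt ht), one_mul]
        rw [setIntegral_congr_fun measurableSet_Ioi e]
        refine (setIntegral_eq_of_subset_of_forall_sdiff_eq_zero measurableSet_Ioi
          Ioc_subset_Ioi_self fun t ht => ?_)
        have : T ≤ t := by
          by_contra hc
          exact ht.2 ⟨ht.1, (not_le.1 hc).le⟩
        rw [hgT t this, hΓT t this]; ring
      rw [e1, hχ1 0 le_rfl, one_mul] at hw
      have hI : ∀ {φ ψ : ℝ → ℝ}, Continuous φ → (∀ T, IntegrableOn ψ (Ioc 0 T)) →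
          IntervalIntegrable (fun t => φ t * ψ t) volume 0 T := fun hφ hψ =>
        (intervalIntegrable_of_integrableOn_Ioc hψ le_rfl hT0.le).continuousOn_mul hφ.continuousOn
      have hgc := hg.continuous
      have hΓc := hΓs.continuous
      rw [intervalIntegral.integral_add (hI hgc hA) (hI hΓc hB)] at hw
      have e2 : ∫ t in (0 : ℝ)..T, Γ t * B t =
          -∫ t in (0 : ℝ)..T, g t * ∫ s in (0 : ℝ)..t, B s := by
        have := integral_smul_primitive hgc hB hT0.le
        simp only [smul_eq_mul] at this
        rw [this, ← intervalIntegral.integral_neg]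
        refine intervalIntegral.integral_congr fun s _ => ?_
        simp only [Γ]
        rw [intervalIntegral.integral_symm]; ring
      have e3 : Γ 0 = -∫ t in (0 : ℝ)..T, g t := by
        simp only [Γ]; rw [intervalIntegral.integral_symm]
      calc ∫ t, g t • (Ioi (0 : ℝ)).indicator D t
          = ∫ t in Ioi (0 : ℝ), g t * D t := by
            rw [← integral_indicator measurableSet_Ioi]
            refine integral_congr_ae (.of_forall fun t => ?_)
            by_cases ht : t ∈ Ioi (0 : ℝ)
            · simp only [indicator_of_mem ht, smul_eq_mul]
            · simp only [indicator_of_notMem ht, smul_zero]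
        _ = ∫ t in (0 : ℝ)..T, g t * D t := by
            rw [intervalIntegral.integral_of_le hT0.le]
            refine (setIntegral_eq_of_subset_of_forall_sdiff_eq_zero measurableSet_Ioi
              Ioc_subset_Ioi_self fun t ht => ?_)
            have : T ≤ t := by
              by_contra hc
              exact ht.2 ⟨ht.1, (not_le.1 hc).le⟩
            rw [hgT t this, zero_mul]
        _ = ∫ t in (0 : ℝ)..T, (g t * A t - g t * A₀ - g t * ∫ s in (0 : ℝ)..t, B s) := by
            refine intervalIntegral.integral_congr fun s _ => ?_
            simp only [D]; ring
        _ = 0 := by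
            rw [intervalIntegral.integral_sub, intervalIntegral.integral_sub,
              intervalIntegral.integral_mul_const]
            · rw [e2, e3] at hw
              linarith
            · exact hI hgc hA
            · exact hI hgc fun T => integrableOn_const (by simp)
            · exact (hI hgc hA).sub (hI hgc fun T => integrableOn_const (by simp))
            · exact hI hgc (integrableOn_primitive hB))
  rw [ae_restrict_iff' measurableSet_Ioi]
  filter_upwards [h0] with t ht ht0
  rw [indicator_of_mem ht0] at ht
  simp only [D] at ht
  linarith

/-- Duhamel's formula, as an inequality, for a scalar linear equation with integrable forcing. -/
theorem norm_le_of_integral_equation {y b : ℝ → ℂ} {y₀ : ℂ} {k : ℝ}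
    (hy : ∀ T, IntegrableOn y (Ioc 0 T)) (hb : ∀ T, IntegrableOn b (Ioc 0 T))
    (h : ∀ᵐ t ∂(volume : Measure ℝ).restrict (Ioi 0),
      y t = y₀ + ∫ s in (0 : ℝ)..t, (b s - k * y s)) :
    ∀ᵐ t ∂(volume : Measure ℝ).restrict (Ioi 0),
      ‖y t‖ₑ ≤ ENNReal.ofReal (Real.exp (-k * t)) * ‖y₀‖ₑ +
        ∫⁻ s in Ioo 0 t, ENNReal.ofReal (Real.exp (-k * (t - s))) * ‖b s‖ₑ := by
  have hc : ∀ T, IntegrableOn (fun s => b s - k * y s) (Ioc 0 T) := fun T =>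
    (hb T).sub ((hy T).const_mul _)
  filter_upwards [h, self_mem_ae_restrict measurableSet_Ioi] with p hp hp0
  have hp0 : 0 < p := hp0
  -- Integrating factor: the integral equation is integrated against `a` up to the fixed time `p`
  -- and the order of integration is exchanged. The terms containing `∫ a y` on the two sides cancel
  -- and leave Duhamel's formula at `p`.
  set a : ℝ → ℝ := fun t => k * Real.exp (k * t) with ha
  have hac : Continuous a := by fun_prop
  have hai : ∀ s t : ℝ, ∫ r in s..t, a r = Real.exp (k * t) - Real.exp (k * s) := by
    intro s t
    refine intervalIntegral.integral_eq_sub_of_hasDerivAt (f := fun r => Real.exp (k * r))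
      (fun r _ => ?_) (hac.intervalIntegrable _ _)
    have := ((hasDerivAt_id r).const_mul k).exp
    simpa [a, mul_comm] using this
  have hI : ∀ {φ : ℝ → ℝ} {ψ : ℝ → ℂ}, Continuous φ → (∀ T, IntegrableOn ψ (Ioc 0 T)) →
      IntervalIntegrable (fun t => φ t • ψ t) volume 0 p := fun hφ hψ =>
    (intervalIntegrable_of_integrableOn_Ioc hψ le_rfl hp0.le).continuousOn_smul hφ.continuousOn
  have hconst : ∀ T, IntegrableOn (fun _ : ℝ => y₀) (Ioc 0 T) := fun T =>
    integrableOn_const (by simp)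
  have hexp : Continuous fun s => Real.exp (k * s) := by fun_prop
  have key := integral_smul_primitive hac hc hp0.le
  have e1 : ∫ t in (0 : ℝ)..p, a t • ∫ s in (0 : ℝ)..t, (b s - k * y s) =
      (∫ t in (0 : ℝ)..p, a t • y t) - (Real.exp (k * p) - 1 : ℝ) • y₀ := by
    have : ∫ t in (0 : ℝ)..p, a t • ∫ s in (0 : ℝ)..t, (b s - k * y s) =
        ∫ t in (0 : ℝ)..p, (a t • y t - a t • y₀) := by
      rw [intervalIntegral.integral_of_le hp0.le, intervalIntegral.integral_of_le hp0.le]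
      refine integral_congr_ae ?_
      filter_upwards [ae_restrict_of_ae_restrict_of_subset Ioc_subset_Ioi_self h] with t ht
      rw [ht, ← smul_sub]; congr 1; ring
    rw [this, intervalIntegral.integral_sub (hI hac hy) (hI hac hconst),
      intervalIntegral.integral_smul_const, hai]
    simp
  have e2 : ∫ s in (0 : ℝ)..p, (∫ t in s..p, a t) • (b s - k * y s) =
      Real.exp (k * p) • (y p - y₀) - (∫ s in (0 : ℝ)..p, Real.exp (k * s) • b s) +
        ∫ s in (0 : ℝ)..p, a s • y s := by
    have : ∀ s, (∫ t in s..p, a t) • (b s - k * y s) =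
        Real.exp (k * p) • (b s - k * y s) - Real.exp (k * s) • b s + a s • y s := by
      intro s
      rw [hai]
      simp only [a, Complex.real_smul]
      push_cast
      ring
    simp only [this]
    rw [intervalIntegral.integral_add, intervalIntegral.integral_sub,
      intervalIntegral.integral_smul]
    · congr 3
      rw [hp]; ring
    · exact hI continuous_const hc
    · exact hI hexp hb
    · exact (hI continuous_const hc).sub (hI hexp hb)
    · exact hI hac hy
  rw [e1, e2] at key
  have e3 : y p = Real.exp (-k * p) • (y₀ + ∫ s in (0 : ℝ)..p, Real.exp (k * s) • b s) := by
    have h1 : Real.exp (k * p) • y p = y₀ + ∫ s in (0 : ℝ)..p, Real.exp (k * s) • b s := by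
      simp only [Complex.real_smul] at key ⊢
      push_cast at key ⊢
      linear_combination -key
    rw [← h1, smul_smul, ← Real.exp_add]
    simp
  have e4 : y p = Real.exp (-k * p) • y₀ +
      ∫ s in (0 : ℝ)..p, Real.exp (-k * (p - s)) • b s := by
    rw [e3, smul_add, ← intervalIntegral.integral_smul]
    congr 1
    refine intervalIntegral.integral_congr fun s _ => ?_
    rw [smul_smul, ← Real.exp_add]
    congr 2; ring
  have hn : ∀ (r : ℝ) (z : ℂ), ‖Real.exp r • z‖ₑ = ENNReal.ofReal (Real.exp r) * ‖z‖ₑ := by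
    intro r z
    rw [enorm_smul, Real.enorm_eq_ofReal (Real.exp_pos r).le]
  rw [e4]
  refine (enorm_add_le _ _).trans (add_le_add (hn _ _).le ?_)
  rw [intervalIntegral.integral_of_le hp0.le, integral_Ioc_eq_integral_Ioo]
  refine (enorm_integral_le_lintegral_enorm _).trans (le_of_eq ?_)
  simp only [hn]

end Time

end NavierStokes2D

/-! ### Distributions with tempered Fourier transform, and constraints at a fixed time. -/

namespace NavierStokes2D

open SchwartzMap FourierTransform Filter Topology LineDeriv

/-- The standard basis vectors of the plane. -/
noncomputable abbrev basisVec (i : Fin 2) : Plane := EuclideanSpace.single i 1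

section Represents

/-- The functional `ψ ↦ ∫ T ψ` on Schwartz functions is the distribution whose Fourier transform
is the tempered function `F`. -/
structure Represents (T : 𝓢(Plane, ℂ) → Plane → ℂ) (F : Plane → ℂ) : Prop where
  tempered : TemperedIntegrable F
  integrable : ∀ ψ, Integrable (T ψ)
  pairing : ∀ ψ, ∫ x, T ψ x = ∫ ξ, F ξ * (𝓕⁻ ψ) ξ

variable {T T₁ T₂ : 𝓢(Plane, ℂ) → Plane → ℂ} {F F₁ F₂ : Plane → ℂ}

theorem Represents.add (h₁ : Represents T₁ F₁) (h₂ : Represents T₂ F₂) :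
    Represents (fun ψ x => T₁ ψ x + T₂ ψ x) (fun ξ => F₁ ξ + F₂ ξ) where
  tempered := h₁.tempered.add h₂.tempered
  integrable ψ := (h₁.integrable ψ).add (h₂.integrable ψ)
  pairing ψ := by
    simp only [add_mul]
    rw [integral_add (h₁.integrable ψ) (h₂.integrable ψ),
      integral_add (h₁.tempered.integrable_mul _) (h₂.tempered.integrable_mul _),
      h₁.pairing, h₂.pairing]

theorem Represents.const_mul (h : Represents T F) (c : ℂ) :
    Represents (fun ψ x => c * T ψ x) (fun ξ => c * F ξ) where
  tempered := h.tempered.const_mul c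
  integrable ψ := (h.integrable ψ).const_mul c
  pairing ψ := by
    simp only [mul_assoc]
    rw [integral_const_mul, integral_const_mul, h.pairing]

theorem Represents.sub (h₁ : Represents T₁ F₁) (h₂ : Represents T₂ F₂) :
    Represents (fun ψ x => T₁ ψ x - T₂ ψ x) (fun ξ => F₁ ξ - F₂ ξ) := by
  simpa only [sub_eq_add_neg, neg_one_mul] using h₁.add (h₂.const_mul (-1))

theorem fourierInv_lineDerivOp_apply (ψ : 𝓢(Plane, ℂ)) (m ξ : Plane) :
    (𝓕⁻ (∂_{m} ψ)) ξ = -(2 * Real.pi * Complex.I) * ⟪ξ, m⟫_ℝ * (𝓕⁻ ψ) ξ := by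
  have ht : (fun η : Plane => ⟪η, m⟫_ℝ).HasTemperateGrowth := by fun_prop
  rw [SchwartzMap.fourierInv_lineDerivOp_eq]
  simp only [smul_apply, smulLeftCLM_apply_apply ht, smul_eq_mul, Complex.real_smul]
  ring

theorem Represents.lineDeriv (h : Represents T F) (m : Plane) :
    Represents (fun ψ => T (∂_{m} ψ))
      (fun ξ => -(2 * Real.pi * Complex.I) * ⟪ξ, m⟫_ℝ * F ξ) where
  tempered := by
    refine h.tempered.mul_left (Continuous.aestronglyMeasurable (by fun_prop))
      (C := 2 * Real.pi * ‖m‖) (j := 1) fun ξ => ?_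
    rw [norm_mul, norm_neg, Complex.norm_real, norm_mul, norm_mul, Complex.norm_I,
      Complex.norm_real, mul_one, Complex.norm_two, Real.norm_of_nonneg Real.pi_pos.le, pow_one,
      mul_assoc (2 * Real.pi)]
    gcongr
    refine (norm_inner_le_norm ξ m).trans ?_
    rw [mul_comm]
    gcongr
    linarith
  integrable ψ := h.integrable _
  pairing ψ := by
    rw [h.pairing]
    refine integral_congr_ae (.of_forall fun ξ => ?_)
    simp only [fourierInv_lineDerivOp_apply]
    ring

theorem IsFourier.represents {v V : Plane → ℂ} (h : IsFourier v V) :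
    Represents (fun ψ x => v x * ψ x) V where
  tempered := h.memLp_right.temperedIntegrable
  integrable ψ := h.memLp_left.integrable_mul (ψ.memLp 2)
  pairing := h.pairing

theorem temperedIntegrable_of_bounded {H : Plane → ℂ} (hm : AEStronglyMeasurable H volume) {C : ℝ}
    (hb : ∀ ξ, ‖H ξ‖ ≤ C) : TemperedIntegrable H := by
  have h1 : TemperedIntegrable fun _ => 1 := by
    refine ⟨3, ?_⟩
    have := integrable_one_add_norm (E := Plane) (μ := volume) (r := 3) (by simp; norm_num)
    refine this.ofReal (𝕜 := ℂ) |>.congr (.of_forall fun ξ => ?_)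
    simp only [Complex.real_smul, mul_one]
    rw [Real.rpow_neg (by positivity)]
    norm_cast
  simpa using h1.mul_left hm (C := C) (j := 0) (by simpa using hb)

theorem norm_fourier_le (q : Plane → ℂ) (ξ : Plane) : ‖𝓕 q ξ‖ ≤ ∫ x, ‖q x‖ := by
  rw [fourier_eq_integral_phase]
  refine (norm_integral_le_integral_norm _).trans (le_of_eq ?_)
  simp only [norm_mul, norm_phase, one_mul]

theorem _root_.MeasureTheory.Integrable.represents_fourier {q : Plane → ℂ} (hq : Integrable q) :
    Represents (fun ψ x => q x * ψ x) (𝓕 q) where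
  tempered := by
    refine temperedIntegrable_of_bounded (Continuous.aestronglyMeasurable ?_) (norm_fourier_le q)
    exact VectorFourier.fourierIntegral_continuous Real.continuous_fourierChar
      (L := innerₗ Plane) continuous_inner hq
  integrable ψ := by
    obtain ⟨C, hC⟩ : ∃ C, ∀ x, ‖ψ x‖ ≤ C := ⟨_, fun x => ψ.norm_le_seminorm ℂ x⟩
    exact hq.mul_bdd (c := C) ψ.continuous.aestronglyMeasurable (.of_forall hC)
  pairing := integral_mul_eq_integral_fourier_mul hq

/-- A representable functional is homogeneous. -/
theorem Represents.integral_smul (h : Represents T F) (c : ℂ) (ψ : 𝓢(Plane, ℂ)) :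
    ∫ x, T (c • ψ) x = c * ∫ x, T ψ x := by
  rw [h.pairing, h.pairing, FourierTransform.fourierInv_smul, ← integral_const_mul]
  refine integral_congr_ae (.of_forall fun ξ => ?_)
  simp only [smul_apply, smul_eq_mul]
  ring

/-- Replacing `ψ` by `iψ` recovers the imaginary part. Real parts are all that real-valued test
functions can detect. -/
theorem Represents.ae_eq_zero_of_re (h : Represents T F)
    (h0 : ∀ ψ : 𝓢(Plane, ℂ), HasCompactSupport ψ → (∫ x, T ψ x).re = 0) :
    ∀ᵐ ξ, F ξ = 0 := by
  refine h.tempered.ae_eq_zero fun ψ hψ => ?_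
  rw [← h.pairing]
  refine Complex.ext (h0 ψ hψ) ?_
  have := h0 (Complex.I • ψ) (hψ.smul_left (f := fun _ => Complex.I))
  rw [h.integral_smul, Complex.I_mul_re, neg_eq_zero] at this
  exact this

end Represents

section FixedTime

theorem lineDerivOp_postcompCLM {E : Type*} [NormedAddCommGroup E] [NormedSpace ℝ E]
    (L : ℂ →L[ℝ] E) (ψ : 𝓢(Plane, ℂ)) (m : Plane) :
    ∂_{m} (ψ.postcompCLM L) = (∂_{m} ψ).postcompCLM L := by
  ext x
  rw [postcompCLM_apply, lineDerivOp_apply_eq_fderiv, lineDerivOp_apply_eq_fderiv]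
  have : HasFDerivAt (ψ.postcompCLM L) (L ∘L fderiv ℝ ψ x) x :=
    L.hasFDerivAt.comp x (ψ.hasFDerivAt x)
  rw [this.fderiv]
  rfl

theorem fderiv_re_apply (ψ : 𝓢(Plane, ℂ)) (x m : Plane) :
    fderiv ℝ (fun y => (ψ y).re) x m = (∂_{m} ψ x).re :=
  congrArg (fun f : 𝓢(Plane, ℝ) => f x) (lineDerivOp_postcompCLM Complex.reCLM ψ m)

theorem re_integral {f : Plane → ℂ} (hf : Integrable f) : (∫ x, f x).re = ∫ x, (f x).re :=
  (Complex.reCLM.integral_comp_comm hf).symm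

theorem eq_basisVec_add (v : Plane) : v = v 0 • basisVec 0 + v 1 • basisVec 1 := by
  ext i
  fin_cases i <;> simp

theorem IsFourier.zero : IsFourier 0 0 where
  memLp_left := MemLp.zero
  memLp_right := MemLp.zero
  pairing ψ := by simp

/-- One statement covers both constraints at a fixed time: `b = 0` gives an entry of the weak
gradient, and `g = 0` gives incompressibility. -/
theorem IsFourier.ae_eq_of_weak_divergence {f₀ f₁ g : Plane → ℝ} {F₀ F₁ G : Plane → ℂ}
    (h₀ : IsFourier (fun x => (f₀ x : ℂ)) F₀) (h₁ : IsFourier (fun x => (f₁ x : ℂ)) F₁)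
    (hg : IsFourier (fun x => (g x : ℂ)) G) (a b : Plane)
    (h : ∀ φ : Plane → ℝ, ContDiff ℝ ∞ φ → HasCompactSupport φ →
      ∫ x, (fderiv ℝ φ x a * f₀ x + fderiv ℝ φ x b * f₁ x) = -∫ x, φ x * g x) :
    ∀ᵐ ξ, G ξ = 2 * Real.pi * Complex.I * (⟪ξ, a⟫_ℝ * F₀ ξ + ⟪ξ, b⟫_ℝ * F₁ ξ) := by
  have hr := ((h₀.represents.lineDeriv a).add (h₁.represents.lineDeriv b)).add hg.represents
  have key := hr.ae_eq_zero_of_re fun ψ hψ => ?_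
  · filter_upwards [key] with ξ hξ
    linear_combination hξ
  have hc : ContDiff ℝ ∞ fun x => (ψ x).re := Complex.reCLM.contDiff.comp (ψ.smooth ⊤)
  have hs : HasCompactSupport fun x => (ψ x).re := hψ.comp_left Complex.zero_re
  have hψ' := h _ hc hs
  have i1 := hr.integrable ψ
  have i2 : Integrable fun x => (f₀ x : ℂ) * (∂_{a} ψ) x + (f₁ x : ℂ) * (∂_{b} ψ) x :=
    ((h₀.represents.lineDeriv a).add (h₁.represents.lineDeriv b)).integrable ψ
  have i3 := hg.represents.integrable ψ
  rw [re_integral i1]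
  simp only [Complex.add_re, Complex.re_ofReal_mul]
  rw [integral_add (i2.re.congr (.of_forall fun x => by simp))
    (i3.re.congr (.of_forall fun x => by simp))]
  simp only [fderiv_re_apply] at hψ'
  simp only [mul_comm (f₀ _), mul_comm (f₁ _), mul_comm (g _)]
  rw [hψ', neg_add_cancel]

/-- Plancherel for a single entry of the gradient, whose transform is `2πi ξ_k V`; the factor `2π ≥
1` is discarded. -/
theorem IsWeakGradient.lintegral_le {v : Plane → Plane} {G : Plane → Plane →L[ℝ] Plane}
    (hG : IsWeakGradient v G) (hv : MemLp v 2) (hG2 : MemLp G 2) {i : Fin 2} {V : Plane → ℂ}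
    (hV : IsFourier (fun x => (v x i : ℂ)) V) (k : Fin 2) :
    ∫⁻ ξ : Plane, (‖ξ k‖ₑ * ‖V ξ‖ₑ) ^ 2 ≤ ∫⁻ x, ‖G x‖ₑ ^ 2 := by
  have hGk : MemLp (fun x => G x (basisVec k)) 2 :=
    (ContinuousLinearMap.apply ℝ Plane (basisVec k)).comp_memLp' hG2
  have hgk : MemLp (fun x => G x (basisVec k) i) 2 :=
    (EuclideanSpace.proj (𝕜 := ℝ) i).comp_memLp' hGk
  obtain ⟨W, hW⟩ : ∃ W, IsFourier (fun x => (G x (basisVec k) i : ℂ)) W :=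
    ⟨_, IsFourier.of_toLp hgk.ofReal⟩
  -- The second function is a dummy, since its direction is the zero vector.
  have key := hV.ae_eq_of_weak_divergence hV hW (basisVec k) 0 fun φ hφ hφs => ?_
  · calc ∫⁻ ξ : Plane, (‖ξ k‖ₑ * ‖V ξ‖ₑ) ^ 2 ≤ ∫⁻ ξ, ‖W ξ‖ₑ ^ 2 := by
          refine lintegral_mono_ae ?_
          filter_upwards [key] with ξ hξ
          gcongr
          have e : ⟪ξ, basisVec k⟫_ℝ = ξ k := by simp [EuclideanSpace.inner_single_right]
          rw [hξ, e, inner_zero_right, Complex.ofReal_zero, zero_mul, add_zero, enorm_mul _ (_ * V ξ),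
            enorm_mul _ (V ξ)]
          have e' : ‖(ξ k : ℂ)‖ₑ = ‖ξ k‖ₑ := by rw [← ofReal_norm, ← ofReal_norm, Complex.norm_real]
          rw [e']
          refine le_mul_of_one_le_left (by positivity) ?_
          rw [← ofReal_norm, ENNReal.one_le_ofReal, norm_mul, norm_mul, Complex.norm_I,
            Complex.norm_two, Complex.norm_real, Real.norm_of_nonneg Real.pi_pos.le]
          linarith [Real.pi_gt_three]
      _ = ∫⁻ x, ‖(G x (basisVec k) i : ℂ)‖ₑ ^ 2 := hW.lintegral_sq_eq
      _ ≤ _ := by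
          refine lintegral_mono fun x => ?_
          gcongr
          rw [← ofReal_norm, ← ofReal_norm, Complex.norm_real]
          refine ENNReal.ofReal_le_ofReal ((PiLp.norm_apply_le _ i).trans ?_)
          refine ((G x).le_opNorm _).trans (le_of_eq ?_)
          simp
  · obtain ⟨-, -, h⟩ := hG
    have h := congrArg (EuclideanSpace.proj (𝕜 := ℝ) i) (h φ hφ hφs (basisVec k))
    have hd : Continuous fun x => fderiv ℝ φ x (basisVec k) :=
      (hφ.continuous_fderiv (by simp)).clm_apply continuous_const
    have m1 : MemLp (fun x => fderiv ℝ φ x (basisVec k)) 2 :=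
      hd.memLp_of_hasCompactSupport (hφs.fderiv_apply ℝ _)
    have m2 : MemLp φ 2 := hφ.continuous.memLp_of_hasCompactSupport hφs
    have i1 : Integrable fun x => fderiv ℝ φ x (basisVec k) • v x :=
      memLp_one_iff_integrable.1 (hv.smul m1)
    have i2 : Integrable fun x => φ x • G x (basisVec k) :=
      memLp_one_iff_integrable.1 (hGk.smul m2)
    rw [map_neg, ← ContinuousLinearMap.integral_comp_comm _ i1,
      ← ContinuousLinearMap.integral_comp_comm _ i2] at h
    simpa using h

theorem IsWeaklyDivergenceFree.ae_eq_zero {v : Plane → Plane} (hd : IsWeaklyDivergenceFree v)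
    {V₀ V₁ : Plane → ℂ} (h₀ : IsFourier (fun x => (v x 0 : ℂ)) V₀)
    (h₁ : IsFourier (fun x => (v x 1 : ℂ)) V₁) :
    ∀ᵐ ξ : Plane, (ξ 0 : ℂ) * V₀ ξ + (ξ 1 : ℂ) * V₁ ξ = 0 := by
  have hz : IsFourier (fun x => ((0 : ℝ) : ℂ)) 0 := by simpa using! IsFourier.zero
  have key := h₀.ae_eq_of_weak_divergence h₁ hz (basisVec 0) (basisVec 1) fun φ hφ hφs => ?_
  · filter_upwards [key] with ξ hξ
    have hp : (2 * Real.pi * Complex.I : ℂ) ≠ 0 := by simp [Real.pi_ne_zero]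
    simpa [EuclideanSpace.inner_single_right, hp] using hξ.symm
  · have h := hd φ hφ hφs
    have e : ∀ x, fderiv ℝ φ x (v x) =
        fderiv ℝ φ x (basisVec 0) * v x 0 + fderiv ℝ φ x (basisVec 1) * v x 1 := by
      intro x
      conv_lhs => rw [eq_basisVec_add (v x)]
      simp only [map_add, map_smul, smul_eq_mul]
      ring
    simp only [e] at h
    simpa using h

/-- The Fourier transform of the scalar vorticity of a field with Fourier transform `(V₀, V₁)`. -/
noncomputable def vorticity (V₀ V₁ : Plane → ℂ) (ξ : Plane) : ℂ :=
  2 * Real.pi * Complex.I * ((ξ 1 : ℂ) * V₀ ξ - (ξ 0 : ℂ) * V₁ ξ)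

/-- For real `ξ`, Lagrange's identity reads `|ξ₁z - ξ₀w|² + |ξ₀z + ξ₁w|² = |ξ|²(|z|² + |w|²)`, and
incompressibility removes the second square. Passing from the Euclidean norm to the sum of moduli
costs at most `2`, which the factor `2π` of the vorticity absorbs. This is the Biot–Savart law as an
inequality. -/
theorem norm_mul_le_norm_vorticity {V₀ V₁ : Plane → ℂ} {ξ : Plane}
    (h : (ξ 0 : ℂ) * V₀ ξ + (ξ 1 : ℂ) * V₁ ξ = 0) :
    ‖ξ‖ * (‖V₀ ξ‖ + ‖V₁ ξ‖) ≤ ‖vorticity V₀ V₁ ξ‖ := by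
  set z := V₀ ξ
  set w := V₁ ξ
  have hr := congrArg Complex.re h
  have hi := congrArg Complex.im h
  simp only [Complex.add_re, Complex.add_im, Complex.re_ofReal_mul, Complex.im_ofReal_mul,
    Complex.zero_re, Complex.zero_im] at hr hi
  have hS : ‖(ξ 1 : ℂ) * z - (ξ 0 : ℂ) * w‖ ^ 2 = ‖ξ‖ ^ 2 * (‖z‖ ^ 2 + ‖w‖ ^ 2) := by
    rw [Complex.sq_norm, Complex.sq_norm, Complex.sq_norm, EuclideanSpace.norm_sq_eq,
      Fin.sum_univ_two]
    simp only [Complex.normSq_apply, Complex.sub_re, Complex.sub_im, Complex.re_ofReal_mul,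
      Complex.im_ofReal_mul, Real.norm_eq_abs, sq_abs]
    linear_combination -(ξ 0 * z.re + ξ 1 * w.re) * hr - (ξ 0 * z.im + ξ 1 * w.im) * hi
  have h2 : ‖ξ‖ * (‖z‖ + ‖w‖) ≤ 2 * ‖(ξ 1 : ℂ) * z - (ξ 0 : ℂ) * w‖ := by
    refine abs_le_of_sq_le_sq' ?_ (by positivity) |>.2
    rw [mul_pow, mul_pow, hS]
    have : 0 ≤ ‖ξ‖ ^ 2 := by positivity
    nlinarith [mul_nonneg this (sq_nonneg (‖z‖ - ‖w‖)), mul_nonneg this (sq_nonneg (‖z‖ + ‖w‖))]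
  refine h2.trans ?_
  unfold vorticity
  rw [norm_mul, norm_mul, norm_mul, Complex.norm_I, Complex.norm_two, Complex.norm_real,
    Real.norm_of_nonneg Real.pi_pos.le, mul_one]
  have := Real.pi_gt_three
  gcongr
  linarith

theorem norm_vorticity_le (V₀ V₁ : Plane → ℂ) (ξ : Plane) :
    ‖vorticity V₀ V₁ ξ‖ ≤ 2 * Real.pi * (‖ξ‖ * (‖V₀ ξ‖ + ‖V₁ ξ‖)) := by
  have e0 := PiLp.norm_apply_le ξ 0
  have e1 := PiLp.norm_apply_le ξ 1
  unfold vorticity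
  rw [norm_mul, norm_mul, norm_mul, Complex.norm_I, Complex.norm_two, Complex.norm_real,
    Real.norm_of_nonneg Real.pi_pos.le, mul_one]
  gcongr
  refine (norm_sub_le _ _).trans ?_
  rw [norm_mul, norm_mul, Complex.norm_real, Complex.norm_real, mul_add]
  gcongr

end FixedTime

end NavierStokes2D

/-! ### The weak formulation tested against perpendicular gradients. -/

namespace NavierStokes2D

open SchwartzMap FourierTransform Filter Topology LineDeriv

section PerpGrad

/-- The perpendicular gradient `(-∂₁, ∂₀)` of the real part of a Schwartz function. -/
noncomputable def perpGrad (ψ : 𝓢(Plane, ℂ)) : 𝓢(Plane, Plane) :=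
  (∂_{basisVec 0} ψ).postcompCLM (Complex.reCLM.smulRight (basisVec 1)) -
    (∂_{basisVec 1} ψ).postcompCLM (Complex.reCLM.smulRight (basisVec 0))

theorem perpGrad_apply (ψ : 𝓢(Plane, ℂ)) (x : Plane) :
    perpGrad ψ x = (∂_{basisVec 0} ψ x).re • basisVec 1 - (∂_{basisVec 1} ψ x).re • basisVec 0 :=
  rfl

theorem lineDerivOp_perpGrad_apply (ψ : 𝓢(Plane, ℂ)) (m x : Plane) :
    (∂_{m} (perpGrad ψ)) x = (∂_{m} (∂_{basisVec 0} ψ) x).re • basisVec 1 -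
      (∂_{m} (∂_{basisVec 1} ψ) x).re • basisVec 0 := by
  unfold perpGrad
  rw [sub_eq_add_neg, lineDerivOp_add, lineDerivOp_neg, lineDerivOp_postcompCLM,
    lineDerivOp_postcompCLM, ← sub_eq_add_neg]
  rfl

theorem lineDerivOp_lineDerivOp_perpGrad_apply (ψ : 𝓢(Plane, ℂ)) (m x : Plane) :
    (∂_{m} (∂_{m} (perpGrad ψ))) x = (∂_{m} (∂_{m} (∂_{basisVec 0} ψ)) x).re • basisVec 1 -
      (∂_{m} (∂_{m} (∂_{basisVec 1} ψ)) x).re • basisVec 0 := by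
  unfold perpGrad
  rw [sub_eq_add_neg, lineDerivOp_add, lineDerivOp_neg, lineDerivOp_postcompCLM,
    lineDerivOp_postcompCLM, lineDerivOp_add, lineDerivOp_neg, lineDerivOp_postcompCLM,
    lineDerivOp_postcompCLM, ← sub_eq_add_neg]
  rfl

theorem inner_smul_basisVec_sub (a : Plane) (r s : ℝ) :
    ⟪a, r • basisVec 1 - s • basisVec 0⟫_ℝ = a 1 * r - a 0 * s := by
  rw [inner_sub_right, inner_smul_right, inner_smul_right]
  simp [EuclideanSpace.inner_single_right]
  ring

theorem lineDerivOp_comm (ψ : 𝓢(Plane, ℂ)) (m n x : Plane) :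
    ∂_{m} (∂_{n} ψ) x = ∂_{n} (∂_{m} ψ) x := by
  have h : ∀ a b : Plane, ∂_{a} (∂_{b} ψ) x = fderiv ℝ (fderiv ℝ ψ) x a b := by
    intro a b
    change fderiv ℝ (fun y => fderiv ℝ ψ y b) x a = _
    have hd : DifferentiableAt ℝ (fderiv ℝ ψ) x :=
      ((ψ.smooth ⊤).fderiv_right (m := ((⊤ : ℕ∞) : ℕ∞ω)) le_rfl).differentiable
        (by simp) x
    rw [fderiv_clm_apply hd (differentiableAt_const b)]
    simp
  rw [h, h]
  exact second_derivative_symmetric (fun y => ψ.hasFDerivAt y)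
    (((ψ.smooth ⊤).fderiv_right (m := ((⊤ : ℕ∞) : ℕ∞ω)) le_rfl).differentiable
        (by simp) x).hasFDerivAt m n

theorem hasCompactSupport_perpGrad {ψ : 𝓢(Plane, ℂ)} (hψ : HasCompactSupport ψ) :
    HasCompactSupport (perpGrad ψ) := by
  have h : ∀ m : Plane, HasCompactSupport (∂_{m} ψ : 𝓢(Plane, ℂ)) := fun m =>
    hψ.mono' ((subset_tsupport _).trans (tsupport_lineDerivOp_subset m ψ))
  have h' : ∀ (L : ℂ →L[ℝ] Plane) (m : Plane),
      HasCompactSupport fun x => L (∂_{m} ψ x) := fun L m => (h m).comp_left (map_zero L)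
  exact (h' _ _).sub (h' _ _)

theorem laplacian_perpGrad_apply (ψ : 𝓢(Plane, ℂ)) (x : Plane) :
    (Δ (perpGrad ψ : Plane → Plane)) x = ∂_{basisVec 0} (∂_{basisVec 0} (perpGrad ψ)) x +
      ∂_{basisVec 1} (∂_{basisVec 1} (perpGrad ψ)) x := by
  rw [← laplacian_apply, laplacian_eq_sum (EuclideanSpace.basisFun (Fin 2) ℝ)]
  simp

/-- The only test fields used: they turn the system into the scalar vorticity equation, free of
pressure. -/
theorem isSolenoidalTest_smul_perpGrad {θ : ℝ → ℝ} (hθ : ContDiff ℝ ∞ θ)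
    (hθs : HasCompactSupport θ) {ψ : 𝓢(Plane, ℂ)} (hψ : HasCompactSupport ψ) :
    IsSolenoidalTest fun t x => θ t • perpGrad ψ x where
  smooth := (hθ.comp contDiff_fst).smul (((perpGrad ψ).smooth ⊤).comp contDiff_snd)
  compactSupport := by
    refine HasCompactSupport.of_support_subset_isCompact
      (hθs.isCompact.prod (hasCompactSupport_perpGrad hψ).isCompact) fun z hz => ?_
    rw [Function.mem_support, smul_ne_zero_iff] at hz
    exact ⟨subset_tsupport _ hz.1, subset_tsupport _ hz.2⟩
  divFree t x := by
    unfold divergence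
    have e : ∀ m : Plane, fderiv ℝ (fun y => θ t • perpGrad ψ y) x m =
        θ t • ∂_{m} (perpGrad ψ) x := by
      intro m
      rw [fderiv_fun_const_smul (perpGrad ψ).differentiableAt]
      rfl
    rw [Fin.sum_univ_two, e, e, lineDerivOp_perpGrad_apply, lineDerivOp_perpGrad_apply,
      lineDerivOp_comm ψ (basisVec 0) (basisVec 1)]
    simp

end PerpGrad

section WeakForm

/-- The density paired with `∂ₜθ` in the weak formulation tested against `θ ∇^⊥ψ`. -/
noncomputable def vorticityPairing (v : Plane → Plane) (ψ : 𝓢(Plane, ℂ)) (x : Plane) : ℂ :=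
  (v x 1 : ℂ) * ∂_{basisVec 0} ψ x - (v x 0 : ℂ) * ∂_{basisVec 1} ψ x

/-- The density of the nonlinear term paired with `θ` in the weak formulation tested against
`θ ∇^⊥ψ`. -/
noncomputable def stressPairing (v : Plane → Plane) (ψ : 𝓢(Plane, ℂ)) (x : Plane) : ℂ :=
  ((v x 0 * v x 1 : ℂ) * ∂_{basisVec 0} (∂_{basisVec 0} ψ) x -
    (v x 0 * v x 0 : ℂ) * ∂_{basisVec 0} (∂_{basisVec 1} ψ) x) +
  ((v x 1 * v x 1 : ℂ) * ∂_{basisVec 1} (∂_{basisVec 0} ψ) x -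
    (v x 0 * v x 1 : ℂ) * ∂_{basisVec 1} (∂_{basisVec 1} ψ) x)

/-- The density of the viscous term paired with `θ` in the weak formulation tested against
`θ ∇^⊥ψ`. -/
noncomputable def viscousPairing (v : Plane → Plane) (ψ : 𝓢(Plane, ℂ)) (x : Plane) : ℂ :=
  ((v x 1 : ℂ) * ∂_{basisVec 0} (∂_{basisVec 0} (∂_{basisVec 0} ψ)) x -
    (v x 0 : ℂ) * ∂_{basisVec 0} (∂_{basisVec 0} (∂_{basisVec 1} ψ)) x) +
  ((v x 1 : ℂ) * ∂_{basisVec 1} (∂_{basisVec 1} (∂_{basisVec 0} ψ)) x -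
    (v x 0 : ℂ) * ∂_{basisVec 1} (∂_{basisVec 1} (∂_{basisVec 1} ψ)) x)

/-- `perpGrad` takes real parts and so is not complex linear in `ψ`. Writing the integrand as the
real part of complex linear expressions makes `Represents` applicable. -/
theorem weakForm_integrand_eq (μ : ℝ) (v : Plane → Plane) {θ : ℝ → ℝ} (hθ : ContDiff ℝ ∞ θ)
    (ψ : 𝓢(Plane, ℂ)) (t : ℝ) (x : Plane) :
    ⟪v x, deriv (fun s => θ s • perpGrad ψ x) t⟫_ℝ +
      ⟪v x, fderiv ℝ (fun y => θ t • perpGrad ψ y) x (v x)⟫_ℝ +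
      μ * ⟪v x, (Δ fun y => θ t • perpGrad ψ y) x⟫_ℝ =
    (deriv θ t * vorticityPairing v ψ x +
      θ t * (stressPairing v ψ x + μ * viscousPairing v ψ x)).re := by
  have e1 : deriv (fun s => θ s • perpGrad ψ x) t = deriv θ t • perpGrad ψ x :=
    deriv_smul_const (hθ.differentiable (by simp) t) _
  have e2 : fderiv ℝ (fun y => θ t • perpGrad ψ y) x (v x) =
      θ t • (v x 0 • ∂_{basisVec 0} (perpGrad ψ) x + v x 1 • ∂_{basisVec 1} (perpGrad ψ) x) := by
    rw [fderiv_fun_const_smul (perpGrad ψ).differentiableAt]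
    conv_lhs => rw [eq_basisVec_add (v x)]
    rw [map_add, map_smul, map_smul, smul_apply,
      smul_apply, smul_add, smul_comm, smul_comm (v x 1)]
    rfl
  have e3 : (Δ fun y => θ t • perpGrad ψ y) x = θ t • (Δ (perpGrad ψ : Plane → Plane)) x :=
    InnerProductSpace.laplacian_smul (θ t) (((perpGrad ψ).smooth 2).contDiffAt)
  rw [e1, e2, e3, laplacian_perpGrad_apply, lineDerivOp_lineDerivOp_perpGrad_apply,
    lineDerivOp_lineDerivOp_perpGrad_apply, lineDerivOp_perpGrad_apply,
    lineDerivOp_perpGrad_apply, perpGrad_apply]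
  simp only [inner_smul_right, inner_add_right, inner_smul_basisVec_sub, vorticityPairing,
    stressPairing, viscousPairing, Complex.add_re, Complex.sub_re, Complex.re_ofReal_mul,
    ← Complex.ofReal_mul]
  ring

/-- The Fourier transform of the curl of the divergence of a symmetric tensor. -/
noncomputable def stress (Q₀₀ Q₀₁ Q₁₁ : Plane → ℂ) (ξ : Plane) : ℂ :=
  4 * Real.pi ^ 2 * ((Q₀₀ ξ - Q₁₁ ξ) * (ξ 0 * ξ 1) + Q₀₁ ξ * (ξ 1 ^ 2 - ξ 0 ^ 2))

/-- The Fourier transform of the product of two components of a field. -/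
noncomputable def fourierProd (v : Plane → Plane) (i j : Fin 2) : Plane → ℂ :=
  𝓕 fun x => (v x i * v x j : ℂ)

/-- The Fourier transform of the right-hand side of the vorticity equation. -/
noncomputable def vorticityRhs (μ : ℝ) (v : Plane → Plane) (V₀ V₁ : Plane → ℂ) (ξ : Plane) : ℂ :=
  stress (fourierProd v 0 0) (fourierProd v 0 1) (fourierProd v 1 1) ξ -
    ((4 * Real.pi ^ 2 * μ * ‖ξ‖ ^ 2 : ℝ) : ℂ) * vorticity V₀ V₁ ξ

variable {v : Plane → Plane} {V₀ V₁ : Plane → ℂ}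

theorem represents_vorticityPairing (h₀ : IsFourier (fun x => (v x 0 : ℂ)) V₀)
    (h₁ : IsFourier (fun x => (v x 1 : ℂ)) V₁) :
    Represents (vorticityPairing v) (vorticity V₀ V₁) := by
  have h := (h₁.represents.lineDeriv (basisVec 0)).sub (h₀.represents.lineDeriv (basisVec 1))
  refine (congrArg₂ Represents rfl ?_).mp h
  ext ξ
  simp only [vorticity, EuclideanSpace.inner_single_right]
  simp
  ring

theorem represents_flux (μ : ℝ) (h₀ : IsFourier (fun x => (v x 0 : ℂ)) V₀)
    (h₁ : IsFourier (fun x => (v x 1 : ℂ)) V₁) :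
    Represents (fun ψ x => stressPairing v ψ x + μ * viscousPairing v ψ x)
      (vorticityRhs μ v V₀ V₁) := by
  have r₀ := h₀.represents
  have r₁ := h₁.represents
  have i00 : Integrable fun x => (v x 0 * v x 0 : ℂ) :=
    h₀.memLp_left.integrable_mul h₀.memLp_left
  have i01 : Integrable fun x => (v x 0 * v x 1 : ℂ) :=
    h₀.memLp_left.integrable_mul h₁.memLp_left
  have i11 : Integrable fun x => (v x 1 * v x 1 : ℂ) :=
    h₁.memLp_left.integrable_mul h₁.memLp_left
  have q00 := i00.represents_fourier
  have q01 := i01.represents_fourier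
  have q11 := i11.represents_fourier
  set a := basisVec 0 with ha
  set b := basisVec 1 with hb
  -- The derivative introduced first is the outermost one acting on `ψ`, so these combinations match
  -- `stressPairing` and `viscousPairing` by definition.
  have hs := (((q01.lineDeriv a).lineDeriv a).sub ((q00.lineDeriv a).lineDeriv b)).add
    (((q11.lineDeriv b).lineDeriv a).sub ((q01.lineDeriv b).lineDeriv b))
  have hv := ((((r₁.lineDeriv a).lineDeriv a).lineDeriv a).sub
    (((r₀.lineDeriv a).lineDeriv a).lineDeriv b)).add
    ((((r₁.lineDeriv b).lineDeriv b).lineDeriv a).sub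
    (((r₀.lineDeriv b).lineDeriv b).lineDeriv b))
  have h := hs.add (hv.const_mul μ)
  refine (congrArg₂ Represents rfl ?_).mp h
  ext ξ
  have ea : ⟪ξ, a⟫_ℝ = ξ 0 := by simp [ha, EuclideanSpace.inner_single_right]
  have eb : ⟪ξ, b⟫_ℝ = ξ 1 := by simp [hb, EuclideanSpace.inner_single_right]
  have en : ‖ξ‖ ^ 2 = ξ 0 ^ 2 + ξ 1 ^ 2 := by
    rw [EuclideanSpace.norm_sq_eq, Fin.sum_univ_two]; simp
  simp only [vorticityRhs, stress, vorticity, fourierProd, ea, eb, en]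
  push_cast
  ring_nf
  simp only [Complex.I_sq, show Complex.I ^ 3 = -Complex.I from Complex.I_pow_three]
  ring

theorem integral_weakForm_integrand (μ : ℝ) (h₀ : IsFourier (fun x => (v x 0 : ℂ)) V₀)
    (h₁ : IsFourier (fun x => (v x 1 : ℂ)) V₁) {θ : ℝ → ℝ} (hθ : ContDiff ℝ ∞ θ)
    (ψ : 𝓢(Plane, ℂ)) (t : ℝ) :
    ∫ x, (⟪v x, deriv (fun s => θ s • perpGrad ψ x) t⟫_ℝ +
      ⟪v x, fderiv ℝ (fun y => θ t • perpGrad ψ y) x (v x)⟫_ℝ +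
      μ * ⟪v x, (Δ fun y => θ t • perpGrad ψ y) x⟫_ℝ) =
    deriv θ t * (∫ ξ, vorticity V₀ V₁ ξ * (𝓕⁻ ψ) ξ).re +
      θ t * (∫ ξ, vorticityRhs μ v V₀ V₁ ξ * (𝓕⁻ ψ) ξ).re := by
  simp only [weakForm_integrand_eq μ v hθ]
  have r₁ := represents_vorticityPairing h₀ h₁
  have r₂ := represents_flux μ h₀ h₁
  have i₁ := (r₁.integrable ψ).const_mul ((deriv θ t : ℝ) : ℂ)
  have i₂ := (r₂.integrable ψ).const_mul (θ t : ℂ)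
  have e := re_integral (i₁.add i₂)
  simp only [Pi.add_apply] at e
  rw [← e, ← r₁.pairing, ← r₂.pairing, integral_add i₁ i₂, integral_const_mul, integral_const_mul, Complex.add_re,
    Complex.re_ofReal_mul, Complex.re_ofReal_mul]

theorem integral_inner_smul_perpGrad (h₀ : IsFourier (fun x => (v x 0 : ℂ)) V₀)
    (h₁ : IsFourier (fun x => (v x 1 : ℂ)) V₁) (r : ℝ) (ψ : 𝓢(Plane, ℂ)) :
    ∫ x, ⟪v x, r • perpGrad ψ x⟫_ℝ = r * (∫ ξ, vorticity V₀ V₁ ξ * (𝓕⁻ ψ) ξ).re := by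
  have h := represents_vorticityPairing h₀ h₁
  rw [← h.pairing, re_integral (h.integrable ψ), ← integral_const_mul]
  refine integral_congr_ae (.of_forall fun x => ?_)
  simp only [perpGrad_apply, inner_smul_right, inner_smul_basisVec_sub, vorticityPairing,
    Complex.sub_re, Complex.re_ofReal_mul]

end WeakForm

end NavierStokes2D

/-! ### From tested equations to equations at almost every frequency. -/

namespace NavierStokes2D

open SchwartzMap FourierTransform Filter Topology

section LocallyTempered

/-- Functions of time and frequency that become integrable on `(0, T) × ℝ²` for every `T` after
division by a fixed power of `1 + ‖ξ‖`. -/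
def LocallyTempered (H : ℝ → Plane → ℂ) : Prop :=
  ∃ k : ℕ, ∀ T : ℝ, Integrable (fun z : ℝ × Plane => ((1 + ‖z.2‖) ^ k)⁻¹ • H z.1 z.2)
    ((volume.restrict (Ioc 0 T)).prod volume)

variable {H H₁ H₂ : ℝ → Plane → ℂ}

theorem LocallyTempered.mul_left (hH : LocallyTempered H) {g : ℝ → Plane → ℂ}
    (hg : Continuous (Function.uncurry g)) (j : ℕ)
    (hb : ∀ T : ℝ, ∃ C : ℝ, ∀ t ∈ Ioc 0 T, ∀ ξ, ‖g t ξ‖ ≤ C * (1 + ‖ξ‖) ^ j) :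
    LocallyTempered fun t ξ => g t ξ * H t ξ := by
  obtain ⟨k, hk⟩ := hH
  refine ⟨j + k, fun T => ?_⟩
  obtain ⟨C, hC⟩ := hb T
  have e : (fun z : ℝ × Plane => ((1 + ‖z.2‖) ^ (j + k))⁻¹ • (g z.1 z.2 * H z.1 z.2)) =
      fun z : ℝ × Plane => (((1 + ‖z.2‖) ^ j)⁻¹ • g z.1 z.2) •
        (((1 + ‖z.2‖) ^ k)⁻¹ • H z.1 z.2) := by
    ext z
    rw [pow_add, mul_inv, smul_eq_mul, smul_mul_smul_comm]
  rw [e]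
  have hm : Continuous fun z : ℝ × Plane => ((1 + ‖z.2‖) ^ j)⁻¹ • g z.1 z.2 := by
    have h0 : Continuous fun z : ℝ × Plane => ((1 + ‖z.2‖) ^ j)⁻¹ :=
      Continuous.inv₀ (by fun_prop) fun z => by positivity
    exact h0.smul hg
  refine (hk T).bdd_smul C hm.aestronglyMeasurable ?_
  have hT : ∀ᵐ z : ℝ × Plane ∂(volume.restrict (Ioc 0 T)).prod volume, z.1 ∈ Ioc 0 T :=
    Measure.quasiMeasurePreserving_fst.ae (ae_restrict_mem measurableSet_Ioc)
  filter_upwards [hT] with z hz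
  rw [norm_smul, norm_inv, norm_pow, Real.norm_of_nonneg (by positivity),
    inv_mul_le_iff₀ (by positivity), mul_comm]
  exact hC _ hz _

theorem LocallyTempered.of_le {k l : ℕ} (hkl : k ≤ l) {μ : Measure (ℝ × Plane)}
    (h : Integrable (fun z : ℝ × Plane => ((1 + ‖z.2‖) ^ k)⁻¹ • H z.1 z.2) μ) :
    Integrable (fun z : ℝ × Plane => ((1 + ‖z.2‖) ^ l)⁻¹ • H z.1 z.2) μ := by
  have e : (fun z : ℝ × Plane => ((1 + ‖z.2‖) ^ l)⁻¹ • H z.1 z.2) =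
      fun z : ℝ × Plane => ((1 + ‖z.2‖) ^ (l - k))⁻¹ • (((1 + ‖z.2‖) ^ k)⁻¹ • H z.1 z.2) := by
    ext z
    rw [smul_smul, ← mul_inv, ← pow_add, Nat.sub_add_cancel hkl]
  rw [e]
  have hm : Continuous fun z : ℝ × Plane => ((1 + ‖z.2‖) ^ (l - k))⁻¹ :=
    Continuous.inv₀ (by fun_prop) fun z => by positivity
  refine h.bdd_smul 1 hm.aestronglyMeasurable (.of_forall fun z => ?_)
  rw [norm_inv, norm_pow, Real.norm_of_nonneg (by positivity)]
  exact inv_le_one_of_one_le₀ (one_le_pow₀ (by linarith [norm_nonneg z.2]))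

theorem LocallyTempered.add (h₁ : LocallyTempered H₁) (h₂ : LocallyTempered H₂) :
    LocallyTempered fun t ξ => H₁ t ξ + H₂ t ξ := by
  obtain ⟨k, hk⟩ := h₁
  obtain ⟨l, hl⟩ := h₂
  refine ⟨max k l, fun T => ?_⟩
  simp only [smul_add]
  exact (of_le (le_max_left k l) (hk T)).add (of_le (le_max_right k l) (hl T))

theorem LocallyTempered.sub (h₁ : LocallyTempered H₁) (h₂ : LocallyTempered H₂) :
    LocallyTempered fun t ξ => H₁ t ξ - H₂ t ξ := by
  have := h₁.add (h₂.mul_left (g := fun _ _ => -1) continuous_const 0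
    fun T => ⟨1, fun t _ ξ => by simp⟩)
  simpa only [neg_one_mul, ← sub_eq_add_neg] using this

theorem locallyTempered_of_lintegral_le (hH : StronglyMeasurable (Function.uncurry H)) {k : ℕ}
    {M : ℝ≥0∞} (hM : M < ⊤) (h : ∀ᵐ t ∂(volume : Measure ℝ).restrict (Ioi 0),
      ∫⁻ ξ : Plane, ‖((1 + ‖ξ‖) ^ k)⁻¹‖ₑ * ‖H t ξ‖ₑ ≤ M) : LocallyTempered H := by
  refine ⟨k, fun T => ?_⟩
  have hm : Continuous fun z : ℝ × Plane => ((1 + ‖z.2‖) ^ k)⁻¹ :=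
    Continuous.inv₀ (by fun_prop) fun z => by positivity
  have hs : StronglyMeasurable fun z : ℝ × Plane => ((1 + ‖z.2‖) ^ k)⁻¹ • H z.1 z.2 :=
    hm.stronglyMeasurable.smul hH
  refine ⟨hs.aestronglyMeasurable, ?_⟩
  rw [HasFiniteIntegral, lintegral_prod _ hs.enorm.aemeasurable]
  simp only [enorm_smul]
  calc _ ≤ ∫⁻ _ in Ioc 0 T, M := by
        refine lintegral_mono_ae ?_
        exact ae_restrict_of_ae_restrict_of_subset Ioc_subset_Ioi_self h
    _ < ⊤ := by
        rw [setLIntegral_const]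
        exact ENNReal.mul_lt_top hM (by simp)

theorem lintegral_enorm_weight_lt_top {k : ℕ} (hk : 3 ≤ k) :
    ∫⁻ ξ : Plane, ‖((1 + ‖ξ‖) ^ k)⁻¹‖ₑ < ⊤ := by
  have := (integrable_one_add_norm (E := Plane) (μ := volume) (r := k)
    (by simp; exact_mod_cast hk)).2
  refine lt_of_le_of_lt (lintegral_mono fun ξ => le_of_eq ?_) this
  simp only
  rw [Real.rpow_neg (by positivity)]
  norm_cast

theorem locallyTempered_of_bounded (hH : StronglyMeasurable (Function.uncurry H)) {K : ℝ≥0∞}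
    (hK : K < ⊤) (h : ∀ᵐ t ∂(volume : Measure ℝ).restrict (Ioi 0), ∀ ξ, ‖H t ξ‖ₑ ≤ K) :
    LocallyTempered H := by
  refine locallyTempered_of_lintegral_le hH (k := 3)
    (ENNReal.mul_lt_top (lintegral_enorm_weight_lt_top le_rfl) hK) ?_
  filter_upwards [h] with t ht
  rw [← lintegral_mul_const' _ _ hK.ne]
  exact lintegral_mono fun ξ => by gcongr; exact ht ξ

theorem ENNReal_mul_le_sq_add_sq (a b : ℝ≥0∞) : a * b ≤ a ^ 2 + b ^ 2 := by
  rcases le_total a b with h | h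
  · exact (mul_le_mul_left h b).trans (by rw [← sq]; exact le_add_self)
  · exact (mul_le_mul_right h a).trans (by rw [← sq]; exact le_self_add)

theorem locallyTempered_of_sq (hH : StronglyMeasurable (Function.uncurry H)) {K : ℝ≥0∞}
    (hK : K < ⊤) (h : ∀ᵐ t ∂(volume : Measure ℝ).restrict (Ioi 0), ∫⁻ ξ, ‖H t ξ‖ₑ ^ 2 ≤ K) :
    LocallyTempered H := by
  have hw := lintegral_enorm_weight_lt_top (k := 4) (by norm_num)
  refine locallyTempered_of_lintegral_le hH (k := 2) (ENNReal.add_lt_top.2 ⟨hw, hK⟩) ?_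
  filter_upwards [h] with t ht
  have e : ∀ ξ : Plane, ‖((1 + ‖ξ‖) ^ 2)⁻¹‖ₑ ^ 2 = ‖((1 + ‖ξ‖) ^ 4)⁻¹‖ₑ := by
    intro ξ
    rw [← enorm_pow, ← inv_pow, ← inv_pow, ← pow_mul]
  calc _ ≤ ∫⁻ ξ : Plane, (‖((1 + ‖ξ‖) ^ 4)⁻¹‖ₑ + ‖H t ξ‖ₑ ^ 2) :=
        lintegral_mono fun ξ => by rw [← e]; exact ENNReal_mul_le_sq_add_sq _ _
    _ ≤ _ := by
        have hm : Measurable fun ξ : Plane => ‖((1 + ‖ξ‖) ^ 4)⁻¹‖ₑ := by fun_prop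
        rw [lintegral_add_left hm]
        gcongr

theorem LocallyTempered.integrable_mul (h : LocallyTempered H) (T : ℝ) (m : 𝓢(Plane, ℂ)) :
    Integrable (fun z : ℝ × Plane => H z.1 z.2 * m z.2)
      ((volume.restrict (Ioc 0 T)).prod volume) := by
  obtain ⟨k, hk⟩ := h
  have e : (fun z : ℝ × Plane => H z.1 z.2 * m z.2) =
      fun z => ((1 + ‖z.2‖) ^ k • m z.2) * (((1 + ‖z.2‖) ^ k)⁻¹ • H z.1 z.2) := by
    ext z
    have : ((1 + ‖z.2‖) ^ k) ≠ 0 := by positivity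
    rw [smul_mul_smul_comm, mul_inv_cancel₀ this, one_smul, mul_comm]
  rw [e]
  have hm : Continuous fun z : ℝ × Plane => (1 + ‖z.2‖) ^ k • m z.2 := by
    have h0 : Continuous fun z : ℝ × Plane => (1 + ‖z.2‖) ^ k := by fun_prop
    exact h0.smul (m.continuous.comp continuous_snd)
  refine (hk T).bdd_mul (c := 2 ^ k * ((Finset.Iic (k, 0)).sup
    (schwartzSeminormFamily ℂ Plane ℂ)) m) hm.aestronglyMeasurable (.of_forall fun z => ?_)
  have := one_add_le_sup_seminorm_apply (𝕜 := ℂ) (m := (k, 0)) le_rfl le_rfl m z.2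
  rw [norm_iteratedFDeriv_zero] at this
  rw [norm_smul, norm_pow, Real.norm_of_nonneg (by positivity)]
  exact this

theorem LocallyTempered.integrableOn_integral_mul (h : LocallyTempered H) (T : ℝ)
    (m : 𝓢(Plane, ℂ)) : IntegrableOn (fun t => ∫ ξ, H t ξ * m ξ) (Ioc 0 T) :=
  (h.integrable_mul T m).integral_prod_left

theorem LocallyTempered.integral_integral_mul (h : LocallyTempered H) (T : ℝ)
    (m : 𝓢(Plane, ℂ)) :
    ∫ t in Ioc 0 T, ∫ ξ, H t ξ * m ξ = ∫ ξ, (∫ t in Ioc 0 T, H t ξ) * m ξ := by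
  rw [integral_integral_swap (h.integrable_mul T m)]
  simp only [integral_mul_const]

theorem LocallyTempered.temperedIntegrable_integral (h : LocallyTempered H) (T : ℝ) :
    TemperedIntegrable fun ξ => ∫ t in Ioc 0 T, H t ξ := by
  obtain ⟨k, hk⟩ := h
  refine ⟨k, (hk T).integral_prod_right.congr (.of_forall fun ξ => ?_)⟩
  simp only [integral_smul]

theorem LocallyTempered.ae_integrableOn (h : LocallyTempered H) :
    ∀ᵐ ξ, ∀ T : ℝ, IntegrableOn (fun t => H t ξ) (Ioc 0 T) := by
  obtain ⟨k, hk⟩ := h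
  have : ∀ n : ℕ, ∀ᵐ ξ, Integrable (fun t => ((1 + ‖ξ‖) ^ k)⁻¹ • H t ξ)
      (volume.restrict (Ioc 0 (n : ℝ))) := fun n => (hk n).prod_left_ae
  filter_upwards [ae_all_iff.2 this] with ξ hξ T
  obtain ⟨n, hn⟩ := exists_nat_ge T
  have h0 : ((1 + ‖ξ‖) ^ k)⁻¹ ≠ 0 := by positivity
  have hi : IntegrableOn (fun t => H t ξ) (Ioc 0 (n : ℝ)) := (integrable_smul_iff h0 _).1 (hξ n)
  exact hi.mono_set (Ioc_subset_Ioc_right hn)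

/-- An evolution equation tested against the Fourier transforms of test functions holds at almost
every frequency. -/
theorem ae_ae_eq_add_integral {ζ β : ℝ → Plane → ℂ} {ζ₀ : Plane → ℂ} (hζ : LocallyTempered ζ)
    (hβ : LocallyTempered β) (hζ₀ : TemperedIntegrable ζ₀)
    (h : ∀ ψ : 𝓢(Plane, ℂ), HasCompactSupport ψ →
      ∀ᵐ t ∂(volume : Measure ℝ).restrict (Ioi 0), ∫ ξ, ζ t ξ * (𝓕⁻ ψ) ξ =
        (∫ ξ, ζ₀ ξ * (𝓕⁻ ψ) ξ) + ∫ s in (0 : ℝ)..t, ∫ ξ, β s ξ * (𝓕⁻ ψ) ξ) :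
    ∀ᵐ ξ, ∀ᵐ t ∂(volume : Measure ℝ).restrict (Ioi 0),
      ζ t ξ = ζ₀ ξ + ∫ s in (0 : ℝ)..t, β s ξ := by
  -- The null set of times in `h` depends on `ψ`, so no time can be fixed first. Integrating over
  -- `(0, p)` gives an identity between tempered functions of `ξ` alone, with the iterated time
  -- integral becoming the weight `p - t`. Each rational `p` costs one null set of frequencies.
  have hp : ∀ p : ℚ, 0 < p → ∀ᵐ ξ, (∫ t in Ioc 0 (p : ℝ), ζ t ξ) -
      (∫ t in Ioc 0 (p : ℝ), ((p - t : ℝ) : ℂ) * β t ξ) - p * ζ₀ ξ = 0 := by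
    intro p hp
    have hp0 : (0 : ℝ) ≤ p := by exact_mod_cast hp.le
    have hpβ : LocallyTempered fun t ξ => ((p - t : ℝ) : ℂ) * β t ξ := by
      refine hβ.mul_left (g := fun t _ => ((p - t : ℝ) : ℂ)) (by fun_prop) 0
        fun T => ⟨p + T, fun t ht ξ => ?_⟩
      rw [Complex.norm_real, pow_zero, mul_one, Real.norm_eq_abs, abs_le]
      constructor <;> linarith [ht.1, ht.2]
    have t1 := hζ.temperedIntegrable_integral p
    have t2 := hpβ.temperedIntegrable_integral p
    have t3 := hζ₀.const_mul (p : ℂ)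
    refine ((t1.sub t2).sub t3).ae_eq_zero fun ψ hψ => ?_
    set m := 𝓕⁻ ψ with hm
    have t12 := (t1.sub t2).integrable_mul m
    simp only [sub_mul] at t12 ⊢
    rw [integral_sub t12 (t3.integrable_mul m),
      integral_sub (t1.integrable_mul m) (t2.integrable_mul m), ← hζ.integral_integral_mul,
      ← hpβ.integral_integral_mul]
    simp only [mul_assoc, integral_const_mul]
    have hB := fun T => hβ.integrableOn_integral_mul T m
    have e1 : ∫ t in Ioc 0 (p : ℝ), ∫ ξ, ζ t ξ * m ξ =
        ∫ t in Ioc 0 (p : ℝ), ((∫ ξ, ζ₀ ξ * m ξ) + ∫ s in (0 : ℝ)..t, ∫ ξ, β s ξ * m ξ) :=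
      integral_congr_ae (ae_restrict_of_ae_restrict_of_subset Ioc_subset_Ioi_self (h ψ hψ))
    have e2 := integral_primitive hB hp0
    rw [intervalIntegral.integral_of_le hp0, intervalIntegral.integral_of_le hp0] at e2
    simp only [Complex.real_smul] at e2
    rw [e1, integral_add (integrable_const _) (integrableOn_primitive hB p), e2]
    simp [hp0]
  have hp' : ∀ᵐ ξ, ∀ p : ℚ, 0 < p → (∫ t in Ioc 0 (p : ℝ), ζ t ξ) -
      (∫ t in Ioc 0 (p : ℝ), ((p - t : ℝ) : ℂ) * β t ξ) - p * ζ₀ ξ = 0 :=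
    ae_all_iff.2 fun p => by
      by_cases h0 : 0 < p
      · filter_upwards [hp p h0] with ξ hξ _ using hξ
      · exact .of_forall fun ξ h => absurd h h0
  filter_upwards [hp', hζ.ae_integrableOn, hβ.ae_integrableOn] with ξ h1 h2 h3
  have hc : ∀ T : ℝ, IntegrableOn (fun _ : ℝ => ζ₀ ξ) (Ioc 0 T) := fun T =>
    integrableOn_const (by simp)
  have hi : ∀ T : ℝ, IntegrableOn (fun t => ζ t ξ - ζ₀ ξ - ∫ s in (0 : ℝ)..t, β s ξ) (Ioc 0 T) :=
    fun T => ((h2 T).sub (hc T)).sub (integrableOn_primitive h3 T)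
  -- At a fixed good frequency the integrated identities determine the equation at almost every
  -- time.
  have key := ae_eq_zero_of_forall_integral_eq_zero hi fun p hp => by
    have hp0 : (0 : ℝ) ≤ p := by exact_mod_cast hp.le
    have e2 := integral_primitive h3 hp0
    rw [intervalIntegral.integral_of_le hp0, intervalIntegral.integral_of_le hp0] at e2
    simp only [Complex.real_smul] at e2
    have h20 : IntegrableOn (fun t => ζ t ξ - ζ₀ ξ) (Ioc 0 (p : ℝ)) := (h2 p).sub (hc p)
    rw [intervalIntegral.integral_of_le hp0, integral_sub h20
      (integrableOn_primitive h3 p), integral_sub (h2 p) (hc p), e2, ← h1 p hp]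
    simp [hp0]
    ring
  filter_upwards [key] with t ht
  linear_combination ht

end LocallyTempered

end NavierStokes2D

/-! ### The Duhamel inequality for the Fourier transform of the velocity. -/

namespace NavierStokes2D

open SchwartzMap FourierTransform Filter Topology

section TestedEquation

theorem ae_integral_eq_add_integral_of_weak {ζ β : ℝ → Plane → ℂ} {ζ₀ : Plane → ℂ}
    (hζ : LocallyTempered ζ) (hβ : LocallyTempered β)
    (h : ∀ ψ : 𝓢(Plane, ℂ), HasCompactSupport ψ → ∀ θ : ℝ → ℝ, ContDiff ℝ ∞ θ →
      HasCompactSupport θ → ∫ t in Ioi (0 : ℝ), (deriv θ t * (∫ ξ, ζ t ξ * (𝓕⁻ ψ) ξ).re +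
        θ t * (∫ ξ, β t ξ * (𝓕⁻ ψ) ξ).re) = -(θ 0 * (∫ ξ, ζ₀ ξ * (𝓕⁻ ψ) ξ).re))
    (ψ : 𝓢(Plane, ℂ)) (hψ : HasCompactSupport ψ) :
    ∀ᵐ t ∂(volume : Measure ℝ).restrict (Ioi 0), ∫ ξ, ζ t ξ * (𝓕⁻ ψ) ξ =
      (∫ ξ, ζ₀ ξ * (𝓕⁻ ψ) ξ) + ∫ s in (0 : ℝ)..t, ∫ ξ, β s ξ * (𝓕⁻ ψ) ξ := by
  have hre : ∀ χ : 𝓢(Plane, ℂ), HasCompactSupport χ →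
      ∀ᵐ t ∂(volume : Measure ℝ).restrict (Ioi 0), (∫ ξ, ζ t ξ * (𝓕⁻ χ) ξ).re =
        (∫ ξ, ζ₀ ξ * (𝓕⁻ χ) ξ).re + (∫ s in (0 : ℝ)..t, ∫ ξ, β s ξ * (𝓕⁻ χ) ξ).re := by
    intro χ hχ
    have hA := fun T => hζ.integrableOn_integral_mul T (𝓕⁻ χ)
    have hB := fun T => hβ.integrableOn_integral_mul T (𝓕⁻ χ)
    have key := ae_eq_add_integral_of_weak (fun T => (hA T).re) (fun T => (hB T).re) (h χ hχ)
    filter_upwards [key, self_mem_ae_restrict measurableSet_Ioi] with t ht ht0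
    refine ht.trans ?_
    congr 1
    exact Complex.reCLM.intervalIntegral_comp_comm
      (intervalIntegrable_of_integrableOn_Ioc hB le_rfl (le_of_lt ht0))
  -- The weak equation controls real parts only; testing with `iψ` supplies the imaginary part.
  have hI : ∀ f : Plane → ℂ, ∫ ξ, f ξ * (𝓕⁻ (Complex.I • ψ)) ξ =
      Complex.I * ∫ ξ, f ξ * (𝓕⁻ ψ) ξ := by
    intro f
    rw [FourierTransform.fourierInv_smul, ← integral_const_mul]
    refine integral_congr_ae (.of_forall fun ξ => ?_)
    simp only [smul_apply, smul_eq_mul]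
    ring
  filter_upwards [hre ψ hψ, hre (Complex.I • ψ) (hψ.smul_left (f := fun _ => Complex.I))]
    with t h1 h2
  refine Complex.ext ?_ ?_
  · rw [h1, Complex.add_re]
  · simp only [hI, intervalIntegral.integral_const_mul, Complex.I_mul_re] at h2
    rw [Complex.add_im]
    linarith

end TestedEquation

section Measurability

theorem measurable_lintegral_Ioo {f : ℝ × Plane → ℝ → ℝ≥0∞}
    (hf : Measurable (Function.uncurry f)) :
    Measurable fun z : ℝ × Plane => ∫⁻ s in Ioo 0 z.1, f z s := by
  have e : (fun z : ℝ × Plane => ∫⁻ s in Ioo 0 z.1, f z s) = fun z => ∫⁻ s,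
      {q : (ℝ × Plane) × ℝ | q.2 ∈ Ioo 0 q.1.1}.indicator (Function.uncurry f) (z, s) := by
    ext z
    rw [← lintegral_indicator measurableSet_Ioo]
    rfl
  rw [e]
  refine Measurable.lintegral_prod_right' (hf.indicator ?_)
  exact (measurableSet_lt measurable_const measurable_snd).inter
    (measurableSet_lt measurable_snd measurable_fst.fst)

theorem stronglyMeasurable_fourierProd {w : ℝ → Plane → Plane}
    (hw : StronglyMeasurable (Function.uncurry w)) (i j : Fin 2) :
    StronglyMeasurable (Function.uncurry fun t => fourierProd (w t) i j) := by
  have hc : ∀ k : Fin 2, StronglyMeasurable fun p : (ℝ × Plane) × Plane => (w p.1.1 p.2 k : ℂ) :=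
    fun k => (Complex.continuous_ofReal.comp (EuclideanSpace.proj (𝕜 := ℝ) k).continuous
      ).comp_stronglyMeasurable (hw.comp_measurable (measurable_fst.fst.prodMk measurable_snd))
  refine StronglyMeasurable.integral_prod_right'
    (f := fun p : (ℝ × Plane) × Plane => phase p.1.2 p.2 * (w p.1.1 p.2 i * w p.1.1 p.2 j : ℂ)) ?_
  refine StronglyMeasurable.mul ?_ ((hc i).mul (hc j))
  exact (continuous_phase.comp (continuous_fst.snd.prodMk continuous_snd)).stronglyMeasurable

theorem norm_apply_le_one_add (ξ : Plane) (i : Fin 2) : ‖(ξ i : ℂ)‖ ≤ 1 + ‖ξ‖ := by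
  rw [Complex.norm_real]
  linarith [PiLp.norm_apply_le ξ i]

theorem LocallyTempered.coord_mul {H : ℝ → Plane → ℂ} (hH : LocallyTempered H) (i : Fin 2) :
    LocallyTempered fun t ξ => (ξ i : ℂ) * H t ξ :=
  hH.mul_left (g := fun _ ξ => (ξ i : ℂ))
    (Complex.continuous_ofReal.comp
      ((EuclideanSpace.proj (𝕜 := ℝ) i).continuous.comp continuous_snd)) 1
    fun _ => ⟨1, fun _ _ ξ => by simpa using norm_apply_le_one_add ξ i⟩

theorem LocallyTempered.const_mul {H : ℝ → Plane → ℂ} (hH : LocallyTempered H) (c : ℂ) :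
    LocallyTempered fun t ξ => c * H t ξ :=
  hH.mul_left (g := fun _ _ => c) continuous_const 0 fun _ => ⟨‖c‖, fun _ _ ξ => by simp⟩

theorem LocallyTempered.vorticity {V₀ V₁ : ℝ → Plane → ℂ} (h₀ : LocallyTempered V₀)
    (h₁ : LocallyTempered V₁) : LocallyTempered fun t => vorticity (V₀ t) (V₁ t) :=
  ((h₀.coord_mul 1).sub (h₁.coord_mul 0)).const_mul _

theorem LocallyTempered.stress {Q₀₀ Q₀₁ Q₁₁ : ℝ → Plane → ℂ} (h₀₀ : LocallyTempered Q₀₀)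
    (h₀₁ : LocallyTempered Q₀₁) (h₁₁ : LocallyTempered Q₁₁) :
    LocallyTempered fun t => stress (Q₀₀ t) (Q₀₁ t) (Q₁₁ t) := by
  have h := ((((h₀₀.sub h₁₁).coord_mul 0).coord_mul 1).add
    (((h₀₁.coord_mul 1).coord_mul 1).sub ((h₀₁.coord_mul 0).coord_mul 0))).const_mul
    (4 * Real.pi ^ 2)
  refine (congrArg LocallyTempered ?_).mp h
  ext t ξ
  simp only [NavierStokes2D.stress]
  ring

theorem LocallyTempered.normSq_mul {H : ℝ → Plane → ℂ} (hH : LocallyTempered H) (c : ℝ) :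
    LocallyTempered fun t ξ => ((c * ‖ξ‖ ^ 2 : ℝ) : ℂ) * H t ξ := by
  refine hH.mul_left (g := fun _ ξ => ((c * ‖ξ‖ ^ 2 : ℝ) : ℂ)) (by fun_prop) 2
    fun _ => ⟨‖c‖, fun _ _ ξ => ?_⟩
  rw [Complex.norm_real, norm_mul, norm_pow, norm_norm]
  gcongr
  linarith

end Measurability

section Duhamel

theorem enorm_ofReal (r : ℝ) : ‖(r : ℂ)‖ₑ = ‖r‖ₑ := by
  rw [← ofReal_norm, ← ofReal_norm, Complex.norm_real]

theorem norm_stress_le (Q₀₀ Q₀₁ Q₁₁ : Plane → ℂ) (ξ : Plane) :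
    ‖stress Q₀₀ Q₀₁ Q₁₁ ξ‖ ≤
      4 * Real.pi ^ 2 * (‖ξ‖ * (‖ξ‖ * (‖Q₀₀ ξ‖ + ‖Q₁₁ ξ‖ + ‖Q₀₁ ξ‖))) := by
  have en : ‖ξ‖ ^ 2 = ξ 0 ^ 2 + ξ 1 ^ 2 := by
    rw [EuclideanSpace.norm_sq_eq, Fin.sum_univ_two]; simp
  have h1 : ‖(ξ 0 * ξ 1 : ℂ)‖ ≤ ‖ξ‖ ^ 2 := by
    rw [← Complex.ofReal_mul, Complex.norm_real, Real.norm_eq_abs, en, abs_le]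
    constructor <;> nlinarith [sq_nonneg (ξ 0 + ξ 1), sq_nonneg (ξ 0 - ξ 1)]
  have h2 : ‖(ξ 1 ^ 2 - ξ 0 ^ 2 : ℂ)‖ ≤ ‖ξ‖ ^ 2 := by
    rw [← Complex.ofReal_pow, ← Complex.ofReal_pow, ← Complex.ofReal_sub, Complex.norm_real,
      Real.norm_eq_abs, en, abs_le]
    constructor <;> nlinarith [sq_nonneg (ξ 0), sq_nonneg (ξ 1)]
  have h4 : ‖(4 * Real.pi ^ 2 : ℂ)‖ = 4 * Real.pi ^ 2 := by
    rw [norm_mul, norm_pow, Complex.norm_real, Real.norm_of_nonneg Real.pi_pos.le]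
    simp
  unfold stress
  rw [norm_mul, h4]
  gcongr
  calc _ ≤ (‖Q₀₀ ξ‖ + ‖Q₁₁ ξ‖) * ‖ξ‖ ^ 2 + ‖Q₀₁ ξ‖ * ‖ξ‖ ^ 2 := by
        refine (norm_add_le _ _).trans ?_
        rw [norm_mul _ (ξ 0 * ξ 1 : ℂ), norm_mul (Q₀₁ ξ)]
        gcongr
        exact norm_sub_le _ _
    _ = _ := by ring

/-- The transforms of the three products are bounded by three of the four correlations in the
expansion of `(|V₀| + |V₁|)(|V₀| + |V₁|)`. One factor `|ξ|` is part of `bilin`; the other is kept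
apart, to be cancelled against the vorticity. -/
theorem enorm_stress_fourierProd_le {v : Plane → Plane} {V₀ V₁ : Plane → ℂ}
    (h₀ : IsFourier (fun x => (v x 0 : ℂ)) V₀) (h₁ : IsFourier (fun x => (v x 1 : ℂ)) V₁)
    (ξ : Plane) :
    ‖stress (fourierProd v 0 0) (fourierProd v 0 1) (fourierProd v 1 1) ξ‖ₑ ≤
      ENNReal.ofReal (4 * Real.pi ^ 2) *
        (ENNReal.ofReal ‖ξ‖ * bilin (fun η => ‖V₀ η‖ₑ + ‖V₁ η‖ₑ) ξ) := by
  have m0 := h₀.memLp_right.1.enorm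
  have m1 := h₁.memLp_right.1.enorm
  have hq : ‖fourierProd v 0 0 ξ‖ₑ + ‖fourierProd v 1 1 ξ‖ₑ + ‖fourierProd v 0 1 ξ‖ₑ ≤
      ∫⁻ η, (‖V₀ η‖ₑ + ‖V₁ η‖ₑ) * (‖V₀ (ξ + η)‖ₑ + ‖V₁ (ξ + η)‖ₑ) := by
    have ht : ∀ {V : Plane → ℂ}, AEMeasurable (fun η => ‖V η‖ₑ) →
        AEMeasurable fun η => ‖V (ξ + η)‖ₑ := fun hV =>
      hV.comp_quasiMeasurePreserving
        (measurePreserving_add_left volume ξ).quasiMeasurePreserving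
    refine (add_le_add (add_le_add (h₀.enorm_fourier_mul_le h₀ ξ)
      (h₁.enorm_fourier_mul_le h₁ ξ)) (h₀.enorm_fourier_mul_le h₁ ξ)).trans ?_
    have a0 : AEMeasurable fun η => ‖V₀ η‖ₑ * ‖V₀ (ξ + η)‖ₑ := m0.mul (ht m0)
    have a1 : AEMeasurable fun η => ‖V₀ η‖ₑ * ‖V₀ (ξ + η)‖ₑ + ‖V₁ η‖ₑ * ‖V₁ (ξ + η)‖ₑ :=
      a0.add (m1.mul (ht m1))
    rw [← lintegral_add_left' a0, ← lintegral_add_left' a1]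
    refine lintegral_mono fun η => ?_
    simp only [add_mul, mul_add]
    calc _ ≤ ‖V₀ η‖ₑ * ‖V₀ (ξ + η)‖ₑ + ‖V₁ η‖ₑ * ‖V₁ (ξ + η)‖ₑ + ‖V₀ η‖ₑ * ‖V₁ (ξ + η)‖ₑ +
          ‖V₁ η‖ₑ * ‖V₀ (ξ + η)‖ₑ := le_self_add
      _ = _ := by ring
  rw [← ofReal_norm]
  refine (ENNReal.ofReal_le_ofReal (norm_stress_le _ _ _ ξ)).trans ?_
  rw [ENNReal.ofReal_mul (by positivity), ENNReal.ofReal_mul (norm_nonneg _),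
    ENNReal.ofReal_mul (norm_nonneg _), ENNReal.ofReal_add (by positivity) (by positivity),
    ENNReal.ofReal_add (by positivity) (by positivity), ofReal_norm, ofReal_norm, ofReal_norm,
    ofReal_norm]
  unfold bilin
  rw [ofReal_norm]
  gcongr

theorem measurable_enorm_vorticity {V₀ V₁ : ℝ → Plane → ℂ}
    (h₀ : StronglyMeasurable (Function.uncurry V₀))
    (h₁ : StronglyMeasurable (Function.uncurry V₁)) :
    Measurable fun z : ℝ × Plane => ‖vorticity (V₀ z.1) (V₁ z.1) z.2‖ₑ := by
  have hc : ∀ i : Fin 2, Measurable fun z : ℝ × Plane => (z.2 i : ℂ) := fun i => by fun_prop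
  have m₀ := h₀.measurable
  have m₁ := h₁.measurable
  exact (((hc 1).mul m₀).sub ((hc 0).mul m₁)).const_mul _ |>.enorm

theorem measurable_enorm_vorticity' {V₀ V₁ : Plane → ℂ} (h₀ : StronglyMeasurable V₀)
    (h₁ : StronglyMeasurable V₁) : Measurable fun ξ => ‖vorticity V₀ V₁ ξ‖ₑ := by
  have hc : ∀ i : Fin 2, Measurable fun ξ : Plane => (ξ i : ℂ) := fun i => by fun_prop
  have m₀ := h₀.measurable
  have m₁ := h₁.measurable
  exact (((hc 1).mul m₀).sub ((hc 0).mul m₁)).const_mul _ |>.enorm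

theorem measurable_enorm_stress {Q₀₀ Q₀₁ Q₁₁ : ℝ → Plane → ℂ}
    (h₀₀ : StronglyMeasurable (Function.uncurry Q₀₀))
    (h₀₁ : StronglyMeasurable (Function.uncurry Q₀₁))
    (h₁₁ : StronglyMeasurable (Function.uncurry Q₁₁)) :
    Measurable fun z : ℝ × Plane => ‖stress (Q₀₀ z.1) (Q₀₁ z.1) (Q₁₁ z.1) z.2‖ₑ := by
  have hc : ∀ i : Fin 2, Measurable fun z : ℝ × Plane => (z.2 i : ℂ) := fun i => by fun_prop
  exact ((((h₀₀.measurable.sub h₁₁.measurable).mul ((hc 0).mul (hc 1))).add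
    (h₀₁.measurable.mul (((hc 1).pow_const 2).sub ((hc 0).pow_const 2)))).const_mul _).enorm

/-- The Duhamel inequality obtained from the evolution equation at almost every frequency. -/
theorem ae_ae_enorm_le_heat {κ : ℝ} {ζ b : ℝ → Plane → ℂ} {ζ₀ : Plane → ℂ}
    (hζ : LocallyTempered ζ) (hb : LocallyTempered b)
    (mζ : Measurable fun z : ℝ × Plane => ‖ζ z.1 z.2‖ₑ)
    (mb : Measurable fun z : ℝ × Plane => ‖b z.1 z.2‖ₑ) (mζ₀ : Measurable fun ξ => ‖ζ₀ ξ‖ₑ)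
    (h : ∀ᵐ ξ, ∀ᵐ t ∂(volume : Measure ℝ).restrict (Ioi 0),
      ζ t ξ = ζ₀ ξ + ∫ s in (0 : ℝ)..t, (b s ξ - ((κ * ‖ξ‖ ^ 2 : ℝ) : ℂ) * ζ s ξ)) :
    ∀ᵐ t ∂(volume : Measure ℝ).restrict (Ioi 0), ∀ᵐ ξ,
      ‖ζ t ξ‖ₑ ≤ heat κ t ξ * ‖ζ₀ ξ‖ₑ + ∫⁻ s in Ioo 0 t, heat κ (t - s) ξ * ‖b s ξ‖ₑ := by
  have hduh : ∀ᵐ ξ : Plane, ∀ᵐ t ∂(volume : Measure ℝ).restrict (Ioi 0),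
      ‖ζ t ξ‖ₑ ≤ heat κ t ξ * ‖ζ₀ ξ‖ₑ + ∫⁻ s in Ioo 0 t, heat κ (t - s) ξ * ‖b s ξ‖ₑ := by
    have he : ∀ r (ξ : Plane), ENNReal.ofReal (Real.exp (-(κ * ‖ξ‖ ^ 2) * r)) = heat κ r ξ := by
      intro r ξ
      unfold heat
      congr 2
      ring
    filter_upwards [h, hζ.ae_integrableOn, hb.ae_integrableOn] with ξ a1 a2 a3
    have := norm_le_of_integral_equation a2 a3 a1
    simpa only [he] using this
  have mh := measurable_heat κ
  have hset : MeasurableSet {z : ℝ × Plane | ‖ζ z.1 z.2‖ₑ ≤ heat κ z.1 z.2 * ‖ζ₀ z.2‖ₑ +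
        ∫⁻ s in Ioo 0 z.1, heat κ (z.1 - s) z.2 * ‖b s z.2‖ₑ} := by
    refine measurableSet_le mζ ((mh.mul (mζ₀.comp measurable_snd)).add
      (measurable_lintegral_Ioo (f := fun z s => heat κ (z.1 - s) z.2 * ‖b s z.2‖ₑ) ?_))
    exact (mh.comp ((measurable_fst.fst.sub measurable_snd).prodMk measurable_fst.snd)).mul
      (mb.comp (measurable_snd.prodMk measurable_fst.snd))
  -- The equation was solved at a fixed frequency, whereas the estimates need almost every frequency
  -- at a fixed time; Fubini exchanges the two because the set is measurable.
  exact (Measure.ae_ae_comm (p := fun t ξ => ‖ζ t ξ‖ₑ ≤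
    heat κ t ξ * ‖ζ₀ ξ‖ₑ + ∫⁻ s in Ioo 0 t, heat κ (t - s) ξ * ‖b s ξ‖ₑ) hset).2 hduh

theorem LocallyTempered.fourierProd {w : ℝ → Plane → Plane}
    (hw : StronglyMeasurable (Function.uncurry w)) {i j : Fin 2} {W W' : ℝ → Plane → ℂ}
    (h : ∀ᵐ t ∂(volume : Measure ℝ).restrict (Ioi 0), IsFourier (fun x => (w t x i : ℂ)) (W t))
    (h' : ∀ᵐ t ∂(volume : Measure ℝ).restrict (Ioi 0), IsFourier (fun x => (w t x j : ℂ)) (W' t))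
    {K : ℝ≥0∞} (hK : K < ⊤)
    (hK₀ : ∀ᵐ t ∂(volume : Measure ℝ).restrict (Ioi 0), ∫⁻ ξ, ‖W t ξ‖ₑ ^ 2 ≤ K)
    (hK₁ : ∀ᵐ t ∂(volume : Measure ℝ).restrict (Ioi 0), ∫⁻ ξ, ‖W' t ξ‖ₑ ^ 2 ≤ K) :
    LocallyTempered fun t => fourierProd (w t) i j := by
  refine locallyTempered_of_bounded (stronglyMeasurable_fourierProd hw i j)
    (ENNReal.add_lt_top.2 ⟨hK, hK⟩) ?_
  filter_upwards [h, h', hK₀, hK₁] with t hF hG hFK hGK ξ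
  refine (hF.enorm_fourier_mul_le hG ξ).trans ?_
  calc _ ≤ ∫⁻ η, (‖W t η‖ₑ ^ 2 + ‖W' t (ξ + η)‖ₑ ^ 2) :=
        lintegral_mono fun η => ENNReal_mul_le_sq_add_sq _ _
    _ = (∫⁻ η, ‖W t η‖ₑ ^ 2) + ∫⁻ η, ‖W' t (ξ + η)‖ₑ ^ 2 :=
        lintegral_add_left' (hF.memLp_right.1.enorm.pow_const 2) _
    _ ≤ K + K := by
        rw [lintegral_add_left_eq_self (fun η => ‖W' t η‖ₑ ^ 2) ξ]
        exact add_le_add hFK hGK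

/-- The Duhamel bound for the Fourier transform of the velocity. -/
theorem ae_ae_le_duhamel {μ : ℝ} {w : ℝ → Plane → Plane}
    (hw : StronglyMeasurable (Function.uncurry w)) {W₀ W₁ : ℝ → Plane → ℂ}
    (hW₀ : StronglyMeasurable (Function.uncurry W₀))
    (hW₁ : StronglyMeasurable (Function.uncurry W₁))
    (h₀ : ∀ᵐ t ∂(volume : Measure ℝ).restrict (Ioi 0),
      IsFourier (fun x => (w t x 0 : ℂ)) (W₀ t))
    (h₁ : ∀ᵐ t ∂(volume : Measure ℝ).restrict (Ioi 0),
      IsFourier (fun x => (w t x 1 : ℂ)) (W₁ t))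
    {K : ℝ≥0∞} (hK : K < ⊤)
    (hK₀ : ∀ᵐ t ∂(volume : Measure ℝ).restrict (Ioi 0), ∫⁻ ξ, ‖W₀ t ξ‖ₑ ^ 2 ≤ K)
    (hK₁ : ∀ᵐ t ∂(volume : Measure ℝ).restrict (Ioi 0), ∫⁻ ξ, ‖W₁ t ξ‖ₑ ^ 2 ≤ K)
    (hd : ∀ᵐ t ∂(volume : Measure ℝ).restrict (Ioi 0), ∀ᵐ ξ : Plane,
      (ξ 0 : ℂ) * W₀ t ξ + (ξ 1 : ℂ) * W₁ t ξ = 0)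
    {V₀ V₁ : Plane → ℂ} (hV₀ : StronglyMeasurable V₀) (hV₁ : StronglyMeasurable V₁)
    (hV₀2 : MemLp V₀ 2) (hV₁2 : MemLp V₁ 2)
    (h : ∀ ψ : 𝓢(Plane, ℂ), HasCompactSupport ψ → ∀ θ : ℝ → ℝ, ContDiff ℝ ∞ θ →
      HasCompactSupport θ → ∫ t in Ioi (0 : ℝ),
        (deriv θ t * (∫ ξ, vorticity (W₀ t) (W₁ t) ξ * (𝓕⁻ ψ) ξ).re +
          θ t * (∫ ξ, vorticityRhs μ (w t) (W₀ t) (W₁ t) ξ * (𝓕⁻ ψ) ξ).re) =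
        -(θ 0 * (∫ ξ, vorticity V₀ V₁ ξ * (𝓕⁻ ψ) ξ).re)) :
    ∀ᵐ t ∂(volume : Measure ℝ).restrict (Ioi 0), ∀ᵐ ξ : Plane,
      ‖W₀ t ξ‖ₑ + ‖W₁ t ξ‖ₑ ≤ ENNReal.ofReal (4 * Real.pi ^ 2) *
        (heat (4 * Real.pi ^ 2 * μ) t ξ * (‖V₀ ξ‖ₑ + ‖V₁ ξ‖ₑ) +
          ∫⁻ s in Ioo 0 t, heat (4 * Real.pi ^ 2 * μ) (t - s) ξ *
            bilin (fun η => ‖W₀ s η‖ₑ + ‖W₁ s η‖ₑ) ξ) := by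
  set κ := 4 * Real.pi ^ 2 * μ with hκ
  set b : ℝ → Plane → ℂ := fun t =>
    stress (fourierProd (w t) 0 0) (fourierProd (w t) 0 1) (fourierProd (w t) 1 1) with hb
  have lW₀ := locallyTempered_of_sq hW₀ hK hK₀
  have lW₁ := locallyTempered_of_sq hW₁ hK hK₁
  have lζ : LocallyTempered fun t => vorticity (W₀ t) (W₁ t) := lW₀.vorticity lW₁
  have lb : LocallyTempered b :=
    (LocallyTempered.fourierProd hw h₀ h₀ hK hK₀ hK₀).stress
      (LocallyTempered.fourierProd hw h₀ h₁ hK hK₀ hK₁)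
      (LocallyTempered.fourierProd hw h₁ h₁ hK hK₁ hK₁)
  have lβ : LocallyTempered fun t => vorticityRhs μ (w t) (W₀ t) (W₁ t) :=
    lb.sub (lζ.normSq_mul κ)
  have tζ₀ : TemperedIntegrable (vorticity V₀ V₁) := by
    have hc : ∀ {V : Plane → ℂ}, MemLp V 2 → ∀ i : Fin 2,
        TemperedIntegrable fun ξ : Plane => (ξ i : ℂ) * V ξ := fun hV i =>
      hV.temperedIntegrable.mul_left (Complex.continuous_ofReal.comp
        (EuclideanSpace.proj (𝕜 := ℝ) i).continuous).aestronglyMeasurable (C := 1) (j := 1)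
        fun ξ => by simpa using norm_apply_le_one_add ξ i
    exact ((hc hV₀2 1).sub (hc hV₁2 0)).const_mul _
  have hint := ae_integral_eq_add_integral_of_weak (ζ₀ := vorticity V₀ V₁) lζ lβ h
  have heq : ∀ᵐ ξ, ∀ᵐ t ∂(volume : Measure ℝ).restrict (Ioi 0),
      vorticity (W₀ t) (W₁ t) ξ = vorticity V₀ V₁ ξ +
        ∫ s in (0 : ℝ)..t, vorticityRhs μ (w s) (W₀ s) (W₁ s) ξ :=
    ae_ae_eq_add_integral lζ lβ tζ₀ hint
  have mζ₀ : Measurable fun ξ => ‖vorticity V₀ V₁ ξ‖ₑ := measurable_enorm_vorticity' hV₀ hV₁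
  have mζ := measurable_enorm_vorticity hW₀ hW₁
  have mb := measurable_enorm_stress (stronglyMeasurable_fourierProd hw 0 0)
    (stronglyMeasurable_fourierProd hw 0 1) (stronglyMeasurable_fourierProd hw 1 1)
  have hduh' := ae_ae_enorm_le_heat (κ := κ) lζ lb mζ mb mζ₀ heq
  have hne : ∀ᵐ ξ : Plane, ξ ≠ 0 := by simp [ae_iff]
  filter_upwards [hduh', hd] with t ht hdt
  filter_upwards [ht, hdt, hne] with ξ hξ hdξ h0
  have n0 : ENNReal.ofReal ‖ξ‖ ≠ 0 := by simpa using h0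
  -- Both sides are multiplied by `|ξ|`, nonzero almost everywhere, to compare velocity with
  -- vorticity.
  rw [← ENNReal.mul_le_mul_iff_right n0 ENNReal.ofReal_ne_top]
  set c := ENNReal.ofReal (4 * Real.pi ^ 2) with hc
  have b1 : ENNReal.ofReal ‖ξ‖ * (‖W₀ t ξ‖ₑ + ‖W₁ t ξ‖ₑ) ≤ ‖vorticity (W₀ t) (W₁ t) ξ‖ₑ := by
    have := ENNReal.ofReal_le_ofReal (norm_mul_le_norm_vorticity hdξ)
    rwa [ENNReal.ofReal_mul (norm_nonneg _), ENNReal.ofReal_add (norm_nonneg _) (norm_nonneg _),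
      ofReal_norm (W₀ t ξ), ofReal_norm (W₁ t ξ), ofReal_norm (vorticity _ _ ξ)] at this
  have b2 : ‖vorticity V₀ V₁ ξ‖ₑ ≤ c * (ENNReal.ofReal ‖ξ‖ * (‖V₀ ξ‖ₑ + ‖V₁ ξ‖ₑ)) := by
    have := ENNReal.ofReal_le_ofReal (norm_vorticity_le V₀ V₁ ξ)
    rw [ENNReal.ofReal_mul (by positivity), ENNReal.ofReal_mul (norm_nonneg _),
      ENNReal.ofReal_add (norm_nonneg _) (norm_nonneg _),
      ofReal_norm (V₀ ξ), ofReal_norm (V₁ ξ), ofReal_norm (vorticity _ _ ξ)] at this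
    refine this.trans ?_
    -- The bound `2π ≤ 4π²` allows a single constant for the datum and the forcing.
    exact mul_le_mul_left (ENNReal.ofReal_le_ofReal (by nlinarith [Real.pi_gt_three])) _
  have b3 : ∫⁻ s in Ioo 0 t, heat κ (t - s) ξ * ‖b s ξ‖ₑ ≤ c * (ENNReal.ofReal ‖ξ‖ *
      ∫⁻ s in Ioo 0 t, heat κ (t - s) ξ * bilin (fun η => ‖W₀ s η‖ₑ + ‖W₁ s η‖ₑ) ξ) := by
    rw [← lintegral_const_mul' _ _ ENNReal.ofReal_ne_top,
      ← lintegral_const_mul' _ _ ENNReal.ofReal_ne_top]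
    refine lintegral_mono_ae ?_
    filter_upwards [ae_restrict_of_ae_restrict_of_subset Ioo_subset_Ioi_self h₀,
      ae_restrict_of_ae_restrict_of_subset Ioo_subset_Ioi_self h₁] with s hs₀ hs₁
    calc _ ≤ heat κ (t - s) ξ * (c * (ENNReal.ofReal ‖ξ‖ *
          bilin (fun η => ‖W₀ s η‖ₑ + ‖W₁ s η‖ₑ) ξ)) := by
          gcongr
          exact enorm_stress_fourierProd_le hs₀ hs₁ ξ
      _ = _ := by ring
  calc _ ≤ ‖vorticity (W₀ t) (W₁ t) ξ‖ₑ := b1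
    _ ≤ _ := hξ
    _ ≤ heat κ t ξ * (c * (ENNReal.ofReal ‖ξ‖ * (‖V₀ ξ‖ₑ + ‖V₁ ξ‖ₑ))) + c * (ENNReal.ofReal ‖ξ‖ *
        ∫⁻ s in Ioo 0 t, heat κ (t - s) ξ * bilin (fun η => ‖W₀ s η‖ₑ + ‖W₁ s η‖ₑ) ξ) :=
      add_le_add (mul_le_mul_right b2 _) b3
    _ = _ := by ring

end Duhamel

end NavierStokes2D

/-! ### Consequences of the energy class, and the conclusion. -/

namespace NavierStokes2D

open SchwartzMap FourierTransform Filter Topology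

section EnergyClass

theorem sq_eLpNorm_two {α F : Type*} [MeasurableSpace α] [ENorm F] (ν : Measure α)
    (f : α → F) : eLpNorm f 2 ν ^ 2 = ∫⁻ x, ‖f x‖ₑ ^ 2 ∂ν := by
  rw [eLpNorm_eq_lintegral_rpow_enorm_toReal two_ne_zero ENNReal.ofNat_ne_top]
  simp only [ENNReal.toReal_ofNat, ENNReal.rpow_ofNat, ENNReal_sqrt_sq]

theorem MemLpLq.exists_ae_lintegral_le {F : Type*} [NormedAddCommGroup F] {f : ℝ → Plane → F}
    (h : MemLpLq ⊤ 2 f) : ∃ K < (⊤ : ℝ≥0∞), ∀ᵐ t ∂(volume : Measure ℝ).restrict (Ioi 0),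
      MemLp (f t) 2 ∧ ∫⁻ x, ‖f t x‖ₑ ^ 2 ≤ K := by
  obtain ⟨hm, hf⟩ := h
  set K := eLpNorm (fun t => eLpNorm (f t) 2 volume) ⊤ ((volume : Measure ℝ).restrict (Ioi 0))
    with hK
  refine ⟨K ^ 2, ENNReal.pow_lt_top hf, ?_⟩
  have hle : ∀ᵐ t ∂(volume : Measure ℝ).restrict (Ioi 0), eLpNorm (f t) 2 volume ≤ K := by
    have := ae_le_eLpNormEssSup (f := fun t => eLpNorm (f t) 2 volume)
      (μ := (volume : Measure ℝ).restrict (Ioi 0))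
    rw [hK, eLpNorm_exponent_top]
    filter_upwards [this] with t ht
    simpa using ht
  filter_upwards [hle, hm.prodMk_left] with t ht hmt
  refine ⟨⟨hmt, ht.trans_lt hf⟩, ?_⟩
  rw [← sq_eLpNorm_two]
  gcongr

theorem MemLpLq.lintegral_lintegral_lt_top {F : Type*} [NormedAddCommGroup F] {f : ℝ → Plane → F}
    (h : MemLpLq 2 2 f) : (∀ᵐ t ∂(volume : Measure ℝ).restrict (Ioi 0), MemLp (f t) 2) ∧
      ∫⁻ t in Ioi (0 : ℝ), ∫⁻ x, ‖f t x‖ₑ ^ 2 < ⊤ := by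
  obtain ⟨hm, hf⟩ := h
  have hi : ∫⁻ t in Ioi (0 : ℝ), ∫⁻ x, ‖f t x‖ₑ ^ 2 < ⊤ := by
    have := ENNReal.pow_lt_top (n := 2) hf
    rw [sq_eLpNorm_two] at this
    simpa only [enorm_eq_self, sq_eLpNorm_two] using this
  refine ⟨?_, hi⟩
  have hmeas : AEMeasurable (fun t => ∫⁻ x, ‖f t x‖ₑ ^ 2)
      ((volume : Measure ℝ).restrict (Ioi 0)) :=
    (hm.enorm.pow_const 2).lintegral_prod_right'
  filter_upwards [ae_lt_top' hmeas hi.ne, hm.prodMk_left] with t ht hmt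
  refine ⟨hmt, ?_⟩
  rw [← sq_eLpNorm_two] at ht
  exact lt_top_iff_ne_top.2 fun h => ht.ne (by rw [h]; simp)

theorem _root_.MeasureTheory.MemLp.coord {v : Plane → Plane} (hv : MemLp v 2) (i : Fin 2) :
    MemLp (fun x => (v x i : ℂ)) 2 :=
  MemLp.ofReal ((EuclideanSpace.proj (𝕜 := ℝ) i).comp_memLp' hv)

theorem exists_isFourier {v : Plane → ℂ} (hv : MemLp v 2) :
    ∃ V, StronglyMeasurable V ∧ IsFourier v V := by
  obtain ⟨V, h⟩ : ∃ V, IsFourier v V := ⟨_, IsFourier.of_toLp hv⟩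
  exact ⟨_, h.memLp_right.1.stronglyMeasurable_mk,
    h.congr ae_eq_rfl h.memLp_right.1.ae_eq_mk⟩

theorem enorm_le_enorm_coord_add (v : Plane) : ‖v‖ₑ ≤ ‖v 0‖ₑ + ‖v 1‖ₑ := by
  conv_lhs => rw [eq_basisVec_add v]
  refine (enorm_add_le _ _).trans (add_le_add ?_ ?_) <;>
    simp only [← ofReal_norm, norm_smul, basisVec, PiLp.norm_single, norm_one, mul_one,
      le_refl]

theorem enorm_coord_le (v : Plane) (i : Fin 2) : ‖(v i : ℂ)‖ₑ ≤ ‖v‖ₑ := by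
  rw [enorm_ofReal, ← ofReal_norm, ← ofReal_norm]
  exact ENNReal.ofReal_le_ofReal (PiLp.norm_apply_le v i)

theorem sq_mul_add_le (a : Plane) (p q : ℝ≥0∞) :
    (ENNReal.ofReal ‖a‖ * (p + q)) ^ 2 ≤
      4 * ((‖a 0‖ₑ * p) ^ 2 + (‖a 1‖ₑ * p) ^ 2 + ((‖a 0‖ₑ * q) ^ 2 + (‖a 1‖ₑ * q) ^ 2)) := by
  have h1 : (ENNReal.ofReal ‖a‖) ^ 2 ≤ 2 * (‖a 0‖ₑ ^ 2 + ‖a 1‖ₑ ^ 2) := by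
    rw [ofReal_norm]
    refine (pow_le_pow_left' (enorm_le_enorm_coord_add a) 2).trans (ENNReal_add_sq_le _ _)
  calc _ = (ENNReal.ofReal ‖a‖) ^ 2 * (p + q) ^ 2 := mul_pow _ _ _
    _ ≤ (2 * (‖a 0‖ₑ ^ 2 + ‖a 1‖ₑ ^ 2)) * (2 * (p ^ 2 + q ^ 2)) :=
        mul_le_mul' h1 (ENNReal_add_sq_le p q)
    _ = _ := by ring

theorem lintegral_enorm_add_sq_le {p : Plane → ℂ} (hp : Measurable p) (q : Plane → ℂ) :
    ∫⁻ ξ, (‖p ξ‖ₑ + ‖q ξ‖ₑ) ^ 2 ≤ 2 * ((∫⁻ ξ, ‖p ξ‖ₑ ^ 2) + ∫⁻ ξ, ‖q ξ‖ₑ ^ 2) := by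
  rw [← lintegral_add_left (hp.enorm.pow_const 2), ← lintegral_const_mul' _ _ (by simp)]
  exact lintegral_mono fun ξ => ENNReal_add_sq_le _ _

end EnergyClass

theorem IsFourier.eLpNorm_top_le {v : Plane → Plane} {V₀ V₁ : Plane → ℂ}
    (h₀ : IsFourier (fun x => (v x 0 : ℂ)) V₀) (h₁ : IsFourier (fun x => (v x 1 : ℂ)) V₁) :
    eLpNorm v ⊤ volume ≤ ∫⁻ ξ, (‖V₀ ξ‖ₑ + ‖V₁ ξ‖ₑ) := by
  rw [eLpNorm_exponent_top]
  refine essSup_le_of_ae_le _ ?_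
  filter_upwards [h₀.ae_enorm_le, h₁.ae_enorm_le] with x a b
  rw [lintegral_add_left' h₀.memLp_right.1.enorm]
  refine (enorm_le_enorm_coord_add (v x)).trans (add_le_add ?_ ?_)
  · rwa [enorm_ofReal] at a
  · rwa [enorm_ofReal] at b

theorem fourierProd_congr {v w : Plane → Plane} (h : v =ᵐ[volume] w) (i j : Fin 2) :
    fourierProd v i j = fourierProd w i j := by
  ext ξ
  refine integral_congr_ae ?_
  filter_upwards [h] with x hx
  rw [hx]

theorem vorticityRhs_congr {v w : Plane → Plane} (h : v =ᵐ[volume] w) (μ : ℝ)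
    (V₀ V₁ : Plane → ℂ) : vorticityRhs μ v V₀ V₁ = vorticityRhs μ w V₀ V₁ := by
  ext ξ
  simp only [vorticityRhs, fourierProd_congr h]

theorem IsLeraySolution.memLpLq_two_top {μ : ℝ} (hμ : 0 < μ) {u₀ : Plane → Plane}
    (hu₀ : MemLp u₀ 2 volume) {u : ℝ → Plane → Plane} (hu : IsLeraySolution μ u₀ u) :
    MemLpLq 2 (⊤ : ℝ≥0∞) u := by
  have hm := hu.memLinftyL2.1
  obtain ⟨K, hK, huK⟩ := hu.memLinftyL2.exists_ae_lintegral_le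
  obtain ⟨G, hG, hGu⟩ := hu.memL2H1
  obtain ⟨hG2, hGi⟩ := hG.lintegral_lintegral_lt_top
  obtain ⟨V₀, mV₀, hV₀⟩ := exists_isFourier (hu₀.coord 0)
  obtain ⟨V₁, mV₁, hV₁⟩ := exists_isFourier (hu₀.coord 1)
  -- Joint measurability of the transforms requires a strongly measurable representative; at almost
  -- every time it agrees with `u t` almost everywhere.
  set w : ℝ → Plane → Plane := fun t x => hm.mk _ (t, x) with hwdef
  have mw : StronglyMeasurable (Function.uncurry w) := hm.stronglyMeasurable_mk
  have hae : ∀ᵐ t ∂(volume : Measure ℝ).restrict (Ioi 0), u t =ᵐ[volume] w t :=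
    Measure.ae_ae_of_ae_prod hm.ae_eq_mk
  have mwi : ∀ i : Fin 2, StronglyMeasurable (Function.uncurry fun t x => (w t x i : ℂ)) :=
    fun i => (Complex.continuous_ofReal.comp
      (EuclideanSpace.proj (𝕜 := ℝ) i).continuous).comp_stronglyMeasurable mw
  obtain ⟨W, mW, hWw⟩ : ∃ W : Fin 2 → ℝ → Plane → ℂ,
      (∀ i, StronglyMeasurable (Function.uncurry (W i))) ∧
      ∀ i, ∀ᵐ t ∂(volume : Measure ℝ).restrict (Ioi 0),
        IsFourier (fun x => (w t x i : ℂ)) (W i t) := by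
    refine ⟨fun i => partialFourier fun t x => (w t x i : ℂ),
      fun i => stronglyMeasurable_partialFourier (mwi i), fun i => ?_⟩
    filter_upwards [hae, huK] with t ht hut
    exact isFourier_partialFourier (w := fun t x => (w t x i : ℂ)) ((hut.1.ae_eq ht).coord i)
  have hWu : ∀ i, ∀ᵐ t ∂(volume : Measure ℝ).restrict (Ioi 0),
      IsFourier (fun x => (u t x i : ℂ)) (W i t) := by
    intro i
    filter_upwards [hWw i, hae] with t h1 h2
    refine h1.congr ?_ ae_eq_rfl
    filter_upwards [h2] with x hx
    rw [hx]
  have hWK : ∀ i, ∀ᵐ t ∂(volume : Measure ℝ).restrict (Ioi 0), ∫⁻ ξ, ‖W i t ξ‖ₑ ^ 2 ≤ K := by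
    intro i
    filter_upwards [hWu i, huK] with t h1 h2
    rw [h1.lintegral_sq_eq]
    refine le_trans (lintegral_mono fun x => ?_) h2.2
    exact pow_le_pow_left' (enorm_coord_le _ i) 2
  have hWd : ∀ᵐ t ∂(volume : Measure ℝ).restrict (Ioi 0), ∀ᵐ ξ : Plane,
      (ξ 0 : ℂ) * W 0 t ξ + (ξ 1 : ℂ) * W 1 t ξ = 0 := by
    filter_upwards [hWu 0, hWu 1, hu.divFree] with t h0 h1 hd using hd.ae_eq_zero h0 h1
  have hweak : ∀ ψ : 𝓢(Plane, ℂ), HasCompactSupport ψ → ∀ θ : ℝ → ℝ, ContDiff ℝ ∞ θ →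
      HasCompactSupport θ → ∫ t in Ioi (0 : ℝ),
        (deriv θ t * (∫ ξ, vorticity (W 0 t) (W 1 t) ξ * (𝓕⁻ ψ) ξ).re +
          θ t * (∫ ξ, vorticityRhs μ (w t) (W 0 t) (W 1 t) ξ * (𝓕⁻ ψ) ξ).re) =
        -(θ 0 * (∫ ξ, vorticity V₀ V₁ ξ * (𝓕⁻ ψ) ξ).re) := by
    intro ψ hψ θ hθ hθs
    have h := hu.weakForm _ (isSolenoidalTest_smul_perpGrad hθ hθs hψ)
    rw [integral_inner_smul_perpGrad hV₀ hV₁] at h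
    rw [← h]
    refine integral_congr_ae ?_
    filter_upwards [hWu 0, hWu 1, hae] with t h0 h1 h2
    rw [integral_weakForm_integrand μ h0 h1 hθ, vorticityRhs_congr h2]
  have hD := ae_ae_le_duhamel mw (mW 0) (mW 1) (hWw 0) (hWw 1) hK (hWK 0) (hWK 1) hWd mV₀ mV₁
    hV₀.memLp_right hV₁.memLp_right hweak
  set U : ℝ → Plane → ℝ≥0∞ := fun t ξ => ‖W 0 t ξ‖ₑ + ‖W 1 t ξ‖ₑ with hU
  have mW' : ∀ i t, Measurable (W i t) := fun i t =>
    (mW i).measurable.comp measurable_prodMk_left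
  have mU : Measurable (Function.uncurry U) := (mW 0).measurable.enorm.add (mW 1).measurable.enorm
  have hU₀ : ∫⁻ ξ, (‖V₀ ξ‖ₑ + ‖V₁ ξ‖ₑ) ^ 2 < ⊤ := by
    refine lt_of_le_of_lt (lintegral_enorm_add_sq_le mV₀.measurable V₁) ?_
    rw [hV₀.lintegral_sq_eq, hV₁.lintegral_sq_eq, ← sq_eLpNorm_two, ← sq_eLpNorm_two]
    exact ENNReal.mul_lt_top (by simp) (ENNReal.add_lt_top.2
      ⟨ENNReal.pow_lt_top hV₀.memLp_left.2, ENNReal.pow_lt_top hV₁.memLp_left.2⟩)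
  have hUL2 : ∀ᵐ t ∂(volume : Measure ℝ).restrict (Ioi 0), ∫⁻ ξ, U t ξ ^ 2 ≤ 2 * (K + K) := by
    filter_upwards [hWK 0, hWK 1] with t h0 h1
    exact (lintegral_enorm_add_sq_le (mW' 0 t) _).trans (by gcongr)
  have hUH1 : ∫⁻ t in Ioi (0 : ℝ), ∫⁻ ξ, (ENNReal.ofReal ‖ξ‖ * U t ξ) ^ 2 < ⊤ := by
    -- The factor `16` is the constant `4` of `sq_mul_add_le` times four pairs of direction and
    -- component, each bounded by the full gradient.
    have hle : ∀ᵐ t ∂(volume : Measure ℝ).restrict (Ioi 0),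
        ∫⁻ ξ, (ENNReal.ofReal ‖ξ‖ * U t ξ) ^ 2 ≤ 16 * ∫⁻ x, ‖G t x‖ₑ ^ 2 := by
      filter_upwards [hWu 0, hWu 1, hGu, hG2, huK] with t h0 h1 hw hg hut
      have mk : ∀ k : Fin 2, Measurable fun ξ : Plane => ‖ξ k‖ₑ := fun k => by fun_prop
      have m : ∀ k i : Fin 2, Measurable fun ξ : Plane => (‖ξ k‖ₑ * ‖W i t ξ‖ₑ) ^ 2 :=
        fun k i => ((mk k).mul (mW' i t).enorm).pow_const 2
      have m₂ : Measurable fun ξ : Plane =>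
          (‖ξ 0‖ₑ * ‖W 0 t ξ‖ₑ) ^ 2 + (‖ξ 1‖ₑ * ‖W 0 t ξ‖ₑ) ^ 2 := (m 0 0).add (m 1 0)
      refine (lintegral_mono fun ξ => sq_mul_add_le ξ _ _).trans ?_
      rw [lintegral_const_mul' _ _ (by simp),
        lintegral_add_left m₂, lintegral_add_left (m 0 0),
        lintegral_add_left (m 0 1)]
      calc _ ≤ 4 * ((∫⁻ x, ‖G t x‖ₑ ^ 2) + (∫⁻ x, ‖G t x‖ₑ ^ 2) +
            ((∫⁻ x, ‖G t x‖ₑ ^ 2) + ∫⁻ x, ‖G t x‖ₑ ^ 2)) := by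
            refine mul_le_mul_right (add_le_add (add_le_add ?_ ?_) (add_le_add ?_ ?_)) _
            · exact hw.lintegral_le hut.1 hg h0 0
            · exact hw.lintegral_le hut.1 hg h0 1
            · exact hw.lintegral_le hut.1 hg h1 0
            · exact hw.lintegral_le hut.1 hg h1 1
        _ = _ := by ring
    refine lt_of_le_of_lt (lintegral_mono_ae hle) ?_
    rw [lintegral_const_mul' _ _ (by simp)]
    exact ENNReal.mul_lt_top (by simp) hGi
  have hfin := lintegral_sq_lintegral_lt_top_of_duhamel (κ := 4 * Real.pi ^ 2 * μ)
    (by positivity) mU (mV₀.measurable.enorm.add mV₁.measurable.enorm) hU₀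
    (ENNReal.mul_lt_top (by simp) (ENNReal.add_lt_top.2 ⟨hK, hK⟩)) hUL2 hUH1
    ENNReal.ofReal_lt_top hD
  refine ⟨hm, ?_⟩
  have hle : ∀ᵐ t ∂(volume : Measure ℝ).restrict (Ioi 0),
      eLpNorm (u t) ⊤ volume ≤ ∫⁻ ξ, U t ξ := by
    filter_upwards [hWu 0, hWu 1] with t h0 h1 using h0.eLpNorm_top_le h1
  have : eLpNorm (fun t => eLpNorm (u t) ⊤ volume) 2 ((volume : Measure ℝ).restrict (Ioi 0)) ^ 2
      < ⊤ := by
    rw [sq_eLpNorm_two]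
    refine lt_of_le_of_lt (lintegral_mono_ae ?_) hfin
    filter_upwards [hle] with t ht
    rw [enorm_eq_self]
    gcongr
  exact lt_top_iff_ne_top.2 fun h => this.ne (by rw [h]; simp)

end NavierStokes2D

theorem corollary3p3 (μ : ℝ) (hμ : 0 < μ)
    (u₀ : NavierStokes2D.Plane → NavierStokes2D.Plane)
    (hu₀ : MemLp u₀ 2 volume) (hdiv : NavierStokes2D.IsWeaklyDivergenceFree u₀)
    (u : ℝ → NavierStokes2D.Plane → NavierStokes2D.Plane)
    (hu : NavierStokes2D.IsLeraySolution μ u₀ u) :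
    NavierStokes2D.MemLpLq 2 (⊤ : ℝ≥0∞) u :=
  hu.memLpLq_two_top hμ hu₀
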